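/- Let $R$ be a commutative ring. **Conventions.** $\mathcal M$ is the category of positively graded $R$-modules $N=(N_i)_{i\ge 1}$; $M[n]$ denotes the graded module with the $R$-module $M$ in degree $n$ and $0$ elsewhere. $\mathcal A$ is the category of connected graded $R$-algebras (graded by $\mathbb Z_{\ge 0}$, associative, unital, with unit map $R\to A_0$ an isomorphism) and $\mathcal C$ the category of connected graded $R$-coalgebras (graded by $\mathbb Z_{\ge 0}$, coassociative, counital, with counit $C_0\to R$ an isomorphism). Comonoids and cogroups in $\mathcal A$ are taken with respect to the categorical coproduct $*$ of $\mathcal A$; $\mathcal A_{CM}$ is the category of comonoids in $\mathcal A$, and $\mathcal A_{CG}$ its full subcategory of cogroups. $\mathcal A_{CG}^{co}$ is the full subcategory of $\mathcal A_{CG}$ of those cogroups whose underlying graded algebra is graded commutative ($ab=(-1)^{pq}ba$ for $a\in A_p$, $b\in A_q$), and $\mathcal A_{CG}^{co\,ft}$ the full subcategory of $\mathcal A_{CG}^{co}$ of those of finite type (each $A_n$ is a finitely generated $R$-module). The functor $C:\mathcal M\to\mathcal C$ sends $N$ to $R[0]\oplus N$ with $\Delta(1)=1\otimes 1$ and $\Delta(x)=x\otimes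 1+1\otimes x$ for $x\in N$. The functor $T_{CM}:\mathcal C\to\mathcal A_{CM}$ sends a coalgebra $C$ to the tensor algebra $T(\overline C)$, $\overline C=\bigoplus_{n>0}C_n$, with comultiplication $\Phi:T(\overline C)\to T(\overline C)*T(\overline C)$ determined by $\Phi(x)=x'+x''+\sum y_i'z_i''$ for $x\in\overline C$ with $\Delta(x)=x\otimes 1+1\otimes x+\sum y_i\otimes z_i$ ($y_i,z_i\in\overline C$), where $'$ and $''$ denote the inclusions of the first and the second factor. $\mathcal S$ is the full subcategory of $\mathcal M$ of the locally at most singly generated $N$: for every maximal ideal $\mathfrak m$ of $R$, the localization $N_{\mathfrak m}$ is isomorphic, as a graded $R_{\mathfrak m}$-module, to $0$ or to $(R_{\mathfrak m}/\mathfrak a_{\mathfrak m})[n]$ for some ideal $\mathfrak a\subseteq\mathfrak m$ and some $n\ge 1$, where $n$ is even if $\operatorname{ch}(R_{\mathfrak m}/\mathfrak a_{\mathfrak m})\ne 2$. $\mathcal S^{ft}$ is the full subcategory of $\mathcal S$ of those $N$ with every $N_i$ finitely generated over $R$. $\mathcal F$ is the full subcategory of the graded modules isomorphic to one of $0,R[1],R[2],R[3],\dots$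 if $\operatorname{ch}R=2$, and to one of $0,R[2],R[4],\dots$ if $\operatorname{ch}R\ne 2$. **Theorem 1.4.** 1. $T_{CM}\circ C$ restricts to a fully faithful functor $\mathcal S\to\mathcal A_{CG}^{co}$. 2. If $R$ is a field, then $T_{CM}\circ C$ restricts to an equivalence of categories $\mathcal F\to\mathcal A_{CG}^{co}$. 3. $T_{CM}\circ C$ restricts to an equivalence of categories $\mathcal S^{ft}\to\mathcal A_{CG}^{co\,ft}$. -/

import Mathlib

open CategoryTheory CategoryTheory.Limits
open scoped TensorProduct DirectSum

universe u

noncomputable section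

namespace ConnGr

section WordGrading

variable {R A B : Type*} [CommRing R] [Ring A] [Algebra R A] [Ring B] [Algebra R B]

/-- Products `s₁ ⋯ sₖ` of elements `sᵢ ∈ S dᵢ`, with total degree `d₁ + ⋯ + dₖ`. -/
inductive IsWord (S : ℕ → Set A) : ℕ → A → Prop
  | one : IsWord S 0 1
  | cons {d n : ℕ} {s x : A} (hs : s ∈ S d) (hx : IsWord S n x) : IsWord S (d + n) (s * x)

variable (R) in
/-- The grading of an algebra determined by generators `s ∈ S d` which are declared to have
degree `d`: the part of degree `n` is spanned by the words of total degree `n`. -/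
def wordGrading (S : ℕ → Set A) (n : ℕ) : Submodule R A :=
  Submodule.span R {x | IsWord S n x}

theorem IsWord.mul {S : ℕ → Set A} {m n : ℕ} {x y : A} (hx : IsWord S m x) (hy : IsWord S n y) :
    IsWord S (m + n) (x * y) := by
  induction hx with
  | one => simpa using hy
  | cons hs _ ih => rw [add_assoc, mul_assoc]; exact IsWord.cons hs ih

theorem subset_wordGrading {S : ℕ → Set A} {d : ℕ} {s : A} (hs : s ∈ S d) :
    s ∈ wordGrading R S d := by
  have := IsWord.cons hs IsWord.one
  rw [mul_one, add_zero] at this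
  exact Submodule.subset_span this

instance wordGrading_gradedMonoid (S : ℕ → Set A) :
    SetLike.GradedMonoid (wordGrading R S) where
  one_mem := Submodule.subset_span IsWord.one
  mul_mem := by
    intro i j x y hx hy
    have h := Submodule.mul_mem_mul hx hy
    rw [wordGrading, wordGrading, Submodule.span_mul_span] at h
    refine Submodule.span_mono ?_ h
    rintro _ ⟨a, ha, b, hb, rfl⟩
    exact IsWord.mul ha hb

theorem map_mem_of_wordGrading {S : ℕ → Set A} (𝓑 : ℕ → Submodule R B) [SetLike.GradedMonoid 𝓑]
    (f : A →ₐ[R] B) (hf : ∀ d, ∀ s ∈ S d, f s ∈ 𝓑 d) {n : ℕ} {x : A}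
    (hx : x ∈ wordGrading R S n) : f x ∈ 𝓑 n := by
  refine (Submodule.span_le (p := (𝓑 n).comap f.toLinearMap)).2 ?_ hx
  intro y hy
  change f y ∈ 𝓑 n
  clear hx x
  induction hy with
  | one => rw [map_one]; exact SetLike.GradedOne.one_mem
  | cons hs _ ih =>
    rw [map_mul]
    exact SetLike.GradedMul.mul_mem (hf _ _ hs) ih

theorem wordGrading_zero {S : ℕ → Set A}
    (hS : ∀ s ∈ S 0, s ∈ LinearMap.range (Algebra.linearMap R A)) :
    wordGrading R S 0 = LinearMap.range (Algebra.linearMap R A) := by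
  apply le_antisymm
  · refine Submodule.span_le.2 ?_
    have key : ∀ n x, IsWord S n x → n = 0 → x ∈ LinearMap.range (Algebra.linearMap R A) := by
      intro n x hx
      induction hx with
      | one => intro _; exact ⟨1, by simp⟩
      | @cons d n s x hs _ ih =>
        intro h
        obtain ⟨rfl, rfl⟩ : d = 0 ∧ n = 0 := by omega
        obtain ⟨a, rfl⟩ := hS _ hs
        obtain ⟨b, rfl⟩ := ih rfl
        exact ⟨a * b, by simp⟩
    intro x hx
    exact key 0 x hx rfl
  · rintro _ ⟨r, rfl⟩
    rw [Algebra.linearMap_apply, Algebra.algebraMap_eq_smul_one]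
    exact Submodule.smul_mem _ _ (Submodule.subset_span IsWord.one)

/-- The word grading is a grading as soon as the generators generate and there is an algebra
homomorphism to the external direct sum which places the generators in their degrees. -/
abbrev wordGradedAlgebra (S : ℕ → Set A) (hS : Algebra.adjoin R (⋃ d, S d) = ⊤)
    (f : A →ₐ[R] ⨁ n, wordGrading R S n)
    (hf : ∀ d s (hs : s ∈ S d),
      f s = DirectSum.of (fun n => wordGrading R S n) d ⟨s, subset_wordGrading hs⟩) :
    GradedAlgebra (wordGrading R S) :=
  GradedAlgebra.ofAlgHom _ f
    (by
      refine AlgHom.ext_of_adjoin_eq_top hS ?_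
      intro s hs
      obtain ⟨d, hd⟩ := Set.mem_iUnion.1 hs
      simp [hf d s hd])
    (by
      rintro n ⟨x, hx⟩
      have key : ∀ n x, IsWord S n x → ∀ hx : x ∈ wordGrading R S n,
          f x = DirectSum.of (fun n => wordGrading R S n) n ⟨x, hx⟩ := by
        intro n x hw
        induction hw with
        | one => intro _; rw [map_one]; rfl
        | @cons d n s x hs hw ih =>
          intro h
          rw [map_mul, hf d s hs, ih (Submodule.subset_span hw), DirectSum.of_mul_of]
          rfl
      change f x = DirectSum.of (fun n => wordGrading R S n) n ⟨x, hx⟩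
      have h2 : ∀ y : wordGrading R S n, f y = DirectSum.lof R ℕ (fun n => wordGrading R S n) n y := by
        rintro ⟨y, hy⟩
        induction hy using Submodule.span_induction with
        | mem y hy => exact key n y hy _
        | zero => simp only [map_zero]; exact (map_zero _).symm
        | add a b ha hb iha ihb =>
          have : (⟨a + b, add_mem ha hb⟩ : wordGrading R S n) = ⟨a, ha⟩ + ⟨b, hb⟩ := rfl
          exact (map_add f a b).trans ((congrArg₂ (· + ·) iha ihb).trans (map_add _ _ _).symm)
        | smul r a ha iha =>
          exact (map_smul f r a).trans ((congrArg (r • ·) iha).trans (map_smul _ _ _).symm)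
      exact h2 ⟨x, hx⟩)

/-- The map of external direct sums induced by an algebra homomorphism that respects gradings. -/
def directSumMap (𝓐 : ℕ → Submodule R A) [SetLike.GradedMonoid 𝓐] (𝓑 : ℕ → Submodule R B)
    [SetLike.GradedMonoid 𝓑] (f : A →ₐ[R] B) (hf : ∀ n, ∀ a ∈ 𝓐 n, f a ∈ 𝓑 n) :
    (⨁ n, 𝓐 n) →ₐ[R] ⨁ n, 𝓑 n :=
  DirectSum.toAlgebra R (fun n => 𝓐 n)
    (fun n => DirectSum.lof R ℕ (fun n => 𝓑 n) n ∘ₗ f.toLinearMap.restrict (hf n))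
    (by
      change DirectSum.of (fun n => 𝓑 n) 0 _ = 1
      rw [DirectSum.one_def]
      congr 1
      exact Subtype.ext (map_one f))
    (by
      intro i j a b
      change DirectSum.of (fun n => 𝓑 n) (i + j) _ =
        DirectSum.of (fun n => 𝓑 n) i _ * DirectSum.of (fun n => 𝓑 n) j _
      rw [DirectSum.of_mul_of]
      congr 1
      exact Subtype.ext (map_mul f _ _))

theorem directSumMap_of (𝓐 : ℕ → Submodule R A) [SetLike.GradedMonoid 𝓐]
    (𝓑 : ℕ → Submodule R B) [SetLike.GradedMonoid 𝓑] (f : A →ₐ[R] B)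
    (hf : ∀ n, ∀ a ∈ 𝓐 n, f a ∈ 𝓑 n) (n : ℕ) (a : 𝓐 n) :
    directSumMap 𝓐 𝓑 f hf (DirectSum.of (fun n => 𝓐 n) n a) =
      DirectSum.of (fun n => 𝓑 n) n ⟨f a, hf n a a.2⟩ :=
  DirectSum.toAddMonoid_of (β := fun n => 𝓐 n)
    (fun n => (DirectSum.lof R ℕ (fun n => 𝓑 n) n ∘ₗ
      f.toLinearMap.restrict (hf n)).toAddMonoidHom) n a

end WordGrading

end ConnGr

/-- A connected graded `R`-algebra: a graded associative unital algebra `A = ⨁ₙ Aₙ` (indexed by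
`n ≥ 0`) whose unit `R → A₀` is an isomorphism. -/
structure ConnGrAlg (R : Type u) [CommRing R] where
  carrier : Type u
  [ring : Ring carrier]
  [algebra : Algebra R carrier]
  gr : ℕ → Submodule R carrier
  [graded : GradedAlgebra gr]
  algebraMap_injective : Function.Injective (algebraMap R carrier)
  gr_zero : gr 0 = LinearMap.range (Algebra.linearMap R carrier)

namespace ConnGrAlg

attribute [instance] ConnGrAlg.ring ConnGrAlg.algebra ConnGrAlg.graded

variable {R : Type u} [CommRing R]

/-- Morphisms of connected graded algebras: degree-preserving homomorphisms of algebras. -/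
@[ext]
structure Hom (A B : ConnGrAlg R) where
  alg : A.gr →ₐᵍ[R] B.gr

instance : Category (ConnGrAlg R) where
  Hom A B := Hom A B
  id A := ⟨GradedAlgHom.id R A.gr⟩
  comp f g := ⟨g.alg.comp f.alg⟩

/-- The underlying homomorphism of algebras. -/
def toAlgHom {A B : ConnGrAlg R} (f : A ⟶ B) : A.carrier →ₐ[R] B.carrier := f.alg.toAlgHom

theorem toAlgHom_mem {A B : ConnGrAlg R} (f : A ⟶ B) {n : ℕ} {a : A.carrier} (ha : a ∈ A.gr n) :
    toAlgHom f a ∈ B.gr n := f.alg.map_mem ha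

/-- Construct a morphism from a degree-preserving algebra homomorphism. -/
def ofAlgHom {A B : ConnGrAlg R} (f : A.carrier →ₐ[R] B.carrier)
    (hf : ∀ n, ∀ a ∈ A.gr n, f a ∈ B.gr n) : A ⟶ B :=
  ⟨{ f with map_mem := fun h => hf _ _ h }⟩

@[simp] theorem toAlgHom_ofAlgHom {A B : ConnGrAlg R} (f : A.carrier →ₐ[R] B.carrier)
    (hf : ∀ n, ∀ a ∈ A.gr n, f a ∈ B.gr n) : toAlgHom (ofAlgHom f hf) = f := rfl

@[simp] theorem toAlgHom_id (A : ConnGrAlg R) : toAlgHom (𝟙 A) = AlgHom.id R A.carrier := rfl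

@[simp] theorem toAlgHom_comp {A B C : ConnGrAlg R} (f : A ⟶ B) (g : B ⟶ C) :
    toAlgHom (f ≫ g) = (toAlgHom g).comp (toAlgHom f) := rfl

theorem hom_ext {A B : ConnGrAlg R} {f g : A ⟶ B} (h : toAlgHom f = toAlgHom g) : f = g :=
  Hom.ext (GradedAlgHom.coe_toAlgHom_injective h)

theorem algebraMap_mem (A : ConnGrAlg R) (r : R) : algebraMap R A.carrier r ∈ A.gr 0 := by
  rw [A.gr_zero]; exact ⟨r, rfl⟩

/-- The projection of `A` to `A₀`. -/
def projZero (A : ConnGrAlg R) : A.carrier →ₐ[R] A.carrier :=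
  { GradedRing.projZeroRingHom A.gr with
    commutes' := fun r => DirectSum.decompose_of_mem_same A.gr (A.algebraMap_mem r) }

theorem projZero_mem (A : ConnGrAlg R) (a : A.carrier) :
    A.projZero a ∈ (Algebra.ofId R A.carrier).range := by
  have h : A.projZero a ∈ A.gr 0 := (DirectSum.decompose A.gr a 0).2
  rw [A.gr_zero] at h
  exact h

/-- The augmentation `A → A₀ ≅ R`. -/
def augmentation (A : ConnGrAlg R) : A.carrier →ₐ[R] R :=
  (AlgEquiv.ofInjective (Algebra.ofId R A.carrier) A.algebraMap_injective).symm.toAlgHom.comp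
    (A.projZero.codRestrict _ A.projZero_mem)

end ConnGrAlg

namespace ConnGrAlg

variable {R : Type u} [CommRing R]

section Coproduct

variable {J : Type} [DecidableEq J] (A : J → ConnGrAlg R)

/-- The free product of the underlying algebras. -/
def FreeProd : Type u := LinearAlgebra.FreeProduct R (fun j => (A j).carrier)

instance : Ring (FreeProd A) :=
  inferInstanceAs (Ring (LinearAlgebra.FreeProduct R (fun j => (A j).carrier)))

instance : Algebra R (FreeProd A) :=
  inferInstanceAs (Algebra R (LinearAlgebra.FreeProduct R (fun j => (A j).carrier)))

/-- The inclusion of a factor into the free product. -/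
def FreeProd.ι (j : J) : (A j).carrier →ₐ[R] FreeProd A :=
  LinearAlgebra.FreeProduct.ι R (fun j => (A j).carrier) j

/-- The homomorphism from the free product induced by homomorphisms from the factors. -/
def FreeProd.lift {B : Type*} [Semiring B] [Algebra R B] (f : ∀ j, (A j).carrier →ₐ[R] B) :
    FreeProd A →ₐ[R] B :=
  LinearAlgebra.FreeProduct.lift R (fun j => (A j).carrier) (fun {j} => f j)

variable {A} in
theorem FreeProd.ext {B : Type*} [Semiring B] [Algebra R B] {f g : FreeProd A →ₐ[R] B}
    (h : ∀ j a, f (FreeProd.ι A j a) = g (FreeProd.ι A j a)) : f = g := by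
  apply (LinearAlgebra.FreeProduct.lift R (fun j => (A j).carrier)).symm.injective
  funext j
  exact AlgHom.ext (h j)

theorem FreeProd.lift_ι {B : Type*} [Semiring B] [Algebra R B]
    (f : ∀ j, (A j).carrier →ₐ[R] B) (j : J) (a : (A j).carrier) :
    FreeProd.lift A f (FreeProd.ι A j a) = f j a :=
  AlgHom.congr_fun (LinearAlgebra.FreeProduct.lift_comp_ι R (fun j => (A j).carrier)
    (fun {j} => f j)) a

/-- The homogeneous elements of the factors, which generate the free product. -/
def coprodGens (d : ℕ) : Set (FreeProd A) := {x | ∃ j, ∃ a ∈ (A j).gr d, FreeProd.ι A j a = x}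

theorem ι_mem_coprod (j : J) (n : ℕ) (a : (A j).carrier) (ha : a ∈ (A j).gr n) :
    FreeProd.ι A j a ∈ ConnGr.wordGrading R (coprodGens A) n :=
  ConnGr.subset_wordGrading ⟨j, a, ha, rfl⟩

theorem adjoin_coprodGens : Algebra.adjoin R (⋃ d, coprodGens A d) = ⊤ := by
  have hmem : ∀ j a, FreeProd.ι A j a ∈ Algebra.adjoin R (⋃ d, coprodGens A d) := by
    intro j a
    induction a using DirectSum.Decomposition.inductionOn (A j).gr with
    | zero => rw [map_zero]; exact zero_mem _
    | @homogeneous i m => exact Algebra.subset_adjoin (Set.mem_iUnion.2 ⟨i, j, m, m.2, rfl⟩)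
    | add m m' h h' => rw [map_add]; exact add_mem h h'
  have hf : (Algebra.adjoin R (⋃ d, coprodGens A d)).val.comp
      (FreeProd.lift A fun j => (FreeProd.ι A j).codRestrict _ (hmem j)) = AlgHom.id R _ := by
    apply FreeProd.ext
    intro j a
    rw [AlgHom.comp_apply, FreeProd.lift_ι]
    rfl
  rw [eq_top_iff]
  intro x _
  have := AlgHom.congr_fun hf x
  rw [AlgHom.id_apply] at this
  rw [← this]
  exact Subtype.property _

instance coprodGraded : GradedAlgebra (ConnGr.wordGrading R (coprodGens A)) :=
  ConnGr.wordGradedAlgebra (coprodGens A) (adjoin_coprodGens A)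
    (FreeProd.lift A fun j =>
      (ConnGr.directSumMap (A j).gr (ConnGr.wordGrading R (coprodGens A))
        (FreeProd.ι A j) (ι_mem_coprod A j)).comp
        (DirectSum.decomposeAlgEquiv (A j).gr).toAlgHom)
    (by
      rintro d _ ⟨j, a, ha, rfl⟩
      rw [FreeProd.lift_ι]
      change ConnGr.directSumMap _ _ _ _ (DirectSum.decompose (A j).gr a) = _
      rw [DirectSum.decompose_of_mem _ ha, ConnGr.directSumMap_of])

/-- The free product of connected graded algebras. -/
def coprodObj : ConnGrAlg R where
  carrier := FreeProd A
  gr := ConnGr.wordGrading R (coprodGens A)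
  algebraMap_injective := by
    apply Function.LeftInverse.injective (g := FreeProd.lift A (fun j => (A j).augmentation))
    intro r
    rw [AlgHom.commutes]
    rfl
  gr_zero := by
    apply ConnGr.wordGrading_zero
    rintro _ ⟨j, a, ha, rfl⟩
    rw [(A j).gr_zero] at ha
    obtain ⟨r, rfl⟩ := ha
    exact ⟨r, by simp⟩

/-- The free product with the canonical inclusions of the factors. -/
def coprodCofan : Cofan A :=
  Cofan.mk (coprodObj A) (fun j => ofAlgHom (B := coprodObj A) (FreeProd.ι A j) (ι_mem_coprod A j))

/-- The free product is the coproduct of connected graded algebras. -/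
def coprodCofanIsColimit : IsColimit (coprodCofan A) :=
  Cofan.IsColimit.mk _
    (fun s => ofAlgHom (A := coprodObj A) (FreeProd.lift A (fun j => toAlgHom (s.inj j)))
      (fun n x hx => by
        refine ConnGr.map_mem_of_wordGrading s.pt.gr _ ?_ hx
        rintro d _ ⟨j, a, ha, rfl⟩
        have h := FreeProd.lift_ι A (fun j => toAlgHom (s.inj j)) j a
        exact h ▸ toAlgHom_mem (s.inj j) ha))
    (fun s j => hom_ext (AlgHom.ext fun a => FreeProd.lift_ι A _ j a))
    (fun s m hm => hom_ext (FreeProd.ext (fun j a => by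
      refine Eq.trans ?_ (FreeProd.lift_ι A _ j a).symm
      rw [← hm j]
      rfl)))

end Coproduct

open Classical in
instance : HasCoproducts.{0} (ConnGrAlg R) :=
  hasCoproducts_of_colimit_cofans (fun A => coprodCofan A) (fun A => coprodCofanIsColimit A)

instance : HasFiniteCoproducts (ConnGrAlg R) := hasFiniteCoproducts_of_hasCoproducts.{0} _

/-- The monoidal structure on connected graded algebras given by the categorical coproduct `A ∗ B`
(its unit is the initial object `R`). -/
instance : MonoidalCategory (ConnGrAlg R) := monoidalOfHasFiniteCoproducts _

end ConnGrAlg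

/-- The category of positively graded `R`-modules `N = (N₁, N₂, …)`. -/
abbrev PosGrMod (R : Type u) [CommRing R] := GradedObject ℕ+ (ModuleCat.{u} R)

namespace PosGrMod

variable {R : Type u} [CommRing R] (N : PosGrMod R)

/-- The tensor algebra `T(N)` on (the total module of) a positively graded module. -/
abbrev TensorAlg : Type u := TensorAlgebra R (⨁ i : ℕ+, N i)

/-- The inclusion of a homogeneous component into the tensor algebra. -/
def gen (i : ℕ+) : N i →ₗ[R] TensorAlg N :=
  TensorAlgebra.ι R ∘ₗ DirectSum.lof R ℕ+ (fun i => N i) i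

/-- The generators of `T(N)` of degree `d`. -/
def gens (d : ℕ) : Set (TensorAlg N) := {x | ∃ i : ℕ+, (i : ℕ) = d ∧ ∃ y : N i, gen N i y = x}

theorem gen_mem (i : ℕ+) (y : N i) : gen N i y ∈ ConnGr.wordGrading R (gens N) i :=
  ConnGr.subset_wordGrading ⟨i, rfl, y, rfl⟩

variable {N} in
theorem tensorAlg_ext {B : Type*} [Semiring B] [Algebra R B] {f g : TensorAlg N →ₐ[R] B}
    (h : ∀ i y, f (gen N i y) = g (gen N i y)) : f = g := by
  apply TensorAlgebra.hom_ext
  apply DirectSum.linearMap_ext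
  intro i
  exact LinearMap.ext (h i)

/-- The algebra homomorphism `T(N) → B` induced by linear maps `Nᵢ → B`. -/
def liftAlg {B : Type*} [Semiring B] [Algebra R B] (g : ∀ i : ℕ+, N i →ₗ[R] B) :
    TensorAlg N →ₐ[R] B :=
  TensorAlgebra.lift R (DirectSum.toModule R ℕ+ B g)

theorem liftAlg_gen {B : Type*} [Semiring B] [Algebra R B] (g : ∀ i : ℕ+, N i →ₗ[R] B)
    (i : ℕ+) (y : N i) : liftAlg N g (gen N i y) = g i y := by
  simp [liftAlg, gen]

theorem adjoin_gens : Algebra.adjoin R (⋃ d, gens N d) = ⊤ := by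
  have hmem : ∀ i y, gen N i y ∈ Algebra.adjoin R (⋃ d, gens N d) := fun i y =>
    Algebra.subset_adjoin (Set.mem_iUnion.2 ⟨i, i, rfl, y, rfl⟩)
  have hf : (Algebra.adjoin R (⋃ d, gens N d)).val.comp
      (liftAlg N fun i => (gen N i).codRestrict
        (Subalgebra.toSubmodule (Algebra.adjoin R (⋃ d, gens N d))) (hmem i)) =
      AlgHom.id R _ := by
    apply tensorAlg_ext
    intro i y
    rw [AlgHom.comp_apply]
    exact congrArg Subtype.val (liftAlg_gen N _ i y)
  rw [eq_top_iff]
  intro x _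
  have := AlgHom.congr_fun hf x
  rw [AlgHom.id_apply] at this
  rw [← this]
  exact Subtype.property _

instance tensorAlgGraded : GradedAlgebra (ConnGr.wordGrading R (gens N)) :=
  ConnGr.wordGradedAlgebra (gens N) (adjoin_gens N)
    (liftAlg N fun i =>
      DirectSum.lof R ℕ (fun n => ConnGr.wordGrading R (gens N) n) i ∘ₗ
        (gen N i).codRestrict _ (gen_mem N i))
    (by
      rintro _ _ ⟨i, rfl, y, rfl⟩
      rw [liftAlg_gen]
      rfl)

/-- The tensor algebra `T(N)` of a positively graded module, as a connected graded algebra: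
`x₁ ⊗ ⋯ ⊗ xₖ` with `xⱼ` homogeneous has degree `|x₁| + ⋯ + |xₖ|`. -/
def tensorObj : ConnGrAlg R where
  carrier := TensorAlg N
  gr := ConnGr.wordGrading R (gens N)
  algebraMap_injective := (TensorAlgebra.algebraMap_leftInverse _).injective
  gr_zero := by
    apply ConnGr.wordGrading_zero
    rintro _ ⟨i, hi, -⟩
    exact absurd hi i.pos.ne'

/-- The morphism `T(N) → B` in the category of connected graded algebras induced by
degree-preserving linear maps. -/
def tensorDesc {B : ConnGrAlg R} (g : ∀ i : ℕ+, N i →ₗ[R] B.carrier)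
    (hg : ∀ (i : ℕ+) (y : N i), g i y ∈ B.gr i) : tensorObj N ⟶ B :=
  ConnGrAlg.ofAlgHom (A := tensorObj N) (liftAlg N g) (fun n x hx => by
    refine ConnGr.map_mem_of_wordGrading B.gr _ ?_ hx
    rintro _ _ ⟨i, rfl, y, rfl⟩
    exact (liftAlg_gen N g i y).symm ▸ hg i y)

theorem tensorDesc_gen {B : ConnGrAlg R} (g : ∀ i : ℕ+, N i →ₗ[R] B.carrier)
    (hg : ∀ (i : ℕ+) (y : N i), g i y ∈ B.gr i) (i : ℕ+) (y : N i) :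
    ConnGrAlg.toAlgHom (tensorDesc N g hg) (gen N i y) = g i y :=
  liftAlg_gen N g i y

variable {N} in
theorem tensorObj_hom_ext {B : ConnGrAlg R} {f g : tensorObj N ⟶ B}
    (h : ∀ i y, ConnGrAlg.toAlgHom f (gen N i y) = ConnGrAlg.toAlgHom g (gen N i y)) : f = g :=
  ConnGrAlg.hom_ext (tensorAlg_ext h)

end PosGrMod

/-- A connected graded `R`-coalgebra: a coassociative counital coalgebra `C = ⨁ₙ Cₙ` (indexed by
`n ≥ 0`) whose comultiplication and counit preserve degrees, and such that the counit
`C₀ → R` is an isomorphism. -/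
structure ConnGrCoalg (R : Type u) [CommRing R] where
  carrier : Type u
  [addCommGroup : AddCommGroup carrier]
  [module : Module R carrier]
  [coalgebra : Coalgebra R carrier]
  gr : ℕ → Submodule R carrier
  [decomposition : DirectSum.Decomposition gr]
  comul_mem : ∀ n, ∀ x ∈ gr n, Coalgebra.comul (R := R) x ∈
    ⨆ (p : ℕ × ℕ) (_ : p.1 + p.2 = n),
      LinearMap.range (TensorProduct.map (gr p.1).subtype (gr p.2).subtype)
  counit_eq_zero : ∀ n, n ≠ 0 → ∀ x ∈ gr n, Coalgebra.counit (R := R) x = 0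
  counit_bijective : Function.Bijective (fun x : gr 0 => Coalgebra.counit (R := R) (x : carrier))

namespace ConnGrCoalg

attribute [instance] ConnGrCoalg.addCommGroup ConnGrCoalg.module ConnGrCoalg.coalgebra
  ConnGrCoalg.decomposition

variable {R : Type u} [CommRing R]

/-- Morphisms of connected graded coalgebras: degree-preserving homomorphisms of coalgebras. -/
@[ext]
structure Hom (C D : ConnGrCoalg R) where
  coalg : C.carrier →ₗc[R] D.carrier
  map_mem : ∀ n, ∀ x ∈ C.gr n, coalg x ∈ D.gr n

instance : Category (ConnGrCoalg R) where
  Hom C D := Hom C D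
  id C := ⟨CoalgHom.id R C.carrier, fun _ _ h => h⟩
  comp f g := ⟨g.coalg.comp f.coalg, fun n x h => g.map_mem n _ (f.map_mem n x h)⟩

/-- The underlying homomorphism of coalgebras. -/
def toCoalgHom {C D : ConnGrCoalg R} (f : C ⟶ D) : C.carrier →ₗc[R] D.carrier := f.coalg

theorem toCoalgHom_mem {C D : ConnGrCoalg R} (f : C ⟶ D) {n : ℕ} {x : C.carrier}
    (hx : x ∈ C.gr n) : toCoalgHom f x ∈ D.gr n := f.map_mem n x hx

theorem hom_ext {C D : ConnGrCoalg R} {f g : C ⟶ D} (h : toCoalgHom f = toCoalgHom g) : f = g :=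
  Hom.ext h

/-- The positively graded module `C̄ = ⨁_{n > 0} Cₙ` of a connected graded coalgebra. -/
def bar : ConnGrCoalg R ⥤ PosGrMod R where
  obj C := fun i => ModuleCat.of R (C.gr i)
  map f := fun i => ModuleCat.ofHom
    ((toCoalgHom f).toLinearMap.restrict (fun _ hx => toCoalgHom_mem f hx))

variable (C : ConnGrCoalg R)

/-- The canonical map `j : C → T(C̄)`: the inclusion of generators on `C̄` and the isomorphism
`C₀ ≅ R` followed by the unit in degree zero. -/
def toTensor : C.carrier →ₗ[R] (PosGrMod.tensorObj (bar.obj C)).carrier :=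
  DirectSum.toModule R ℕ (PosGrMod.tensorObj (bar.obj C)).carrier
    (fun n => if h : 0 < n then PosGrMod.gen (bar.obj C) ⟨n, h⟩
      else Algebra.linearMap R _ ∘ₗ Coalgebra.counit ∘ₗ (C.gr n).subtype) ∘ₗ
    (DirectSum.decomposeLinearEquiv C.gr).toLinearMap

theorem toTensor_zero (x : C.carrier) (hx : x ∈ C.gr 0) :
    C.toTensor x = algebraMap R _ (Coalgebra.counit (R := R) x) := by
  simp only [toTensor, LinearMap.comp_apply, LinearEquiv.coe_coe,
    DirectSum.decomposeLinearEquiv_apply]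
  rw [DirectSum.decompose_of_mem _ hx, ← DirectSum.lof_eq_of R, DirectSum.toModule_lof]
  rfl

theorem toTensor_pos (i : ℕ+) (x : C.gr i) :
    C.toTensor x = PosGrMod.gen (bar.obj C) i x := by
  simp only [toTensor, LinearMap.comp_apply, LinearEquiv.coe_coe,
    DirectSum.decomposeLinearEquiv_apply]
  rw [DirectSum.decompose_coe, ← DirectSum.lof_eq_of R, DirectSum.toModule_lof]
  exact LinearMap.congr_fun (dif_pos i.pos) x

/-- The set `G(C, B)` of degree-preserving linear maps `f : C → B` for which `f₀` is the identity
of `R` (after identifying `C₀` and `B₀` with `R`). -/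
structure IsG {C : ConnGrCoalg R} {B : ConnGrAlg R} (f : C.carrier →ₗ[R] B.carrier) : Prop where
  mem : ∀ n, ∀ x ∈ C.gr n, f x ∈ B.gr n
  zero : ∀ x ∈ C.gr 0, f x = algebraMap R B.carrier (Coalgebra.counit (R := R) x)

/-- The convolution product `f * g = μ ∘ (f ⊗ g) ∘ Δ`. -/
def conv {C : ConnGrCoalg R} {B : ConnGrAlg R} (f g : C.carrier →ₗ[R] B.carrier) :
    C.carrier →ₗ[R] B.carrier :=
  LinearMap.mul' R B.carrier ∘ₗ TensorProduct.map f g ∘ₗ Coalgebra.comul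

section Conv

variable {C} {B B' : ConnGrAlg R}

theorem conv_eq (f g : C.carrier →ₗ[R] B.carrier) :
    conv f g = (WithConv.toConv f * WithConv.toConv g).ofConv := rfl

theorem conv_assoc (f g h : C.carrier →ₗ[R] B.carrier) :
    conv (conv f g) h = conv f (conv g h) := by
  have := mul_assoc (WithConv.toConv f) (WithConv.toConv g) (WithConv.toConv h)
  exact congrArg WithConv.ofConv this

theorem conv_one (f : C.carrier →ₗ[R] B.carrier) :
    conv f (Algebra.linearMap R B.carrier ∘ₗ Coalgebra.counit) = f :=
  congrArg WithConv.ofConv (mul_one (WithConv.toConv f))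

theorem one_conv (f : C.carrier →ₗ[R] B.carrier) :
    conv (Algebra.linearMap R B.carrier ∘ₗ Coalgebra.counit) f = f :=
  congrArg WithConv.ofConv (one_mul (WithConv.toConv f))

theorem comp_conv (φ : B.carrier →ₐ[R] B'.carrier) (f g : C.carrier →ₗ[R] B.carrier) :
    φ.toLinearMap ∘ₗ conv f g = conv (φ.toLinearMap ∘ₗ f) (φ.toLinearMap ∘ₗ g) :=
  (LinearMap.algHom_comp_convMul_distrib φ (WithConv.toConv f) (WithConv.toConv g))

theorem conv_comp {D : ConnGrCoalg R} (f g : C.carrier →ₗ[R] B.carrier) (h : D ⟶ C) :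
    conv f g ∘ₗ (toCoalgHom h).toLinearMap =
      conv (f ∘ₗ (toCoalgHom h).toLinearMap) (g ∘ₗ (toCoalgHom h).toLinearMap) :=
  (LinearMap.convMul_comp_coalgHom_distrib (WithConv.toConv f) (WithConv.toConv g) (toCoalgHom h))

theorem IsG.conv {f g : C.carrier →ₗ[R] B.carrier} (hf : IsG f) (hg : IsG g) :
    IsG (conv f g) where
  mem n x hx := by
    have h := C.comul_mem n x hx
    change LinearMap.mul' R B.carrier (TensorProduct.map f g (Coalgebra.comul x)) ∈ B.gr n
    rw [← LinearMap.comp_apply]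
    refine (show (⨆ (p : ℕ × ℕ) (_ : p.1 + p.2 = n),
      LinearMap.range (TensorProduct.map (C.gr p.1).subtype (C.gr p.2).subtype)) ≤
        (B.gr n).comap (LinearMap.mul' R B.carrier ∘ₗ TensorProduct.map f g) from ?_) h
    refine iSup₂_le ?_
    rintro ⟨a, b⟩ hab
    rintro _ ⟨t, rfl⟩
    induction t with
    | zero => simp
    | tmul y z =>
      subst hab
      exact SetLike.GradedMul.mul_mem (hf.mem a y y.2) (hg.mem b z z.2)
    | add s t hs ht => rw [map_add]; exact add_mem hs ht
  zero x hx := by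
    have h : Coalgebra.comul (R := R) x ∈
        LinearMap.range (TensorProduct.map (C.gr 0).subtype (C.gr 0).subtype) := by
      refine (show (⨆ (p : ℕ × ℕ) (_ : p.1 + p.2 = 0),
        LinearMap.range (TensorProduct.map (C.gr p.1).subtype (C.gr p.2).subtype)) ≤ _ from ?_)
          (C.comul_mem 0 x hx)
      refine iSup₂_le ?_
      rintro ⟨a, b⟩ hab
      obtain ⟨rfl, rfl⟩ : a = 0 ∧ b = 0 := by simpa using hab
      exact le_rfl
    obtain ⟨t, ht⟩ := h
    set e : C.carrier →ₗ[R] B.carrier := Algebra.linearMap R B.carrier ∘ₗ Coalgebra.counit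
    have key : ConnGrCoalg.conv f g x = ConnGrCoalg.conv e e x := by
      change LinearMap.mul' R B.carrier (TensorProduct.map f g (Coalgebra.comul x)) =
        LinearMap.mul' R B.carrier (TensorProduct.map e e (Coalgebra.comul x))
      rw [← ht]
      congr 1
      rw [← LinearMap.comp_apply, ← LinearMap.comp_apply, ← TensorProduct.map_comp,
        ← TensorProduct.map_comp]
      congr 2
      · exact LinearMap.ext fun y => hf.zero y y.2
      · exact LinearMap.ext fun y => hg.zero y y.2
    rw [key, conv_one]
    rfl

theorem isG_one : IsG (C := C) (B := B) (Algebra.linearMap R B.carrier ∘ₗ Coalgebra.counit) where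
  mem n x hx := by
    change algebraMap R B.carrier (Coalgebra.counit x) ∈ B.gr n
    by_cases hn : n = 0
    · subst hn; exact B.algebraMap_mem _
    · rw [C.counit_eq_zero n hn x hx, map_zero]; exact zero_mem _
  zero _ _ := rfl

theorem IsG.comp {f : C.carrier →ₗ[R] B.carrier} (hf : IsG f) (φ : B ⟶ B') :
    IsG ((ConnGrAlg.toAlgHom φ).toLinearMap ∘ₗ f) where
  mem n x hx := ConnGrAlg.toAlgHom_mem φ (hf.mem n x hx)
  zero x hx := by
    change ConnGrAlg.toAlgHom φ (f x) = _
    rw [hf.zero x hx, AlgHom.commutes]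

theorem IsG.comp_coalg {D : ConnGrCoalg R} {f : C.carrier →ₗ[R] B.carrier} (hf : IsG f)
    (h : D ⟶ C) : IsG (f ∘ₗ (toCoalgHom h).toLinearMap) where
  mem n x hx := hf.mem n _ (toCoalgHom_mem h hx)
  zero x hx := by
    refine (hf.zero _ (toCoalgHom_mem h hx)).trans ?_
    congr 1
    exact LinearMap.congr_fun (toCoalgHom h).counit_comp x

variable (C) in
theorem isG_toTensor : IsG (B := PosGrMod.tensorObj (bar.obj C)) C.toTensor where
  mem n x hx := by
    rcases Nat.eq_zero_or_pos n with rfl | hn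
    · rw [C.toTensor_zero x hx]; exact ConnGrAlg.algebraMap_mem _ _
    · rw [C.toTensor_pos ⟨n, hn⟩ ⟨x, hx⟩]
      exact PosGrMod.gen_mem (bar.obj C) ⟨n, hn⟩ _
  zero x hx := C.toTensor_zero x hx

/-- Elements of `G(C, B)` agree if they agree in positive degrees. -/
theorem IsG.ext {f g : C.carrier →ₗ[R] B.carrier} (hf : IsG f) (hg : IsG g)
    (h : ∀ i : ℕ+, ∀ x ∈ C.gr i, f x = g x) : f = g := by
  ext x
  induction x using DirectSum.Decomposition.inductionOn C.gr with
  | zero => simp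
  | @homogeneous n m =>
    rcases Nat.eq_zero_or_pos n with rfl | hn
    · rw [hf.zero m m.2, hg.zero m m.2]
    · exact h ⟨n, hn⟩ m m.2
  | add a b ha hb => rw [map_add, map_add, ha, hb]

/-- The extension of an element of `G(C, B)` to a morphism `T(C̄) → B`. -/
def extend (f : C.carrier →ₗ[R] B.carrier) (hf : IsG f) : PosGrMod.tensorObj (bar.obj C) ⟶ B :=
  PosGrMod.tensorDesc (bar.obj C) (fun i => f ∘ₗ (C.gr i).subtype) (fun i y => hf.mem i _ y.2)

theorem extend_comp (f : C.carrier →ₗ[R] B.carrier) (hf : IsG f) :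
    (ConnGrAlg.toAlgHom (extend f hf)).toLinearMap ∘ₗ C.toTensor = f := by
  refine IsG.ext ((isG_toTensor C).comp _) hf ?_
  intro i x hx
  change ConnGrAlg.toAlgHom (extend f hf) (C.toTensor x) = f x
  rw [C.toTensor_pos i ⟨x, hx⟩]
  exact PosGrMod.tensorDesc_gen (bar.obj C) _ _ i _

theorem tensor_hom_ext {φ ψ : PosGrMod.tensorObj (bar.obj C) ⟶ B}
    (h : (ConnGrAlg.toAlgHom φ).toLinearMap ∘ₗ C.toTensor =
      (ConnGrAlg.toAlgHom ψ).toLinearMap ∘ₗ C.toTensor) : φ = ψ := by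
  apply PosGrMod.tensorObj_hom_ext
  intro i (y : C.gr i)
  have hy := C.toTensor_pos i y
  have := LinearMap.congr_fun h (y : C.carrier)
  simp only [LinearMap.comp_apply] at this
  exact (congrArg (ConnGrAlg.toAlgHom φ) hy).symm.trans
    (this.trans (congrArg (ConnGrAlg.toAlgHom ψ) hy))

end Conv

end ConnGrCoalg

namespace ConnGrCoalg

variable {R : Type u} [CommRing R]

/-- The underlying connected graded algebra of `T_CM(C)`: the tensor algebra on `C̄`. -/
abbrev tensor (C : ConnGrCoalg R) : ConnGrAlg R := PosGrMod.tensorObj (bar.obj C)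

/-- The map `𝒜(T(C̄), B) → G(C, B)` given by composition with `j : C → T(C̄)`. -/
def res {C : ConnGrCoalg R} {B : ConnGrAlg R} (φ : C.tensor ⟶ B) : C.carrier →ₗ[R] B.carrier :=
  (ConnGrAlg.toAlgHom φ).toLinearMap ∘ₗ C.toTensor

theorem isG_res {C : ConnGrCoalg R} {B : ConnGrAlg R} (φ : C.tensor ⟶ B) : IsG (res φ) :=
  (isG_toTensor C).comp φ

theorem res_comp {C : ConnGrCoalg R} {B B' : ConnGrAlg R} (φ : C.tensor ⟶ B) (ψ : B ⟶ B') :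
    res (φ ≫ ψ) = (ConnGrAlg.toAlgHom ψ).toLinearMap ∘ₗ res φ := rfl

/-- The comultiplication `Φ : T(C̄) → T(C̄) ∗ T(C̄)`: the homomorphism of algebras determined by
`Φ(x) = x' + x'' + ∑ yᵢ' zᵢ''` for `x ∈ C̄` with `Δ(x) = x ⊗ 1 + 1 ⊗ x + ∑ yᵢ ⊗ zᵢ`; in other
words the restriction of `Φ` along `j` is the convolution product of the two inclusions. -/
def tensorComul (C : ConnGrCoalg R) : C.tensor ⟶ C.tensor ⨿ C.tensor :=
  extend (conv (res coprod.inl) (res coprod.inr)) ((isG_res _).conv (isG_res _))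

/-- The counit of `T_CM(C)`: the morphism to the initial object `R` which vanishes on `C̄`. -/
def tensorCounit (C : ConnGrCoalg R) : C.tensor ⟶ ⊥_ (ConnGrAlg R) :=
  extend (Algebra.linearMap R _ ∘ₗ Coalgebra.counit) isG_one

theorem res_tensorCounit_comp (C : ConnGrCoalg R) {B : ConnGrAlg R} (φ : ⊥_ (ConnGrAlg R) ⟶ B) :
    res (C.tensorCounit ≫ φ) = Algebra.linearMap R _ ∘ₗ Coalgebra.counit := by
  rw [res_comp]
  refine (congrArg (fun t => (ConnGrAlg.toAlgHom φ).toLinearMap ∘ₗ t)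
    (extend_comp _ isG_one)).trans ?_
  ext x
  exact (ConnGrAlg.toAlgHom φ).commutes _

theorem res_tensorComul_comp (C : ConnGrCoalg R) {B : ConnGrAlg R}
    (φ : C.tensor ⨿ C.tensor ⟶ B) :
    res (C.tensorComul ≫ φ) = conv (res (coprod.inl ≫ φ)) (res (coprod.inr ≫ φ)) := by
  rw [res_comp]
  refine (congrArg (fun t => (ConnGrAlg.toAlgHom φ).toLinearMap ∘ₗ t)
    (extend_comp _ ((isG_res _).conv (isG_res _)))).trans ?_
  rw [comp_conv]
  rfl

theorem toLinearMap_comp_conv {C : ConnGrCoalg R} {B B' : ConnGrAlg R}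
    (f g : C.tensor ⟶ B) (φ : B ⟶ B') :
    (ConnGrAlg.toAlgHom φ).toLinearMap ∘ₗ conv (res f) (res g) =
      conv (res (f ≫ φ)) (res (g ≫ φ)) := by
  rw [comp_conv]; rfl

theorem tensorComul_counit_left (C : ConnGrCoalg R) :
    C.tensorComul ≫ coprod.map C.tensorCounit (𝟙 _) = coprod.inr := by
  apply tensor_hom_ext
  change res _ = res _
  rw [res_tensorComul_comp, coprod.inl_map, coprod.inr_map, res_tensorCounit_comp, one_conv,
    Category.id_comp]

theorem tensorComul_counit_right (C : ConnGrCoalg R) :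
    C.tensorComul ≫ coprod.map (𝟙 _) C.tensorCounit = coprod.inl := by
  apply tensor_hom_ext
  change res _ = res _
  rw [res_tensorComul_comp, coprod.inl_map, coprod.inr_map, res_tensorCounit_comp, conv_one,
    Category.id_comp]

section

variable {𝒞 : Type*} [Category* 𝒞] [HasBinaryCoproducts 𝒞] (X Y Z : 𝒞)

theorem inl_inl_associator :
    coprod.inl ≫ coprod.inl ≫ (coprod.associator X Y Z).hom = coprod.inl := by
  simp only [coprod.associator_hom, coprod.inl_desc]

theorem inr_inl_associator :
    coprod.inr ≫ coprod.inl ≫ (coprod.associator X Y Z).hom = coprod.inl ≫ coprod.inr := by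
  simp only [coprod.associator_hom, coprod.inl_desc, coprod.inr_desc]

theorem inr_associator :
    coprod.inr ≫ (coprod.associator X Y Z).hom = coprod.inr ≫ coprod.inr := by
  simp only [coprod.associator_hom, coprod.inr_desc]

end

theorem tensorComul_assoc (C : ConnGrCoalg R) :
    C.tensorComul ≫ coprod.map (𝟙 _) C.tensorComul =
      C.tensorComul ≫ coprod.map C.tensorComul (𝟙 _) ≫ (coprod.associator _ _ _).hom := by
  apply tensor_hom_ext
  change res _ = res _
  rw [res_tensorComul_comp, res_tensorComul_comp, coprod.inl_map, coprod.inr_map,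
    coprod.inl_map_assoc, coprod.inr_map_assoc, res_tensorComul_comp, res_tensorComul_comp,
    conv_assoc, Category.id_comp, inl_inl_associator, inr_inl_associator, Category.id_comp,
    inr_associator]

instance tensorComonObj (C : ConnGrCoalg R) : ComonObj C.tensor where
  counit := C.tensorCounit
  comul := C.tensorComul
  counit_comul := C.tensorComul_counit_left
  comul_counit := C.tensorComul_counit_right
  comul_assoc := C.tensorComul_assoc

/-- The morphism `T(C̄) → T(D̄)` induced by a morphism `C → D`. -/
def tensorMap {C D : ConnGrCoalg R} (f : C ⟶ D) : C.tensor ⟶ D.tensor :=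
  extend (D.toTensor ∘ₗ (toCoalgHom f).toLinearMap) ((isG_toTensor D).comp_coalg f)

theorem res_tensorMap_comp {C D : ConnGrCoalg R} (f : C ⟶ D) {B : ConnGrAlg R}
    (φ : D.tensor ⟶ B) : res (tensorMap f ≫ φ) = res φ ∘ₗ (toCoalgHom f).toLinearMap := by
  rw [res_comp]
  exact congrArg (fun t => (ConnGrAlg.toAlgHom φ).toLinearMap ∘ₗ t)
    (extend_comp _ ((isG_toTensor D).comp_coalg f))

theorem tensorMap_counit {C D : ConnGrCoalg R} (f : C ⟶ D) :
    tensorMap f ≫ D.tensorCounit = C.tensorCounit := by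
  apply tensor_hom_ext
  change res _ = res _
  rw [res_tensorMap_comp, ← Category.comp_id D.tensorCounit, ← Category.comp_id C.tensorCounit,
    res_tensorCounit_comp, res_tensorCounit_comp]
  ext x
  exact congrArg _ (LinearMap.congr_fun (toCoalgHom f).counit_comp x)

theorem tensorMap_comul {C D : ConnGrCoalg R} (f : C ⟶ D) :
    tensorMap f ≫ D.tensorComul = C.tensorComul ≫ coprod.map (tensorMap f) (tensorMap f) := by
  apply tensor_hom_ext
  change res _ = res _
  rw [res_tensorMap_comp, ← Category.comp_id D.tensorComul, res_tensorComul_comp,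
    res_tensorComul_comp, coprod.inl_map, coprod.inr_map, res_tensorMap_comp, res_tensorMap_comp,
    conv_comp, Category.comp_id, Category.comp_id]

/-- The functor `T_CM` from connected graded coalgebras to comonoids (with respect to the
categorical coproduct) in connected graded algebras. -/
def TCM : ConnGrCoalg R ⥤ Comon (ConnGrAlg R) where
  obj C := { X := C.tensor }
  map f := Comon.Hom.mk' (tensorMap f) (tensorMap_counit f) (tensorMap_comul f)
  map_id C := by
    apply Comon.ext
    apply tensor_hom_ext
    change res _ = res _
    rw [← Category.comp_id (Comon.Hom.hom _)]
    exact res_tensorMap_comp (𝟙 C) (𝟙 _)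
  map_comp {C D E} f g := by
    apply Comon.ext
    apply tensor_hom_ext
    change res (tensorMap (f ≫ g)) = res (tensorMap f ≫ tensorMap g)
    rw [res_tensorMap_comp, ← Category.comp_id (tensorMap g), res_tensorMap_comp,
      ← Category.comp_id (tensorMap (f ≫ g)), res_tensorMap_comp]
    rfl

end ConnGrCoalg

namespace PosGrMod

variable {R : Type u} [CommRing R]

/-- The underlying module `R[0] ⊕ N` of the coalgebra `C(N)`. -/
def TrivCarrier (N : PosGrMod R) : Type u := R × ⨁ i : ℕ+, N i

namespace TrivCarrier

variable (N : PosGrMod R)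

instance : AddCommGroup (TrivCarrier N) := inferInstanceAs (AddCommGroup (R × ⨁ i : ℕ+, N i))
instance : Module R (TrivCarrier N) := inferInstanceAs (Module R (R × ⨁ i : ℕ+, N i))

/-- The unit element `1 ∈ R[0]`. -/
def one : TrivCarrier N := ((1 : R), (0 : ⨁ i : ℕ+, N i))

/-- The inclusion of `N`. -/
def inr : (⨁ i : ℕ+, N i) →ₗ[R] TrivCarrier N := LinearMap.inr R R (⨁ i : ℕ+, N i)

/-- The projection to `N`. -/
def snd : TrivCarrier N →ₗ[R] (⨁ i : ℕ+, N i) := LinearMap.snd R R (⨁ i : ℕ+, N i)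

/-- The projection to `R[0]`, which is the counit. -/
def fst : TrivCarrier N →ₗ[R] R := LinearMap.fst R R (⨁ i : ℕ+, N i)

variable {N} in
theorem hom_ext {M : Type*} [AddCommMonoid M] [Module R M] {f g : TrivCarrier N →ₗ[R] M}
    (h₁ : f (one N) = g (one N)) (h₂ : ∀ x, f (inr N x) = g (inr N x)) : f = g := by
  apply LinearMap.prod_ext
  · exact LinearMap.ext_ring h₁
  · exact LinearMap.ext h₂

/-- The linear map on `R[0] ⊕ N` with given value at `1` and given restriction to `N`. -/
def lift {M : Type*} [AddCommGroup M] [Module R M] (m : M) (g : (⨁ i : ℕ+, N i) →ₗ[R] M) :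
    TrivCarrier N →ₗ[R] M :=
  LinearMap.coprod (LinearMap.toSpanSingleton R M m) g

@[simp] theorem lift_one {M : Type*} [AddCommGroup M] [Module R M] (m : M)
    (g : (⨁ i : ℕ+, N i) →ₗ[R] M) : lift N m g (one N) = m := by
  change (1 : R) • m + g 0 = m
  simp

@[simp] theorem lift_inr {M : Type*} [AddCommGroup M] [Module R M] (m : M)
    (g : (⨁ i : ℕ+, N i) →ₗ[R] M) (x) : lift N m g (inr N x) = g x := by
  change (0 : R) • m + g x = g x
  simp

/-- The trivial comultiplication, `Δ(1) = 1 ⊗ 1` and `Δ(x) = x ⊗ 1 + 1 ⊗ x` for `x ∈ N`. -/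
def comul : TrivCarrier N →ₗ[R] TrivCarrier N ⊗[R] TrivCarrier N :=
  lift N (one N ⊗ₜ one N)
    ((TensorProduct.mk R _ _).flip (one N) ∘ₗ inr N + TensorProduct.mk R _ _ (one N) ∘ₗ inr N)

@[simp] theorem fst_one : fst N (one N) = 1 := rfl
@[simp] theorem fst_inr (x) : fst N (inr N x) = 0 := rfl
@[simp] theorem snd_one : snd N (one N) = 0 := rfl
@[simp] theorem snd_inr (x) : snd N (inr N x) = x := rfl

@[simp] theorem comul_one : comul N (one N) = one N ⊗ₜ one N := lift_one N _ _

@[simp] theorem comul_inr (x) :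
    comul N (inr N x) = inr N x ⊗ₜ one N + one N ⊗ₜ inr N x := lift_inr N _ _ x

instance : Coalgebra R (TrivCarrier N) where
  comul := comul N
  counit := fst N
  coassoc := by
    apply hom_ext
    · simp
    · intro x
      simp [TensorProduct.add_tmul, TensorProduct.tmul_add, add_assoc]
  rTensor_counit_comp_comul := by
    apply hom_ext
    · simp
    · intro x; simp
  lTensor_counit_comp_comul := by
    apply hom_ext
    · simp
    · intro x; simp

/-- The grading of `R[0] ⊕ N`. -/
def gr (n : ℕ) : Submodule R (TrivCarrier N) where
  carrier := {x | (n ≠ 0 → fst N x = 0) ∧ ∀ i : ℕ+, (i : ℕ) ≠ n → snd N x i = 0}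
  add_mem' {x y} hx hy :=
    ⟨fun h => by rw [map_add, hx.1 h, hy.1 h, add_zero], fun i h => by
      rw [map_add, DirectSum.add_apply, hx.2 i h, hy.2 i h, add_zero]⟩
  zero_mem' := ⟨fun _ => map_zero _, fun i _ => by rw [map_zero]; rfl⟩
  smul_mem' r x hx :=
    ⟨fun h => by rw [map_smul, hx.1 h, smul_zero], fun i h => by
      rw [map_smul, DirectSum.smul_apply, hx.2 i h, smul_zero]⟩

theorem one_mem : one N ∈ gr N 0 := ⟨fun h => absurd rfl h, fun i _ => by simp⟩

theorem inr_mem (i : ℕ+) (y : N i) : inr N (DirectSum.lof R ℕ+ (fun i => N i) i y) ∈ gr N i := by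
  refine ⟨fun _ => rfl, fun k hk => ?_⟩
  rw [snd_inr]
  exact DirectSum.of_eq_of_ne _ _ _ (fun h => hk (by rw [h]))

theorem eq_of_mem_zero {x : TrivCarrier N} (hx : x ∈ gr N 0) : x = fst N x • one N := by
  have h : snd N x = 0 := by
    ext i
    exact hx.2 i i.pos.ne'
  refine Prod.ext ?_ ?_
  · exact (mul_one _).symm
  · exact h.trans (smul_zero _).symm

theorem eq_of_mem_pos {i : ℕ+} {x : TrivCarrier N} (hx : x ∈ gr N i) :
    x = inr N (DirectSum.lof R ℕ+ (fun i => N i) i (snd N x i)) := by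
  refine Prod.ext (hx.1 i.pos.ne') ?_
  change snd N x = DirectSum.lof R ℕ+ (fun i => N i) i (snd N x i)
  refine DFinsupp.ext fun k => ?_
  by_cases h : k = i
  · subst h; exact (DirectSum.of_eq_same (β := fun i => N i) _ _).symm
  · exact (hx.2 k (fun h' => h (PNat.coe_injective h'))).trans
      (DirectSum.of_eq_of_ne (β := fun i => N i) _ _ _ h).symm

/-- The decomposition of an element of `R[0] ⊕ N` into homogeneous components. -/
def decomp : TrivCarrier N →ₗ[R] ⨁ n, gr N n :=
  lift N (DirectSum.lof R ℕ (fun n => gr N n) 0 ⟨one N, one_mem N⟩)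
    (DirectSum.toModule R ℕ+ _ fun i => DirectSum.lof R ℕ (fun n => gr N n) i ∘ₗ
      (inr N ∘ₗ DirectSum.lof R ℕ+ (fun i => N i) i).codRestrict _ (inr_mem N i))

theorem decomp_one :
    decomp N (one N) = DirectSum.lof R ℕ (fun n => gr N n) 0 ⟨one N, one_mem N⟩ := lift_one N _ _

theorem decomp_inr (i : ℕ+) (y : N i) :
    decomp N (inr N (DirectSum.lof R ℕ+ (fun i => N i) i y)) =
      DirectSum.lof R ℕ (fun n => gr N n) i ⟨_, inr_mem N i y⟩ := by
  rw [decomp, lift_inr, DirectSum.toModule_lof]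
  rfl

instance : DirectSum.Decomposition (gr N) :=
  DirectSum.Decomposition.ofLinearMap (gr N) (decomp N)
    (by
      apply hom_ext
      · rw [LinearMap.comp_apply, decomp_one, DirectSum.coeLinearMap_lof]; rfl
      · intro x
        suffices h : (DirectSum.coeLinearMap (gr N) ∘ₗ decomp N) ∘ₗ inr N = inr N from
          LinearMap.congr_fun h x
        apply DirectSum.linearMap_ext
        intro i
        ext y : 1
        simp only [LinearMap.comp_apply]
        rw [decomp_inr, DirectSum.coeLinearMap_lof])
    (by
      apply DirectSum.linearMap_ext
      intro n
      ext ⟨x, hx⟩ : 1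
      simp only [LinearMap.comp_apply, DirectSum.coeLinearMap_lof, LinearMap.id_apply]
      rcases Nat.eq_zero_or_pos n with rfl | hn
      · have h := eq_of_mem_zero N hx
        have h2 : (⟨x, hx⟩ : gr N 0) = fst N x • ⟨one N, one_mem N⟩ := Subtype.ext h
        rw [h2, map_smul]
        conv_lhs => rw [h]
        rw [map_smul, decomp_one]
      · obtain ⟨i, rfl⟩ : ∃ i : ℕ+, (i : ℕ) = n := ⟨⟨n, hn⟩, rfl⟩
        have h := eq_of_mem_pos N hx
        conv_lhs => rw [h]
        rw [decomp_inr]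
        congr 1
        exact Subtype.ext h.symm)

end TrivCarrier

/-- The connected graded coalgebra `C(N) = R[0] ⊕ N` with the trivial comultiplication. -/
def trivObj (N : PosGrMod R) : ConnGrCoalg R where
  carrier := TrivCarrier N
  gr := TrivCarrier.gr N
  comul_mem n x hx := by
    rcases Nat.eq_zero_or_pos n with rfl | hn
    · refine Submodule.mem_iSup_of_mem (0, 0) (Submodule.mem_iSup_of_mem rfl ?_)
      rw [TrivCarrier.eq_of_mem_zero N hx, map_smul]
      refine Submodule.smul_mem _ _ ⟨⟨_, TrivCarrier.one_mem N⟩ ⊗ₜ ⟨_, TrivCarrier.one_mem N⟩, ?_⟩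
      exact (TrivCarrier.comul_one N).symm
    · obtain ⟨i, rfl⟩ : ∃ i : ℕ+, (i : ℕ) = n := ⟨⟨n, hn⟩, rfl⟩
      rw [TrivCarrier.eq_of_mem_pos N hx]
      refine (TrivCarrier.comul_inr N _).symm ▸ add_mem ?_ ?_
      · refine Submodule.mem_iSup_of_mem (i, 0) (Submodule.mem_iSup_of_mem (add_zero _) ?_)
        exact ⟨⟨_, TrivCarrier.inr_mem N i _⟩ ⊗ₜ ⟨_, TrivCarrier.one_mem N⟩, rfl⟩
      · refine Submodule.mem_iSup_of_mem (0, i) (Submodule.mem_iSup_of_mem (zero_add _) ?_)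
        exact ⟨⟨_, TrivCarrier.one_mem N⟩ ⊗ₜ ⟨_, TrivCarrier.inr_mem N i _⟩, rfl⟩
  counit_eq_zero n hn x hx := hx.1 hn
  counit_bijective := by
    constructor
    · rintro ⟨x, hx⟩ ⟨y, hy⟩ h
      apply Subtype.ext
      change x = y
      rw [TrivCarrier.eq_of_mem_zero N hx, TrivCarrier.eq_of_mem_zero N hy]
      exact congrArg (· • TrivCarrier.one N) h
    · intro r
      refine ⟨⟨r • TrivCarrier.one N, Submodule.smul_mem _ _ (TrivCarrier.one_mem N)⟩, ?_⟩
      exact mul_one r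

namespace TrivCarrier

/-- The linear map `C(N) → C(N')` induced by a morphism `N → N'`. -/
def map {N N' : PosGrMod R} (f : N ⟶ N') : TrivCarrier N →ₗ[R] TrivCarrier N' :=
  lift N (one N') (inr N' ∘ₗ DirectSum.lmap fun i => (f i).hom)

@[simp] theorem map_one {N N' : PosGrMod R} (f : N ⟶ N') : map f (one N) = one N' :=
  lift_one N _ _

@[simp] theorem map_inr {N N' : PosGrMod R} (f : N ⟶ N') (x) :
    map f (inr N x) = inr N' (DirectSum.lmap (fun i => (f i).hom) x) := lift_inr N _ _ x

/-- The homomorphism of coalgebras `C(N) → C(N')` induced by a morphism `N → N'`. -/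
def mapCoalg {N N' : PosGrMod R} (f : N ⟶ N') : TrivCarrier N →ₗc[R] TrivCarrier N' where
  __ := map f
  counit_comp := by
    apply hom_ext
    · exact congrArg (fst N') (map_one f)
    · intro x; exact congrArg (fst N') (map_inr f x)
  map_comp_comul := by
    apply hom_ext
    · change TensorProduct.map (map f) (map f) (comul N (one N)) = comul N' (map f (one N))
      simp
    · intro x
      change TensorProduct.map (map f) (map f) (comul N (inr N x)) = comul N' (map f (inr N x))
      simp

theorem map_mem {N N' : PosGrMod R} (f : N ⟶ N') (n : ℕ) (x : TrivCarrier N) (hx : x ∈ gr N n) :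
    map f x ∈ gr N' n := by
  rcases Nat.eq_zero_or_pos n with rfl | hn
  · rw [eq_of_mem_zero N hx, map_smul, map_one]
    exact Submodule.smul_mem _ _ (one_mem N')
  · obtain ⟨i, rfl⟩ : ∃ i : ℕ+, (i : ℕ) = n := ⟨⟨n, hn⟩, rfl⟩
    rw [eq_of_mem_pos N hx, map_inr, DirectSum.lmap_lof]
    exact inr_mem N' i _

end TrivCarrier

/-- The functor `C` from positively graded modules to connected graded coalgebras. -/
def trivCoalg : PosGrMod R ⥤ ConnGrCoalg R where
  obj N := trivObj N
  map f := ⟨TrivCarrier.mapCoalg f, TrivCarrier.map_mem f⟩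
  map_id N := by
    apply ConnGrCoalg.hom_ext
    apply CoalgHom.coe_linearMap_injective
    apply TrivCarrier.hom_ext
    · exact TrivCarrier.map_one _
    · intro x
      refine (TrivCarrier.map_inr _ x).trans (congrArg _ ?_)
      exact DFinsupp.ext fun i => rfl
  map_comp f g := by
    apply ConnGrCoalg.hom_ext
    apply CoalgHom.coe_linearMap_injective
    apply TrivCarrier.hom_ext
    · refine (TrivCarrier.map_one _).trans ?_
      refine Eq.trans ?_ (congrArg (TrivCarrier.map g) (TrivCarrier.map_one f)).symm
      exact (TrivCarrier.map_one g).symm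
    · intro x
      refine (TrivCarrier.map_inr _ x).trans ?_
      refine Eq.trans ?_ (congrArg (TrivCarrier.map g) (TrivCarrier.map_inr f x)).symm
      refine Eq.trans ?_ (TrivCarrier.map_inr g _).symm
      exact congrArg _ (DFinsupp.ext fun i => rfl)

/-- The graded module `M[n]`, which is `M` in degree `n` and zero in the other degrees. -/
def shift (n : ℕ+) (M : ModuleCat.{u} R) : PosGrMod R := (GradedObject.single n).obj M

/-- The localization `N_𝔪`, formed degreewise. -/
def localization (𝔪 : Ideal R) [𝔪.IsMaximal] (N : PosGrMod R) :
    PosGrMod (Localization.AtPrime 𝔪) :=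
  fun i => ModuleCat.of (Localization.AtPrime 𝔪) (LocalizedModule 𝔪.primeCompl (N i))

/-- `N` is locally at most singly generated: for every maximal ideal `𝔪`, the localization `N_𝔪`
is isomorphic to `0` or to `(R_𝔪 / 𝔞_𝔪)[n]` for some ideal `𝔞 ⊆ 𝔪` and some `n`, where `n` is even
if the characteristic of `R_𝔪 / 𝔞_𝔪` is not `2`. These are the objects of `𝒮`. -/
def IsLocallyAtMostSinglyGenerated : ObjectProperty (PosGrMod R) := fun N =>
  ∀ (𝔪 : Ideal R) [𝔪.IsMaximal],
    IsZero (localization 𝔪 N) ∨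
      ∃ (𝔞 : Ideal R) (n : ℕ+), 𝔞 ≤ 𝔪 ∧
        (ringChar (Localization.AtPrime 𝔪 ⧸
          𝔞.map (algebraMap R (Localization.AtPrime 𝔪))) ≠ 2 → Even (n : ℕ)) ∧
        Nonempty (localization 𝔪 N ≅ shift n (ModuleCat.of (Localization.AtPrime 𝔪)
          (Localization.AtPrime 𝔪 ⧸ 𝔞.map (algebraMap R (Localization.AtPrime 𝔪)))))

/-- The objects of `ℱ`: graded modules isomorphic to one of `0, R[1], R[2], …` if `ch R = 2`, or
to one of `0, R[2], R[4], …` if `ch R ≠ 2`. -/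
def IsZeroOrFreeOnOne : ObjectProperty (PosGrMod R) := fun N =>
  IsZero N ∨ ∃ n : ℕ+, (ringChar R ≠ 2 → Even (n : ℕ)) ∧
    Nonempty (N ≅ shift n (ModuleCat.of R R))

/-- A graded module is of finite type if it is finitely generated in each degree. -/
def IsFiniteType : ObjectProperty (PosGrMod R) := fun N => ∀ i, Module.Finite R (N i)

end PosGrMod

namespace ConnGrAlg

variable {R : Type u} [CommRing R]

/-- Graded commutativity: `ab = (-1)^{pq} ba` for `a ∈ A_p` and `b ∈ A_q`. -/
def IsGradedCommutative (A : ConnGrAlg R) : Prop :=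
  ∀ p q : ℕ, ∀ a ∈ A.gr p, ∀ b ∈ A.gr q, a * b = (-1) ^ (p * q) * (b * a)

/-- A graded algebra is of finite type if it is finitely generated in each degree. -/
def IsFiniteType (A : ConnGrAlg R) : Prop := ∀ n, Module.Finite R (A.gr n)

/-- A comonoid (with respect to the categorical coproduct) is a cogroup if it has an inverse
`ν : A → A`, i.e. the composites `A → A ∗ A → A` of the comultiplication with `(ν, 1)` and `(1, ν)`
are the trivial morphism `A → R → A`. -/
def IsCogroup (A : Comon (ConnGrAlg R)) : Prop :=
  ∃ ν : A.X ⟶ A.X,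
    (ComonObj.comul : A.X ⟶ A.X ⨿ A.X) ≫ coprod.desc ν (𝟙 A.X) =
      (ComonObj.counit : A.X ⟶ ⊥_ (ConnGrAlg R)) ≫ initial.to A.X ∧
    (ComonObj.comul : A.X ⟶ A.X ⨿ A.X) ≫ coprod.desc (𝟙 A.X) ν =
      (ComonObj.counit : A.X ⟶ ⊥_ (ConnGrAlg R)) ≫ initial.to A.X

/-- The objects of `𝒜_CG^co`: cogroups in the category of connected graded algebras whose
underlying graded algebra is graded commutative. -/
def IsCommCogroup : ObjectProperty (Comon (ConnGrAlg R)) := fun A =>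
  IsCogroup A ∧ A.X.IsGradedCommutative

/-- The objects of `𝒜_CG^{co ft}`: those of `𝒜_CG^co` which are of finite type. -/
def IsCommCogroupFT : ObjectProperty (Comon (ConnGrAlg R)) := fun A =>
  IsCommCogroup A ∧ A.X.IsFiniteType

end ConnGrAlg

/-- The composite functor `T_CM ∘ C` from positively graded modules to comonoids in connected
graded algebras. -/
def tcmC (R : Type u) [CommRing R] : PosGrMod R ⥤ Comon (ConnGrAlg R) :=
  PosGrMod.trivCoalg ⋙ ConnGrCoalg.TCM

end

/-!
The functor `T_CM ∘ C` sends a graded module `N` to the tensor algebra `T(N)` in which the elements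
of `N` are primitive. Everything rests on a structure theorem for comonoids `A` in connected graded
algebras: the underlying algebra is free, with a canonical module of generators.

*Structure of comonoids.* The counit laws say that `Φ(x) ∈ A ∗ A` projects to `x` in both factors.
A homomorphism from `A ∗ A` to upper triangular matrices over `A ⊗ A` (`matHom`) extracts the
component of `Φ(x)` in the summand `Ā' ⊗ Ā''`; composing with `Φ` gives a derivation
`d : A → A ⊗ A` with `d(x) = x ⊗ 1 + δ(x)` and `δ(x) ∈ Ā ⊗ Ā` (`coderiv_mul`, `coderiv_sub_mem`).
By recursion on the degree there is a linear map `e` with `e(x) = x - ∑ e(yᵢ) zᵢ` on `Ā`, where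
`δ(x) = ∑ yᵢ ⊗ zᵢ` (`primProj`); it is a projection and vanishes on decomposable elements
(`primProj_mul`). The map `λ = (e ⊗ 1) ∘ d` satisfies `λ(e(x) b) = e(x) ⊗ b`
(`splitMap_primProj_mul`), so it peels off the first letter of a word in the generators `P = e(A)`,
and `A = T(P)` (`lift_injective`, `lift_surjective`). Coassociativity is not needed for this.

*Full faithfulness.* A homogeneous primitive element `x` has `δ(x) = 0`, hence `e(x) = x`. For
`A = T(N)` the image of `e` is `N`, so morphisms of comonoids `T(N) → T(N')` correspond to maps
`N → N'`. The inverse of the cogroup `T(N)` is `x ↦ -x` on generators.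

*Commutativity.* If `N` is locally generated by one element `y`, with `2y = 0` locally in odd
degree, then any two generators of `T(N)` commute up to the sign, which can be checked locally
(`gensCommute_of_isLocallyGeneratedAt`). Conversely, suppose that `T(N)` is graded commutative.
Comparing the words `pq` and `qp` by means of functionals `φ`, `ψ` on `N` gives
`φ(p) ψ(q) = ± φ(q) ψ(p)`, so the fibre of `N` at a maximal ideal has dimension at most one, and
Nakayama's lemma, which needs finite generation or a field, shows that `N` is locally generated by
one element (`GensCommute.exists_isLocallyGeneratedAt`).

*Essential surjectivity.* Let `A` be a graded commutative cogroup, so `A = T(P)`, where `P` is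
locally generated by one element, say of degree `n`. Locally `A` vanishes in the degrees strictly
between `0` and `n`, so the elements of degree `n` are primitive for lack of cross terms
(`isPrimitive_primIncl`). Hence the isomorphism `T(P) → A` respects comultiplications
(`nonempty_iso_of_isPrimitive`).
-/

noncomputable section

/-! ### Augmentations, binary coproducts and comonoids -/

namespace ConnGrAlg

variable {R : Type u} [CommRing R]

theorem algebraMap_augmentation (A : ConnGrAlg R) (a : A.carrier) :
    algebraMap R A.carrier (A.augmentation a) = A.projZero a := by
  have h := (AlgEquiv.ofInjective (Algebra.ofId R A.carrier)
    A.algebraMap_injective).apply_symm_apply (A.projZero.codRestrict _ A.projZero_mem a)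
  exact congrArg Subtype.val h

theorem algebraMap_augmentation_of_mem (A : ConnGrAlg R) {a : A.carrier} (ha : a ∈ A.gr 0) :
    algebraMap R A.carrier (A.augmentation a) = a := by
  rw [algebraMap_augmentation]
  exact DirectSum.decompose_of_mem_same A.gr ha

theorem augmentation_of_mem (A : ConnGrAlg R) {n : ℕ} (hn : n ≠ 0) {a : A.carrier}
    (ha : a ∈ A.gr n) : A.augmentation a = 0 := by
  apply A.algebraMap_injective
  rw [algebraMap_augmentation, map_zero]
  exact DirectSum.decompose_of_mem_ne A.gr ha hn

/-- Two additive conditions on `A.gr 0` and on each `A.gr n`, `n > 0`, suffice for all of `A`. -/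
theorem homogeneous_induction (A : ConnGrAlg R) {p : A.carrier → Prop}
    (zero : ∀ r : R, p (algebraMap R A.carrier r)) (pos : ∀ n ≠ 0, ∀ a ∈ A.gr n, p a)
    (add : ∀ a b, p a → p b → p (a + b)) (a : A.carrier) : p a := by
  induction a using DirectSum.Decomposition.inductionOn A.gr with
  | zero => simpa using zero 0
  | @homogeneous i m =>
    by_cases hi : i = 0
    · subst hi
      rw [← A.algebraMap_augmentation_of_mem m.2]
      exact zero _
    · exact pos i hi m m.2
  | add a b ha hb => exact add a b ha hb

theorem augmentation_toAlgHom {A B : ConnGrAlg R} (f : A ⟶ B) (a : A.carrier) :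
    B.augmentation (toAlgHom f a) = A.augmentation a := by
  induction a using A.homogeneous_induction with
  | zero r => rw [AlgHom.commutes, AlgHom.commutes, AlgHom.commutes]
  | pos n hn a ha =>
    rw [A.augmentation_of_mem hn ha, B.augmentation_of_mem hn (toAlgHom_mem f ha)]
  | add a b ha hb => simp only [map_add, ha, hb]

/-- The trivial endomorphism `A → R → A`. -/
def trivEnd (A : ConnGrAlg R) : A ⟶ A :=
  ofAlgHom ((Algebra.ofId R A.carrier).comp A.augmentation) (fun n a ha => by
    change algebraMap R A.carrier (A.augmentation a) ∈ A.gr n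
    by_cases hn : n = 0
    · subst hn; exact A.algebraMap_mem _
    · rw [A.augmentation_of_mem hn ha, map_zero]; exact zero_mem _)

theorem eq_algebraMap_of_initial (x : (⊥_ (ConnGrAlg R)).carrier) :
    x = algebraMap R _ ((⊥_ (ConnGrAlg R)).augmentation x) := by
  have h : 𝟙 (⊥_ (ConnGrAlg R)) = trivEnd _ := initial.hom_ext _ _
  exact AlgHom.congr_fun (congrArg toAlgHom h) x

/-- Every morphism which factors through the initial object `R` is the augmentation followed by
the unit map. -/
theorem toAlgHom_comp_initial {A B : ConnGrAlg R} (f : A ⟶ ⊥_ (ConnGrAlg R))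
    (g : ⊥_ (ConnGrAlg R) ⟶ B) (a : A.carrier) :
    toAlgHom (f ≫ g) a = algebraMap R B.carrier (A.augmentation a) := by
  change toAlgHom g (toAlgHom f a) = _
  rw [eq_algebraMap_of_initial (toAlgHom f a), AlgHom.commutes, augmentation_toAlgHom]

section BinaryCoproduct

variable (X Y : ConnGrAlg R)

/-- The family of two algebras underlying a binary coproduct. -/
abbrev pairFam (j : WalkingPair) : ConnGrAlg R := WalkingPair.casesOn j X Y

/-- The chosen coproduct `X ⨿ Y` is the free product. -/
def coprodIso : X ⨿ Y ≅ coprodObj (pairFam X Y) :=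
  colimit.isoColimitCocone (F := pair X Y)
    ⟨coprodCofan (pairFam X Y), coprodCofanIsColimit (pairFam X Y)⟩

theorem inl_coprodIso (x : X.carrier) :
    toAlgHom (coprodIso X Y).hom (toAlgHom (coprod.inl : X ⟶ X ⨿ Y) x) =
      FreeProd.ι (pairFam X Y) WalkingPair.left x := by
  have h : (coprod.inl : X ⟶ X ⨿ Y) ≫ (coprodIso X Y).hom =
      (coprodCofan (pairFam X Y)).ι.app ⟨WalkingPair.left⟩ :=
    colimit.isoColimitCocone_ι_hom (F := pair X Y) _ _
  exact AlgHom.congr_fun (congrArg toAlgHom h) x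

theorem inr_coprodIso (y : Y.carrier) :
    toAlgHom (coprodIso X Y).hom (toAlgHom (coprod.inr : Y ⟶ X ⨿ Y) y) =
      FreeProd.ι (pairFam X Y) WalkingPair.right y := by
  have h : (coprod.inr : Y ⟶ X ⨿ Y) ≫ (coprodIso X Y).hom =
      (coprodCofan (pairFam X Y)).ι.app ⟨WalkingPair.right⟩ :=
    colimit.isoColimitCocone_ι_hom (F := pair X Y) _ _
  exact AlgHom.congr_fun (congrArg toAlgHom h) y

variable {X Y} {B : Type*} [Ring B] [Algebra R B]

/-- The universal property of the free product with respect to arbitrary `R`-algebras, without any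
grading. -/
def coprodLift (f : X.carrier →ₐ[R] B) (g : Y.carrier →ₐ[R] B) : (X ⨿ Y).carrier →ₐ[R] B :=
  (FreeProd.lift (pairFam X Y) (fun j => match j with
    | WalkingPair.left => f
    | WalkingPair.right => g)).comp (toAlgHom (coprodIso X Y).hom)

@[simp] theorem coprodLift_inl (f : X.carrier →ₐ[R] B) (g : Y.carrier →ₐ[R] B) (x : X.carrier) :
    coprodLift f g (toAlgHom (coprod.inl : X ⟶ X ⨿ Y) x) = f x := by
  refine (congrArg (FreeProd.lift (pairFam X Y) _) (inl_coprodIso X Y x)).trans ?_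
  exact FreeProd.lift_ι _ _ _ _

@[simp] theorem coprodLift_inr (f : X.carrier →ₐ[R] B) (g : Y.carrier →ₐ[R] B) (y : Y.carrier) :
    coprodLift f g (toAlgHom (coprod.inr : Y ⟶ X ⨿ Y) y) = g y := by
  refine (congrArg (FreeProd.lift (pairFam X Y) _) (inr_coprodIso X Y y)).trans ?_
  exact FreeProd.lift_ι _ _ _ _

/-- The homogeneous elements of the two factors of a coproduct. -/
def pairGens (X Y : ConnGrAlg R) (d : ℕ) : Set (X ⨿ Y).carrier :=
  toAlgHom (coprod.inl : X ⟶ X ⨿ Y) '' X.gr d ∪ toAlgHom (coprod.inr : Y ⟶ X ⨿ Y) '' Y.gr d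

/-- The part of degree `n` of a coproduct is spanned by the words of degree `n` in homogeneous
elements of the factors. -/
theorem coprod_gr_le (n : ℕ) : (X ⨿ Y).gr n ≤ ConnGr.wordGrading R (pairGens X Y) n := by
  intro w hw
  have h1 : toAlgHom (coprodIso X Y).inv (toAlgHom (coprodIso X Y).hom w) = w :=
    AlgHom.congr_fun (congrArg toAlgHom (coprodIso X Y).hom_inv_id) w
  rw [← h1]
  refine ConnGr.map_mem_of_wordGrading (S := coprodGens (pairFam X Y)) _ _ ?_
    (toAlgHom_mem (coprodIso X Y).hom hw)
  rintro d _ ⟨j, a, ha, rfl⟩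
  apply ConnGr.subset_wordGrading
  cases j with
  | left =>
    left
    refine ⟨a, ha, ?_⟩
    rw [← inl_coprodIso]
    exact (AlgHom.congr_fun (congrArg toAlgHom (coprodIso X Y).hom_inv_id) _).symm
  | right =>
    right
    refine ⟨a, ha, ?_⟩
    rw [← inr_coprodIso]
    exact (AlgHom.congr_fun (congrArg toAlgHom (coprodIso X Y).hom_inv_id) _).symm

/-- Induction over the words in homogeneous elements of the factors of a coproduct. -/
@[elab_as_elim]
theorem coprod_induction {p : ∀ (n : ℕ) (w : (X ⨿ Y).carrier), w ∈ (X ⨿ Y).gr n → Prop}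
    (zero : ∀ n, p n 0 (zero_mem _)) (one : p 0 1 SetLike.GradedOne.one_mem)
    (add : ∀ n v w hv hw, p n v hv → p n w hw → p n (v + w) (add_mem hv hw))
    (smul : ∀ n (r : R) w hw, p n w hw → p n (r • w) (Submodule.smul_mem _ r hw))
    (inl_mul : ∀ d n x (hx : x ∈ X.gr d) w hw, p n w hw →
      p (d + n) (toAlgHom (coprod.inl : X ⟶ X ⨿ Y) x * w)
        (SetLike.GradedMul.mul_mem (toAlgHom_mem _ hx) hw))
    (inr_mul : ∀ d n y (hy : y ∈ Y.gr d) w hw, p n w hw →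
      p (d + n) (toAlgHom (coprod.inr : Y ⟶ X ⨿ Y) y * w)
        (SetLike.GradedMul.mul_mem (toAlgHom_mem _ hy) hw))
    {n : ℕ} {w : (X ⨿ Y).carrier} (hw : w ∈ (X ⨿ Y).gr n) : p n w hw := by
  have key : ∀ n x, ConnGr.IsWord (pairGens X Y) n x → ∃ hx : x ∈ (X ⨿ Y).gr n, p n x hx := by
    intro n x hx
    induction hx with
    | one => exact ⟨_, one⟩
    | @cons d n s x hs _ ih =>
      obtain ⟨hx, ih⟩ := ih
      rcases hs with ⟨a, ha, rfl⟩ | ⟨a, ha, rfl⟩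
      · exact ⟨_, inl_mul d n a ha x hx ih⟩
      · exact ⟨_, inr_mul d n a ha x hx ih⟩
  suffices h : ∃ hw : w ∈ (X ⨿ Y).gr n, p n w hw from h.2
  have h := coprod_gr_le n hw
  clear hw
  rw [ConnGr.wordGrading] at h
  induction h using Submodule.span_induction with
  | mem x hx => exact key n x hx
  | zero => exact ⟨_, zero n⟩
  | add a b _ _ ha hb => exact ⟨_, add n a b _ _ ha.2 hb.2⟩
  | smul r a _ ha => exact ⟨_, smul n r a _ ha.2⟩

end BinaryCoproduct

section Comonoid

variable (A : ConnGrAlg R)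

/-- The projection `A ∗ A → A` to the first factor. -/
def fstProj : A ⨿ A ⟶ A := coprod.desc (𝟙 A) A.trivEnd

/-- The projection `A ∗ A → A` to the second factor. -/
def sndProj : A ⨿ A ⟶ A := coprod.desc A.trivEnd (𝟙 A)

theorem fstProj_inl (a : A.carrier) : toAlgHom A.fstProj (toAlgHom coprod.inl a) = a :=
  AlgHom.congr_fun (congrArg toAlgHom (coprod.inl_desc (𝟙 A) A.trivEnd)) a

theorem fstProj_inr (a : A.carrier) : toAlgHom A.fstProj (toAlgHom coprod.inr a) =
    algebraMap R _ (A.augmentation a) :=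
  AlgHom.congr_fun (congrArg toAlgHom (coprod.inr_desc (𝟙 A) A.trivEnd)) a

theorem sndProj_inl (a : A.carrier) : toAlgHom A.sndProj (toAlgHom coprod.inl a) =
    algebraMap R _ (A.augmentation a) :=
  AlgHom.congr_fun (congrArg toAlgHom (coprod.inl_desc A.trivEnd (𝟙 A))) a

theorem sndProj_inr (a : A.carrier) : toAlgHom A.sndProj (toAlgHom coprod.inr a) = a :=
  AlgHom.congr_fun (congrArg toAlgHom (coprod.inr_desc A.trivEnd (𝟙 A))) a

variable [ComonObj A]

/-- The comultiplication `A → A ∗ A`. -/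
def comulHom : A ⟶ A ⨿ A := ComonObj.comul (X := A)

/-- The counit `A → R`. -/
def counitHom : A ⟶ ⊥_ (ConnGrAlg R) := ComonObj.counit (X := A)

/-- The counit law, rewritten in `A` itself: the initial object of the comonoid axioms is replaced by
its image under the unit map. -/
theorem comulHom_counit_left :
    A.comulHom ≫ coprod.desc (A.counitHom ≫ initial.to A) (𝟙 A) = 𝟙 A := by
  have h : A.comulHom ≫ coprod.map A.counitHom (𝟙 A) =
      (coprod.inr : A ⟶ (⊥_ (ConnGrAlg R)) ⨿ A) := ComonObj.counit_comul A
  have h2 := congrArg (· ≫ coprod.desc (initial.to A) (𝟙 A)) h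
  simp only [Category.assoc, coprod.map_desc, Category.id_comp] at h2
  exact h2.trans (coprod.inr_desc _ _)

theorem comulHom_counit_right :
    A.comulHom ≫ coprod.desc (𝟙 A) (A.counitHom ≫ initial.to A) = 𝟙 A := by
  have h : A.comulHom ≫ coprod.map (𝟙 A) A.counitHom =
      (coprod.inl : A ⟶ A ⨿ (⊥_ (ConnGrAlg R))) := ComonObj.comul_counit A
  have h2 := congrArg (· ≫ coprod.desc (𝟙 A) (initial.to A)) h
  simp only [Category.assoc, coprod.map_desc, Category.id_comp] at h2
  exact h2.trans (coprod.inl_desc _ _)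

theorem counitHom_comp_initial_to : A.counitHom ≫ initial.to A = A.trivEnd :=
  hom_ext (AlgHom.ext fun a => toAlgHom_comp_initial _ _ a)

theorem fstProj_comul (a : A.carrier) :
    toAlgHom A.fstProj (toAlgHom A.comulHom a) = a := by
  have h := A.comulHom_counit_right
  rw [counitHom_comp_initial_to] at h
  exact AlgHom.congr_fun (congrArg toAlgHom h) a

theorem sndProj_comul (a : A.carrier) :
    toAlgHom A.sndProj (toAlgHom A.comulHom a) = a := by
  have h := A.comulHom_counit_left
  rw [counitHom_comp_initial_to] at h
  exact AlgHom.congr_fun (congrArg toAlgHom h) a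

end Comonoid

end ConnGrAlg

/-! ### The derivation of a comonoid -/

namespace ConnGrAlg

variable {R : Type u} [CommRing R]

section TriangularMatrices

variable {A S : Type*} [Ring A] [Algebra R A] [Ring S] [Algebra R S]

/-- The homomorphism to diagonal matrices with entries `p a` and `q a`. -/
def diagHom (p q : A →ₐ[R] S) : A →ₐ[R] Matrix (Fin 2) (Fin 2) S :=
  AlgHom.ofLinearMap
    { toFun := fun a => !![p a, 0; 0, q a]
      map_add' := fun a b => by ext i j; fin_cases i <;> fin_cases j <;> simp
      map_smul' := fun r a => by ext i j; fin_cases i <;> fin_cases j <;> simp }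
    (by ext i j; fin_cases i <;> fin_cases j <;> simp)
    (fun a b => by ext i j; fin_cases i <;> fin_cases j <;> simp)

/-- The homomorphism `diagHom p q` conjugated by the elementary matrix with upper right entry
`1`. -/
def triangHom (p q : A →ₐ[R] S) : A →ₐ[R] Matrix (Fin 2) (Fin 2) S :=
  AlgHom.ofLinearMap
    { toFun := fun a => !![p a, p a - q a; 0, q a]
      map_add' := fun a b => by
        ext i j; fin_cases i <;> fin_cases j <;> simp [sub_add_sub_comm]
      map_smul' := fun r a => by
        ext i j; fin_cases i <;> fin_cases j <;> simp [smul_sub] }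
    (by ext i j; fin_cases i <;> fin_cases j <;> simp)
    (fun a b => by
      ext i j; fin_cases i <;> fin_cases j <;> simp [mul_sub, sub_mul])

theorem diagHom_apply (p q : A →ₐ[R] S) (a : A) : diagHom p q a = !![p a, 0; 0, q a] := rfl

theorem triangHom_apply (p q : A →ₐ[R] S) (a : A) :
    triangHom p q a = !![p a, p a - q a; 0, q a] := rfl

end TriangularMatrices

variable (A : ConnGrAlg R)

/-- The part of degree `n` of `Ā ⊗ Ā`, as a submodule of `A ⊗ A`. -/
def redTensor (n : ℕ) : Submodule R (A.carrier ⊗[R] A.carrier) :=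
  Submodule.span R {t | ∃ i j : ℕ, i ≠ 0 ∧ j ≠ 0 ∧ i + j = n ∧
    ∃ a ∈ A.gr i, ∃ b ∈ A.gr j, a ⊗ₜ[R] b = t}

variable {A} in
theorem tmul_mem_redTensor {i j : ℕ} (hi : i ≠ 0) (hj : j ≠ 0) {a b : A.carrier}
    (ha : a ∈ A.gr i) (hb : b ∈ A.gr j) : a ⊗ₜ[R] b ∈ A.redTensor (i + j) :=
  Submodule.subset_span ⟨i, j, hi, hj, rfl, a, ha, b, hb, rfl⟩

variable {A} in
theorem tmul_one_mul_mem_redTensor {d n : ℕ} {x : A.carrier} (hx : x ∈ A.gr d)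
    {t : A.carrier ⊗[R] A.carrier} (ht : t ∈ A.redTensor n) :
    (x ⊗ₜ[R] 1) * t ∈ A.redTensor (d + n) := by
  refine (Submodule.span_le (p := (A.redTensor (d + n)).comap
    (LinearMap.mulLeft R (x ⊗ₜ[R] (1 : A.carrier))))).2 ?_ ht
  rintro _ ⟨i, j, hi, hj, rfl, a, ha, b, hb, rfl⟩
  change (x ⊗ₜ[R] 1) * (a ⊗ₜ[R] b) ∈ A.redTensor (d + (i + j))
  rw [Algebra.TensorProduct.tmul_mul_tmul, one_mul, ← add_assoc]
  exact tmul_mem_redTensor (by omega) hj (SetLike.GradedMul.mul_mem hx ha) hb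

/-- The homomorphism `a ↦ a ⊗ 1`. -/
abbrev leftIncl : A.carrier →ₐ[R] A.carrier ⊗[R] A.carrier :=
  Algebra.TensorProduct.includeLeft

/-- The homomorphism `a ↦ 1 ⊗ a`. -/
abbrev rightIncl : A.carrier →ₐ[R] A.carrier ⊗[R] A.carrier :=
  Algebra.TensorProduct.includeRight

/-- The homomorphism `a ↦ ε(a) (1 ⊗ 1)`. -/
abbrev augIncl : A.carrier →ₐ[R] A.carrier ⊗[R] A.carrier :=
  (Algebra.ofId R _).comp A.augmentation

/-- The homomorphism `A ∗ A → M₂(A ⊗ A)` whose upper right entry sends a product `a'b''` with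
`a, b ∈ Ā` to `a ⊗ b`, and sends every word in which a letter from the second factor precedes one
from the first to zero. It isolates the summand `Ā' ⊗ Ā''` of `A ∗ A`. -/
def matHom : (A ⨿ A).carrier →ₐ[R] Matrix (Fin 2) (Fin 2) (A.carrier ⊗[R] A.carrier) :=
  coprodLift (triangHom A.leftIncl A.augIncl) (diagHom A.augIncl A.rightIncl)

theorem matHom_inl (a : A.carrier) : A.matHom (toAlgHom coprod.inl a) =
    !![a ⊗ₜ 1, a ⊗ₜ 1 - algebraMap R _ (A.augmentation a); 0,
      algebraMap R _ (A.augmentation a)] := by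
  rw [matHom, coprodLift_inl, triangHom_apply]
  rfl

theorem matHom_inr (a : A.carrier) : A.matHom (toAlgHom coprod.inr a) =
    !![algebraMap R _ (A.augmentation a), 0; 0, 1 ⊗ₜ a] := by
  rw [matHom, coprodLift_inr, diagHom_apply]
  rfl

theorem algebraMap_eq_tmul_one (r : R) :
    algebraMap R (A.carrier ⊗[R] A.carrier) r = algebraMap R A.carrier r ⊗ₜ 1 := rfl

theorem algebraMap_eq_one_tmul (r : R) :
    algebraMap R (A.carrier ⊗[R] A.carrier) r = 1 ⊗ₜ algebraMap R A.carrier r := by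
  rw [algebraMap_eq_tmul_one, Algebra.algebraMap_eq_smul_one, TensorProduct.smul_tmul]

theorem matHom_diagonal_of_mem {n : ℕ} {w : (A ⨿ A).carrier} (hw : w ∈ (A ⨿ A).gr n) :
    A.matHom w 0 0 = toAlgHom A.fstProj w ⊗ₜ 1 ∧ A.matHom w 1 0 = 0 ∧
      A.matHom w 1 1 = 1 ⊗ₜ toAlgHom A.sndProj w := by
  induction hw using coprod_induction with
  | zero n => simp
  | one => simp [Algebra.TensorProduct.one_def]
  | add n v w _ _ hv hw =>
    simp only [map_add, Matrix.add_apply, hv.1, hv.2.1, hv.2.2, hw.1, hw.2.1, hw.2.2,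
      TensorProduct.add_tmul, TensorProduct.tmul_add, add_zero, and_self]
  | smul n r w _ hw =>
    simp only [map_smul, Matrix.smul_apply, hw.1, hw.2.1, hw.2.2, smul_zero,
      TensorProduct.smul_tmul', TensorProduct.tmul_smul, and_self]
  | inl_mul d n x hx w _ hw =>
    simp only [map_mul, matHom_inl, Matrix.mul_apply, Fin.sum_univ_two, hw.1, hw.2.1, hw.2.2,
      fstProj_inl, sndProj_inl]
    refine ⟨?_, ?_, ?_⟩
    · simp
    · simp
    · have h := A.algebraMap_eq_one_tmul (A.augmentation x)
      rw [algebraMap_eq_tmul_one] at h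
      simp [h]
  | inr_mul d n x hx w _ hw =>
    simp only [map_mul, matHom_inr, Matrix.mul_apply, Fin.sum_univ_two, hw.1, hw.2.1, hw.2.2,
      fstProj_inr, sndProj_inr]
    refine ⟨?_, ?_, ?_⟩
    · simp
    · simp
    · simp

theorem matHom_diagonal (w : (A ⨿ A).carrier) :
    A.matHom w 0 0 = toAlgHom A.fstProj w ⊗ₜ 1 ∧ A.matHom w 1 0 = 0 ∧
      A.matHom w 1 1 = 1 ⊗ₜ toAlgHom A.sndProj w := by
  induction w using DirectSum.Decomposition.inductionOn (A ⨿ A).gr with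
  | zero => simp
  | homogeneous m => exact A.matHom_diagonal_of_mem m.2
  | add v w hv hw =>
    simp only [map_add, Matrix.add_apply, hv.1, hv.2.1, hv.2.2, hw.1, hw.2.1, hw.2.2,
      TensorProduct.add_tmul, TensorProduct.tmul_add, add_zero, and_self]

/-- The upper right entry of `matHom`, without its component in `Ā ⊗ 1`. -/
def matHomUpper : (A ⨿ A).carrier →ₗ[R] A.carrier ⊗[R] A.carrier :=
  Matrix.entryLinearMap R _ 0 1 ∘ₗ A.matHom.toLinearMap -
    (A.leftIncl.toLinearMap ∘ₗ (toAlgHom A.fstProj).toLinearMap -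
      Algebra.linearMap R _ ∘ₗ (A ⨿ A).augmentation.toLinearMap)

theorem matHomUpper_apply (w : (A ⨿ A).carrier) : A.matHomUpper w =
    A.matHom w 0 1 - (toAlgHom A.fstProj w ⊗ₜ 1 -
      algebraMap R _ ((A ⨿ A).augmentation w)) := rfl

theorem matHomUpper_mem {n : ℕ} {w : (A ⨿ A).carrier} (hw : w ∈ (A ⨿ A).gr n) :
    A.matHomUpper w ∈ A.redTensor n := by
  induction hw using coprod_induction with
  | zero n => simp
  | one => simp [matHomUpper_apply]
  | add n v w _ _ hv hw => rw [map_add]; exact add_mem hv hw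
  | smul n r w _ hw => rw [map_smul]; exact Submodule.smul_mem _ r hw
  | inl_mul d n x hx w hw' hw =>
    have h1 := A.matHom_diagonal w
    by_cases hd : d = 0
    · subst hd
      rw [← A.algebraMap_augmentation_of_mem hx, zero_add, AlgHom.commutes, ← Algebra.smul_def,
        map_smul]
      exact Submodule.smul_mem _ _ hw
    · have hε : A.augmentation x = 0 := A.augmentation_of_mem hd hx
      have h2 : x ⊗ₜ[R] (toAlgHom A.sndProj w -
          algebraMap R _ ((A ⨿ A).augmentation w)) ∈ A.redTensor (d + n) := by
        by_cases hn : n = 0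
        · subst hn
          rw [← (A ⨿ A).algebraMap_augmentation_of_mem hw', AlgHom.commutes, AlgHom.commutes]
          simp
        · rw [(A ⨿ A).augmentation_of_mem hn hw', map_zero, sub_zero]
          exact tmul_mem_redTensor hd hn hx (toAlgHom_mem _ hw')
      convert add_mem (tmul_one_mul_mem_redTensor hx hw) h2 using 1
      rw [matHomUpper_apply, matHomUpper_apply, map_mul, map_mul, map_mul, matHom_inl,
        Matrix.mul_apply, Fin.sum_univ_two, h1.2.2, fstProj_inl, augmentation_toAlgHom, hε,
        mul_sub, mul_sub, TensorProduct.tmul_sub, algebraMap_eq_one_tmul _ ((A ⨿ A).augmentation w)]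
      simp
      abel
  | inr_mul d n x hx w hw' hw =>
    by_cases hd : d = 0
    · subst hd
      rw [← A.algebraMap_augmentation_of_mem hx, zero_add, AlgHom.commutes, ← Algebra.smul_def,
        map_smul]
      exact Submodule.smul_mem _ _ hw
    · have hε : A.augmentation x = 0 := A.augmentation_of_mem hd hx
      rw [matHomUpper_apply, map_mul, map_mul, map_mul, matHom_inr, Matrix.mul_apply,
        Fin.sum_univ_two, fstProj_inr, augmentation_toAlgHom, hε]
      simp

section Comonoid

variable [ComonObj A]

/-- The derivation `d : A → A ⊗ A` of a comonoid: up to the summand `x ⊗ 1`, it is the component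
in `Ā' ⊗ Ā''` of the comultiplication. -/
def coderiv : A.carrier →ₗ[R] A.carrier ⊗[R] A.carrier :=
  Matrix.entryLinearMap R _ 0 1 ∘ₗ A.matHom.toLinearMap ∘ₗ (toAlgHom A.comulHom).toLinearMap

theorem coderiv_apply (x : A.carrier) :
    A.coderiv x = A.matHom (toAlgHom A.comulHom x) 0 1 := rfl

theorem coderiv_one : A.coderiv 1 = 0 := by
  simp [coderiv_apply]

theorem coderiv_algebraMap (r : R) : A.coderiv (algebraMap R _ r) = 0 := by
  rw [Algebra.algebraMap_eq_smul_one, map_smul, coderiv_one, smul_zero]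

theorem coderiv_mul (a b : A.carrier) :
    A.coderiv (a * b) = (a ⊗ₜ 1) * A.coderiv b + A.coderiv a * (1 ⊗ₜ b) := by
  rw [coderiv_apply, map_mul, map_mul, Matrix.mul_apply, Fin.sum_univ_two,
    (A.matHom_diagonal _).1, (A.matHom_diagonal _).2.2, fstProj_comul, sndProj_comul]
  rfl

/-- For homogeneous `x` of positive degree, `d(x) = x ⊗ 1 + δ(x)` with `δ(x) ∈ Ā ⊗ Ā`. -/
theorem coderiv_sub_mem {n : ℕ} (hn : n ≠ 0) {x : A.carrier} (hx : x ∈ A.gr n) :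
    A.coderiv x - x ⊗ₜ 1 ∈ A.redTensor n := by
  have h := A.matHomUpper_mem (toAlgHom_mem A.comulHom hx)
  rwa [matHomUpper_apply, fstProj_comul, augmentation_toAlgHom, A.augmentation_of_mem hn hx, map_zero,
    sub_zero] at h

end Comonoid

end ConnGrAlg

/-! ### Freeness of the underlying algebra -/

namespace ConnGrAlg

variable {R : Type u} [CommRing R] (A : ConnGrAlg R)

section Recursion

variable {M : Type*} [AddCommGroup M] [Module R M]

/-- Recursion on the degree: an operator on linear maps `A → M` whose value in degree `n` only
depends on the argument in degrees below `n` has a fixed point. -/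
theorem exists_fixedPoint (Ψ : (A.carrier →ₗ[R] M) → (A.carrier →ₗ[R] M))
    (hΨ : ∀ n f g, (∀ m < n, ∀ x ∈ A.gr m, f x = g x) → ∀ x ∈ A.gr n, Ψ f x = Ψ g x) :
    ∃ f, Ψ f = f := by
  -- In degree `n`, the iterates of `Ψ` are stationary from the `(n + 1)`-st on.
  set F : ℕ → A.carrier →ₗ[R] M := fun n => Ψ^[n] 0 with hF
  have hsucc : ∀ n, F (n + 1) = Ψ (F n) := fun n => Function.iterate_succ_apply' Ψ n 0
  have hstep : ∀ n, ∀ m < n, ∀ x ∈ A.gr m, F (n + 1) x = F n x := by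
    intro n
    induction n with
    | zero => intro m hm; omega
    | succ n ih =>
      intro m hm x hx
      rw [hsucc (n + 1)]
      refine Eq.trans ?_ (LinearMap.congr_fun (hsucc n) x).symm
      exact hΨ m _ _ (fun k hk y hy => ih k (by omega) y hy) x hx
  have hstable : ∀ m x, x ∈ A.gr m → ∀ k, F (m + 1 + k) x = F (m + 1) x := by
    intro m x hx k
    induction k with
    | zero => rfl
    | succ k ih => rw [← add_assoc, hstep _ m (by omega) x hx, ih]
  let f : A.carrier →ₗ[R] M :=
    DirectSum.toModule R ℕ M (fun n => F (n + 1) ∘ₗ (A.gr n).subtype) ∘ₗ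
    (DirectSum.decomposeLinearEquiv A.gr).toLinearMap
  have hf : ∀ m x, x ∈ A.gr m → f x = F (m + 1) x := by
    intro m x hx
    simp only [f, LinearMap.comp_apply, LinearEquiv.coe_coe, DirectSum.decomposeLinearEquiv_apply]
    rw [DirectSum.decompose_of_mem _ hx, ← DirectSum.lof_eq_of R, DirectSum.toModule_lof]
    rfl
  refine ⟨f, LinearMap.ext fun x => ?_⟩
  induction x using DirectSum.Decomposition.inductionOn A.gr with
  | zero => simp
  | @homogeneous n x =>
    rw [hf n x x.2, hsucc]
    refine hΨ n _ _ (fun m hm y hy => ?_) x x.2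
    obtain ⟨k, rfl⟩ := Nat.exists_eq_add_of_le (Nat.succ_le_of_lt hm)
    rw [hf m y hy]
    exact (hstable m y hy k).symm
  | add x y hx hy => rw [map_add, map_add, hx, hy]

variable {A} in
theorem eq_of_mem_redTensor {n : ℕ} {t : A.carrier ⊗[R] A.carrier} (ht : t ∈ A.redTensor n)
    {f g : A.carrier ⊗[R] A.carrier →ₗ[R] M}
    (h : ∀ i j, i ≠ 0 → j ≠ 0 → i + j = n → ∀ a ∈ A.gr i, ∀ b ∈ A.gr j,
      f (a ⊗ₜ b) = g (a ⊗ₜ b)) : f t = g t := by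
  refine LinearMap.eqOn_span ?_ ht
  rintro _ ⟨i, j, hi, hj, hij, a, ha, b, hb, rfl⟩
  exact h i j hi hj hij a ha b hb

variable {A} in
theorem mem_of_mem_redTensor {n : ℕ} {t : A.carrier ⊗[R] A.carrier} (ht : t ∈ A.redTensor n)
    {f : A.carrier ⊗[R] A.carrier →ₗ[R] M} {p : Submodule R M}
    (h : ∀ i j, i ≠ 0 → j ≠ 0 → i + j = n → ∀ a ∈ A.gr i, ∀ b ∈ A.gr j,
      f (a ⊗ₜ b) ∈ p) : f t ∈ p := by
  refine (Submodule.span_le (p := p.comap f)).2 ?_ ht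
  rintro _ ⟨i, j, hi, hj, hij, a, ha, b, hb, rfl⟩
  exact h i j hi hj hij a ha b hb

end Recursion

/-- The projection `x ↦ x - ε(x)` to `Ā`. -/
def barProj : A.carrier →ₗ[R] A.carrier :=
  LinearMap.id - Algebra.linearMap R _ ∘ₗ A.augmentation.toLinearMap

theorem barProj_apply (x : A.carrier) :
    A.barProj x = x - algebraMap R _ (A.augmentation x) := rfl

theorem barProj_of_mem {n : ℕ} (hn : n ≠ 0) {x : A.carrier} (hx : x ∈ A.gr n) :
    A.barProj x = x := by
  rw [barProj_apply, A.augmentation_of_mem hn hx, map_zero, sub_zero]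

theorem barProj_of_mem_zero {x : A.carrier} (hx : x ∈ A.gr 0) : A.barProj x = 0 := by
  rw [barProj_apply, A.algebraMap_augmentation_of_mem hx, sub_self]

theorem map_mul_one_tmul {C : Type*} [Ring C] [Algebra R C] (f : A.carrier →ₗ[R] C)
    (t : A.carrier ⊗[R] A.carrier) (b : A.carrier) :
    TensorProduct.map f LinearMap.id (t * (1 ⊗ₜ[R] b)) =
      TensorProduct.map f LinearMap.id t * ((1 : C) ⊗ₜ[R] b) := by
  induction t with
  | zero => simp
  | tmul x y => simp
  | add s t hs ht => rw [add_mul, map_add, hs, ht, map_add, add_mul]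

theorem mul'_mul_one_tmul (t : A.carrier ⊗[R] A.carrier) (b : A.carrier) :
    LinearMap.mul' R A.carrier (t * (1 ⊗ₜ[R] b)) = LinearMap.mul' R A.carrier t * b := by
  induction t with
  | zero => simp
  | tmul x y => simp [mul_assoc]
  | add s t hs ht => rw [add_mul, map_add, hs, ht, map_add, add_mul]

variable [ComonObj A]

/-- The reduced part `δ(x) ∈ Ā ⊗ Ā` of `d(x)`. -/
def redCoderiv : A.carrier →ₗ[R] A.carrier ⊗[R] A.carrier :=
  A.coderiv - (TensorProduct.mk R A.carrier A.carrier).flip 1 ∘ₗ A.barProj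

theorem coderiv_eq (x : A.carrier) : A.coderiv x = A.barProj x ⊗ₜ 1 + A.redCoderiv x :=
  (add_sub_cancel _ _).symm

theorem redCoderiv_mem {n : ℕ} {x : A.carrier} (hx : x ∈ A.gr n) :
    A.redCoderiv x ∈ A.redTensor n := by
  by_cases hn : n = 0
  · subst hn
    have h : A.redCoderiv x = 0 := by
      change A.coderiv x - A.barProj x ⊗ₜ 1 = 0
      rw [A.barProj_of_mem_zero hx, ← A.algebraMap_augmentation_of_mem hx, coderiv_algebraMap,
        TensorProduct.zero_tmul, sub_zero]
    rw [h]
    exact zero_mem _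
  · change A.coderiv x - A.barProj x ⊗ₜ 1 ∈ _
    rw [A.barProj_of_mem hn hx]
    exact A.coderiv_sub_mem hn hx

theorem exists_primProj : ∃ e : A.carrier →ₗ[R] A.carrier,
    A.barProj - LinearMap.mul' R A.carrier ∘ₗ TensorProduct.map e LinearMap.id ∘ₗ A.redCoderiv =
      e := by
  refine A.exists_fixedPoint (fun e => A.barProj -
    LinearMap.mul' R A.carrier ∘ₗ TensorProduct.map e LinearMap.id ∘ₗ A.redCoderiv) ?_
  intro n f g h x hx
  refine congrArg (A.barProj x - ·) ?_
  refine eq_of_mem_redTensor (f := LinearMap.mul' R A.carrier ∘ₗ TensorProduct.map f LinearMap.id)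
    (g := LinearMap.mul' R A.carrier ∘ₗ TensorProduct.map g LinearMap.id)
    (A.redCoderiv_mem hx) ?_
  intro i j hi hj hij a ha b hb
  simp [h i (by omega) a ha]

/-- The projection `e : A → A` onto a complement of `R ⊕ Ā²`, where `Ā²` is the submodule of
decomposable elements; it is defined recursively by `e(x) = x - ε(x) - ∑ e(yᵢ) zᵢ` with
`δ(x) = ∑ yᵢ ⊗ zᵢ`. Its image freely generates `A`. -/
def primProj : A.carrier →ₗ[R] A.carrier := A.exists_primProj.choose

theorem primProj_eq (x : A.carrier) : A.primProj x = A.barProj x -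
    LinearMap.mul' R A.carrier (TensorProduct.map A.primProj LinearMap.id (A.redCoderiv x)) :=
  LinearMap.congr_fun A.exists_primProj.choose_spec.symm x

/-- The map `λ = (e ⊗ 1) ∘ d`. -/
def splitMap : A.carrier →ₗ[R] A.carrier ⊗[R] A.carrier :=
  TensorProduct.map A.primProj LinearMap.id ∘ₗ A.coderiv

theorem splitMap_apply (x : A.carrier) :
    A.splitMap x = TensorProduct.map A.primProj LinearMap.id (A.coderiv x) := rfl

theorem primProj_of_mem_zero {x : A.carrier} (hx : x ∈ A.gr 0) : A.primProj x = 0 := by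
  rw [primProj_eq, A.barProj_of_mem_zero hx, zero_sub, neg_eq_zero]
  refine eq_of_mem_redTensor (f := LinearMap.mul' R A.carrier ∘ₗ
    TensorProduct.map A.primProj LinearMap.id) (g := 0) (A.redCoderiv_mem hx) ?_
  intro i j hi hj hij
  omega

theorem primProj_algebraMap (r : R) : A.primProj (algebraMap R _ r) = 0 :=
  A.primProj_of_mem_zero (A.algebraMap_mem r)

theorem primProj_barProj (x : A.carrier) : A.primProj (A.barProj x) = A.primProj x := by
  rw [barProj_apply, map_sub, primProj_algebraMap, sub_zero]

theorem splitMap_eq (x : A.carrier) : A.splitMap x = A.primProj x ⊗ₜ 1 +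
    TensorProduct.map A.primProj LinearMap.id (A.redCoderiv x) := by
  rw [splitMap_apply, coderiv_eq, map_add, TensorProduct.map_tmul, primProj_barProj]
  rfl

/-- Since `μ ∘ λ` is the projection to `Ā`, every element of `Ā` is a sum of products with first
factor in the image of `e`. -/
theorem mul_splitMap (x : A.carrier) : LinearMap.mul' R A.carrier (A.splitMap x) =
    A.barProj x := by
  rw [splitMap_eq, map_add, LinearMap.mul'_apply, mul_one]
  exact eq_sub_iff_add_eq.1 (A.primProj_eq x)

theorem primProj_mem {n : ℕ} {x : A.carrier} (hx : x ∈ A.gr n) : A.primProj x ∈ A.gr n := by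
  induction n using Nat.strong_induction_on generalizing x with
  | _ n ih =>
    by_cases hn : n = 0
    · subst hn
      rw [A.primProj_of_mem_zero hx]
      exact zero_mem _
    · rw [primProj_eq, A.barProj_of_mem hn hx]
      refine sub_mem hx ?_
      refine mem_of_mem_redTensor (f := LinearMap.mul' R A.carrier ∘ₗ
        TensorProduct.map A.primProj LinearMap.id) (A.redCoderiv_mem hx) ?_
      rintro i j hi hj rfl a ha b hb
      exact SetLike.GradedMul.mul_mem (ih i (by omega) ha) hb

theorem augmentation_primProj (x : A.carrier) : A.augmentation (A.primProj x) = 0 := by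
  induction x using A.homogeneous_induction with
  | zero r => rw [primProj_algebraMap, map_zero]
  | pos n hn a ha => exact A.augmentation_of_mem hn (A.primProj_mem ha)
  | add a b ha hb => rw [map_add, map_add, ha, hb, add_zero]

/-- The projection `e` vanishes on decomposable elements. -/
theorem primProj_mul {i j : ℕ} (hi : i ≠ 0) (hj : j ≠ 0) {a b : A.carrier} (ha : a ∈ A.gr i)
    (hb : b ∈ A.gr j) : A.primProj (a * b) = 0 := by
  induction j using Nat.strong_induction_on generalizing i a b with
  | _ j ih =>
    have h1 := A.mul_splitMap (a * b)
    rw [A.barProj_of_mem (show i + j ≠ 0 by omega) (SetLike.GradedMul.mul_mem ha hb),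
      splitMap_apply, coderiv_mul, map_add, map_add, map_mul_one_tmul, mul'_mul_one_tmul,
      ← splitMap_apply, mul_splitMap, A.barProj_of_mem hi ha, add_eq_right, coderiv_eq,
      A.barProj_of_mem hj hb, mul_add, map_add, map_add, Algebra.TensorProduct.tmul_mul_tmul,
      TensorProduct.map_tmul, LinearMap.mul'_apply] at h1
    have h2 : LinearMap.mul' R A.carrier (TensorProduct.map A.primProj LinearMap.id
        ((a ⊗ₜ 1) * A.redCoderiv b)) = 0 := by
      refine eq_of_mem_redTensor (f := LinearMap.mul' R A.carrier ∘ₗ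
        TensorProduct.map A.primProj LinearMap.id ∘ₗ LinearMap.mulLeft R (a ⊗ₜ[R] (1 : A.carrier)))
        (g := 0) (A.redCoderiv_mem hb) ?_
      rintro k l hk hl rfl x hx y hy
      simp [ih k (by omega) hi hk ha hx]
    rw [h2, add_zero] at h1
    simpa using h1

/-- By its recursive definition `e(x)` differs from `x` by a scalar and decomposables, on all of
which `e` vanishes. -/
theorem primProj_primProj (x : A.carrier) : A.primProj (A.primProj x) = A.primProj x := by
  induction x using A.homogeneous_induction with
  | zero r => rw [primProj_algebraMap, map_zero]
  | pos n hn x hx =>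
    rw [A.primProj_eq x, map_sub, primProj_barProj, ← A.primProj_eq x, sub_eq_self]
    refine eq_of_mem_redTensor (f := A.primProj ∘ₗ LinearMap.mul' R A.carrier ∘ₗ
      TensorProduct.map A.primProj LinearMap.id) (g := 0) (A.redCoderiv_mem hx) ?_
    intro i j hi hj _ a ha b hb
    exact A.primProj_mul hi hj (A.primProj_mem ha) hb
  | add a b ha hb => rw [map_add, map_add, ha, hb]

/-- The map `λ` is linear for right multiplication on `Ā`: in the derivation rule for `d(ab)`, the
term `(a ⊗ 1) d(b)` has decomposable left factors and is killed by `e`. -/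
theorem splitMap_mul {i : ℕ} (hi : i ≠ 0) {a : A.carrier} (ha : a ∈ A.gr i) (b : A.carrier) :
    A.splitMap (a * b) = A.splitMap a * (1 ⊗ₜ b) := by
  have h : TensorProduct.map A.primProj LinearMap.id ((a ⊗ₜ 1) * A.coderiv b) = 0 := by
    induction b using A.homogeneous_induction with
    | zero r => rw [coderiv_algebraMap, mul_zero, map_zero]
    | pos j hj b hb =>
      rw [coderiv_eq, A.barProj_of_mem hj hb, mul_add, map_add,
        Algebra.TensorProduct.tmul_mul_tmul, TensorProduct.map_tmul, A.primProj_mul hi hj ha hb,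
        TensorProduct.zero_tmul, zero_add]
      refine eq_of_mem_redTensor (f := TensorProduct.map A.primProj LinearMap.id ∘ₗ
        LinearMap.mulLeft R (a ⊗ₜ[R] (1 : A.carrier))) (g := 0) (A.redCoderiv_mem hb) ?_
      intro k l hk hl _ x hx y hy
      simp [A.primProj_mul hi hk ha hx]
    | add x y hx hy => rw [map_add, mul_add, map_add, hx, hy, add_zero]
  rw [splitMap_apply, coderiv_mul, map_add, h, zero_add, map_mul_one_tmul]
  rfl

/-- On the image of `e` the map `λ` is `p ↦ p ⊗ 1`. The remaining terms `η` of `λ(p)` have image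
zero under the multiplication `μ`, and `λ ∘ μ` fixes `η` by induction on the degree. -/
theorem splitMap_primProj (x : A.carrier) : A.splitMap (A.primProj x) = A.primProj x ⊗ₜ 1 := by
  have key : ∀ n, ∀ x ∈ A.gr n, A.splitMap (A.primProj x) = A.primProj x ⊗ₜ 1 := by
    intro n
    induction n using Nat.strong_induction_on with
    | _ n ih =>
      intro x hx
      by_cases hn : n = 0
      · subst hn
        rw [A.primProj_of_mem_zero hx, map_zero, TensorProduct.zero_tmul]
      have hy := A.primProj_mem hx
      set y := A.primProj x with hy'
      have hey : A.primProj y = y := A.primProj_primProj x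
      have h1 := A.splitMap_eq y
      rw [hey] at h1
      set η := TensorProduct.map A.primProj LinearMap.id (A.redCoderiv y) with hη
      have h2 : LinearMap.mul' R A.carrier η = 0 := by
        have h := A.mul_splitMap y
        rw [h1, map_add, A.barProj_of_mem hn hy, LinearMap.mul'_apply, mul_one,
          add_eq_left] at h
        exact h
      have h3 : A.splitMap (LinearMap.mul' R A.carrier η) = η := by
        refine eq_of_mem_redTensor (f := A.splitMap ∘ₗ LinearMap.mul' R A.carrier ∘ₗ
          TensorProduct.map A.primProj LinearMap.id)
          (g := TensorProduct.map A.primProj LinearMap.id) (A.redCoderiv_mem hy) ?_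
        intro i j hi hj hij a ha b hb
        change A.splitMap (A.primProj a * b) = A.primProj a ⊗ₜ b
        rw [A.splitMap_mul hi (A.primProj_mem ha), ih i (by omega) a ha,
          Algebra.TensorProduct.tmul_mul_tmul, mul_one, one_mul]
      rw [h1, ← h3, h2, map_zero, add_zero]
  induction x using A.homogeneous_induction with
  | zero r => rw [primProj_algebraMap, map_zero, TensorProduct.zero_tmul]
  | pos n hn x hx => exact key n x hx
  | add a b ha hb => rw [map_add, map_add, ha, hb, TensorProduct.add_tmul]

theorem splitMap_primProj_mul (x b : A.carrier) :
    A.splitMap (A.primProj x * b) = A.primProj x ⊗ₜ b := by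
  induction x using A.homogeneous_induction with
  | zero r => rw [primProj_algebraMap, zero_mul, map_zero, TensorProduct.zero_tmul]
  | pos n hn x hx =>
    rw [A.splitMap_mul hn (A.primProj_mem hx), splitMap_primProj,
      Algebra.TensorProduct.tmul_mul_tmul, mul_one, one_mul]
  | add x y hx hy => rw [map_add, add_mul, map_add, hx, hy, TensorProduct.add_tmul]

section Freeness

variable {V : Type*} [AddCommGroup V] [Module R V] (inc : V →ₗ[R] A.carrier)

/-- The image of `e` generates `A`, by induction on the degree. Here `inc` parametrizes the image
of `e`. -/
theorem lift_surjective (hrange : LinearMap.range inc = LinearMap.range A.primProj) :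
    Function.Surjective (TensorAlgebra.lift R inc) := by
  have he : ∀ x, A.primProj x ∈ (TensorAlgebra.lift R inc).range := by
    intro x
    have hx : A.primProj x ∈ LinearMap.range inc := by rw [hrange]; exact ⟨x, rfl⟩
    obtain ⟨v, hv⟩ := hx
    exact ⟨TensorAlgebra.ι R v, by rw [← hv]; exact TensorAlgebra.lift_ι_apply _ _⟩
  have key : ∀ n, ∀ x ∈ A.gr n, x ∈ (TensorAlgebra.lift R inc).range := by
    intro n
    induction n using Nat.strong_induction_on with
    | _ n ih =>
      intro x hx
      by_cases hn : n = 0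
      · subst hn
        rw [← A.algebraMap_augmentation_of_mem hx]
        exact Subalgebra.algebraMap_mem _ _
      rw [← A.barProj_of_mem hn hx, ← mul_splitMap, splitMap_eq, map_add]
      refine add_mem ?_ ?_
      · rw [LinearMap.mul'_apply, mul_one]
        exact he x
      · refine mem_of_mem_redTensor (f := LinearMap.mul' R A.carrier ∘ₗ
          TensorProduct.map A.primProj LinearMap.id)
          (p := Subalgebra.toSubmodule (TensorAlgebra.lift R inc).range) (A.redCoderiv_mem hx) ?_
        intro i j hi hj hij a ha b hb
        exact Subalgebra.mul_mem _ (he a) (ih j (by omega) b hb)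
  intro x
  change x ∈ (TensorAlgebra.lift R inc).range
  induction x using DirectSum.Decomposition.inductionOn A.gr with
  | zero => exact zero_mem _
  | @homogeneous n x => exact key n x x.2
  | add x y hx hy => exact add_mem hx hy

/-- Left cancellation of generators: `λ` peels off the first letter of a word, so a left inverse of
`T(V) → A` can be defined by recursion on the degree. -/
theorem lift_injective (hinj : Function.Injective inc)
    (hrange : LinearMap.range inc = LinearMap.range A.primProj) :
    Function.Injective (TensorAlgebra.lift R inc) := by
  let j : A.carrier →ₗ[R] TensorAlgebra R V := TensorAlgebra.ι R ∘ₗ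
    (LinearEquiv.ofInjective inc hinj).symm.toLinearMap ∘ₗ
    A.primProj.codRestrict (LinearMap.range inc) (fun x => by rw [hrange]; exact ⟨x, rfl⟩)
  have hj : ∀ x v, A.primProj x = inc v → j x = TensorAlgebra.ι R v := by
    intro x v h
    have h2 : A.primProj.codRestrict (LinearMap.range inc)
        (fun x => by rw [hrange]; exact ⟨x, rfl⟩) x = LinearEquiv.ofInjective inc hinj v :=
      Subtype.ext h
    simp only [j, LinearMap.comp_apply, LinearEquiv.coe_coe, h2, LinearEquiv.symm_apply_apply]
  have hje : j ∘ₗ A.primProj = j := by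
    refine LinearMap.ext fun x => ?_
    have hx : A.primProj x ∈ LinearMap.range inc := by rw [hrange]; exact ⟨x, rfl⟩
    obtain ⟨v, hv⟩ := hx
    rw [hj x v hv.symm]
    exact hj _ v (by rw [primProj_primProj, hv])
  -- The left inverse `σ` is determined by `σ(1) = 1` and `σ(p a) = p σ(a)` for generators `p`.
  obtain ⟨σ, hσ⟩ := A.exists_fixedPoint (M := TensorAlgebra R V)
    (fun s => Algebra.linearMap R (TensorAlgebra R V) ∘ₗ A.augmentation.toLinearMap +
      LinearMap.mul' R (TensorAlgebra R V) ∘ₗ TensorProduct.map j s ∘ₗ A.coderiv) (by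
    intro n f g h x hx
    refine congrArg (algebraMap R (TensorAlgebra R V) (A.augmentation x) + ·) ?_
    change LinearMap.mul' R (TensorAlgebra R V) (TensorProduct.map j f (A.coderiv x)) =
      LinearMap.mul' R (TensorAlgebra R V) (TensorProduct.map j g (A.coderiv x))
    rw [coderiv_eq, map_add, map_add, map_add, map_add]
    congr 1
    · by_cases hn : n = 0
      · subst hn
        rw [A.barProj_of_mem_zero hx]
        simp
      · simp [h 0 (by omega) 1 SetLike.GradedOne.one_mem]
    · refine eq_of_mem_redTensor (f := LinearMap.mul' R (TensorAlgebra R V) ∘ₗ TensorProduct.map j f)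
        (g := LinearMap.mul' R (TensorAlgebra R V) ∘ₗ TensorProduct.map j g) (A.redCoderiv_mem hx) ?_
      intro k l hk hl hkl a ha b hb
      simp [h l (by omega) b hb])
  have hσ' : ∀ x, σ x = algebraMap R _ (A.augmentation x) +
      LinearMap.mul' R _ (TensorProduct.map j σ (A.splitMap x)) := by
    intro x
    conv_lhs => rw [← hσ]
    change algebraMap R _ (A.augmentation x) +
      LinearMap.mul' R _ (TensorProduct.map j σ (A.coderiv x)) = _
    have h : TensorProduct.map j σ ∘ₗ TensorProduct.map A.primProj LinearMap.id =
        TensorProduct.map j σ := by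
      rw [← TensorProduct.map_comp, hje, LinearMap.comp_id]
    rw [splitMap_apply]
    exact congrArg (algebraMap R _ (A.augmentation x) + LinearMap.mul' R _ ·)
      (LinearMap.congr_fun h (A.coderiv x)).symm
  have hσ1 : σ 1 = 1 := by
    rw [hσ', splitMap_apply, coderiv_one]
    simp
  have hmul : ∀ t a, σ (TensorAlgebra.lift R inc t * a) = t * σ a := by
    intro t
    induction t using TensorAlgebra.induction with
    | algebraMap r => intro a; rw [AlgHom.commutes, ← Algebra.smul_def, map_smul, Algebra.smul_def]
    | ι v =>
      intro a
      have hv : inc v ∈ LinearMap.range A.primProj := by rw [← hrange]; exact ⟨v, rfl⟩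
      obtain ⟨x, hx⟩ := hv
      rw [TensorAlgebra.lift_ι_apply, ← hx, hσ', map_mul, augmentation_primProj, zero_mul,
        map_zero, zero_add, splitMap_primProj_mul, TensorProduct.map_tmul, LinearMap.mul'_apply,
        hj _ v (by rw [primProj_primProj, hx])]
    | mul s t hs ht =>
      intro a; rw [map_mul (TensorAlgebra.lift R inc), mul_assoc, hs, ht, mul_assoc]
    | add s t hs ht =>
      intro a; rw [map_add (TensorAlgebra.lift R inc), add_mul, map_add, hs, ht, add_mul]
  refine Function.LeftInverse.injective (g := σ) fun t => ?_
  have := hmul t 1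
  rwa [mul_one, hσ1, mul_one] at this

end Freeness

end ConnGrAlg

/-! ### Isomorphisms, primitive elements and torsion -/

namespace ConnGrAlg

variable {R : Type u} [CommRing R]

section Isomorphisms

theorem decompose_toAlgHom {X Y : ConnGrAlg R} (f : X ⟶ Y) (x : X.carrier) (n : ℕ) :
    (DirectSum.decompose Y.gr (toAlgHom f x) n : Y.carrier) =
      toAlgHom f (DirectSum.decompose X.gr x n) := by
  induction x using DirectSum.Decomposition.inductionOn X.gr with
  | zero => simp
  | @homogeneous i x =>
    rw [DirectSum.decompose_of_mem _ (toAlgHom_mem f x.2), DirectSum.decompose_coe]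
    by_cases h : i = n
    · subst h
      rw [DirectSum.of_eq_same, DirectSum.of_eq_same]
    · rw [DirectSum.of_eq_of_ne _ _ _ (Ne.symm h), DirectSum.of_eq_of_ne _ _ _ (Ne.symm h)]
      simp
  | add a b ha hb => simp only [map_add, DirectSum.decompose_add, DirectSum.add_apply,
      Submodule.coe_add, ha, hb]

theorem isIso_of_bijective {X Y : ConnGrAlg R} (f : X ⟶ Y)
    (hf : Function.Bijective (toAlgHom f)) : IsIso f := by
  let E : X.carrier ≃ₐ[R] Y.carrier := AlgEquiv.ofBijective (toAlgHom f) hf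
  have hE : ∀ n, ∀ y ∈ Y.gr n, E.symm y ∈ X.gr n := by
    intro n y hy
    have h1 : E.symm y = (DirectSum.decompose X.gr (E.symm y) n : X.carrier) := by
      apply hf.1
      have h2 : toAlgHom f (E.symm y) = y := E.apply_symm_apply y
      rw [← decompose_toAlgHom, h2, DirectSum.decompose_of_mem_same Y.gr hy]
    rw [h1]
    exact Subtype.property _
  refine ⟨ofAlgHom E.symm.toAlgHom hE, hom_ext (AlgHom.ext fun x => ?_),
    hom_ext (AlgHom.ext fun y => ?_)⟩
  · exact E.symm_apply_apply x
  · exact E.apply_symm_apply y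

theorem hom_initial_unique {X : ConnGrAlg R} (f g : X ⟶ ⊥_ (ConnGrAlg R)) : f = g := by
  refine hom_ext (AlgHom.ext fun x => ?_)
  rw [eq_algebraMap_of_initial (toAlgHom f x), eq_algebraMap_of_initial (toAlgHom g x),
    augmentation_toAlgHom, augmentation_toAlgHom]

end Isomorphisms

variable (A : ConnGrAlg R)

/-- If the scalar `s` kills `A` in the degrees strictly between `0` and `n`, then up to `s`-torsion
every element of degree `n` of `A ∗ A` is a sum of elements of the two factors, since longer words
have a letter of intermediate degree. -/
theorem smul_eq_of_mem_coprod {n : ℕ} {s : R}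
    (hs : ∀ i, i ≠ 0 → i < n → ∀ a ∈ A.gr i, s • a = 0) {k : ℕ} {w : (A ⨿ A).carrier}
    (hw : w ∈ (A ⨿ A).gr k) (hk : k ≤ n) :
    s • w = s • (toAlgHom coprod.inl (toAlgHom A.fstProj w) +
      toAlgHom coprod.inr (toAlgHom A.sndProj w) -
        algebraMap R _ ((A ⨿ A).augmentation w)) := by
  let Θ : (A ⨿ A).carrier →ₗ[R] (A ⨿ A).carrier :=
    (toAlgHom (coprod.inl : A ⟶ A ⨿ A)).toLinearMap ∘ₗ (toAlgHom A.fstProj).toLinearMap +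
    (toAlgHom (coprod.inr : A ⟶ A ⨿ A)).toLinearMap ∘ₗ (toAlgHom A.sndProj).toLinearMap -
    Algebra.linearMap R _ ∘ₗ (A ⨿ A).augmentation.toLinearMap
  have hΘ : ∀ w, Θ w = toAlgHom coprod.inl (toAlgHom A.fstProj w) +
      toAlgHom coprod.inr (toAlgHom A.sndProj w) -
        algebraMap R _ ((A ⨿ A).augmentation w) := fun w => rfl
  rw [← hΘ]
  have hinl : ∀ x, Θ (toAlgHom coprod.inl x) = toAlgHom coprod.inl x := by
    intro x
    rw [hΘ, fstProj_inl, sndProj_inl, augmentation_toAlgHom, AlgHom.commutes, add_sub_cancel_right]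
  have hinr : ∀ x, Θ (toAlgHom coprod.inr x) = toAlgHom coprod.inr x := by
    intro x
    rw [hΘ, fstProj_inr, sndProj_inr, augmentation_toAlgHom, AlgHom.commutes, add_sub_cancel_left]
  induction hw using coprod_induction with
  | zero k => rw [map_zero]
  | one => simpa using congrArg (s • ·) (hinl 1).symm
  | add k v w _ _ hv hw => rw [map_add, smul_add, smul_add, hv hk, hw hk]
  | smul k r w _ hw => rw [map_smul, smul_comm s r, smul_comm s r, hw hk]
  | inl_mul d k x hx w hw' hw =>
    by_cases hd : d = 0
    · subst hd
      rw [← A.algebraMap_augmentation_of_mem hx, AlgHom.commutes, ← Algebra.smul_def, map_smul,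
        smul_comm s, smul_comm s, hw (by omega)]
    by_cases hk0 : k = 0
    · subst hk0
      rw [← (A ⨿ A).algebraMap_augmentation_of_mem hw', ← Algebra.commutes, ← Algebra.smul_def,
        map_smul, hinl]
    · have h1 : s • x = 0 := hs d hd (by omega) x hx
      have h2 : A.augmentation x = 0 := A.augmentation_of_mem hd hx
      rw [hΘ, map_mul (toAlgHom A.fstProj), map_mul (toAlgHom A.sndProj),
        map_mul (A ⨿ A).augmentation, fstProj_inl, sndProj_inl, augmentation_toAlgHom, h2]
      simp only [map_zero, zero_mul, add_zero, sub_zero]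
      rw [map_mul, ← smul_mul_assoc, ← smul_mul_assoc, ← map_smul, h1, map_zero, zero_mul,
        zero_mul]
  | inr_mul d k x hx w hw' hw =>
    by_cases hd : d = 0
    · subst hd
      rw [← A.algebraMap_augmentation_of_mem hx, AlgHom.commutes, ← Algebra.smul_def, map_smul,
        smul_comm s, smul_comm s, hw (by omega)]
    by_cases hk0 : k = 0
    · subst hk0
      rw [← (A ⨿ A).algebraMap_augmentation_of_mem hw', ← Algebra.commutes, ← Algebra.smul_def,
        map_smul, hinr]
    · have h1 : s • x = 0 := hs d hd (by omega) x hx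
      have h2 : A.augmentation x = 0 := A.augmentation_of_mem hd hx
      rw [hΘ, map_mul (toAlgHom A.fstProj), map_mul (toAlgHom A.sndProj),
        map_mul (A ⨿ A).augmentation, fstProj_inr, sndProj_inr, augmentation_toAlgHom, h2]
      simp only [map_zero, zero_mul, zero_add, sub_zero]
      rw [map_mul, ← smul_mul_assoc, ← smul_mul_assoc, ← map_smul, h1, map_zero, zero_mul,
        zero_mul]

variable [ComonObj A]

/-- The element `x` is primitive: its comultiplication is `x' + x''`. -/
def IsPrimitive (x : A.carrier) : Prop :=
  toAlgHom A.comulHom x = toAlgHom coprod.inl x + toAlgHom coprod.inr x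

variable {A} in
/-- A homogeneous primitive element belongs to the image of `e`: its `δ` vanishes. -/
theorem IsPrimitive.primProj_eq {x : A.carrier} (h : A.IsPrimitive x) {n : ℕ} (hn : n ≠ 0)
    (hx : x ∈ A.gr n) : A.primProj x = x := by
  have h1 : A.coderiv x = x ⊗ₜ 1 := by
    rw [coderiv_apply, h, map_add, Matrix.add_apply, matHom_inl, matHom_inr,
      A.augmentation_of_mem hn hx]
    simp
  have h2 := A.mul_splitMap x
  rwa [splitMap_apply, h1, TensorProduct.map_tmul, LinearMap.mul'_apply, LinearMap.id_apply,
    mul_one, A.barProj_of_mem hn hx] at h2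

/-- If the scalar `s` kills the generators of `A` in the degrees strictly between `0` and `n`, then
the elements of degree `n` are primitive up to `s`-torsion. -/
theorem smul_comul_eq {n : ℕ} (hn : n ≠ 0) {s : R}
    (hs : ∀ i, i ≠ 0 → i < n → ∀ a ∈ A.gr i, s • A.primProj a = 0) {x : A.carrier}
    (hx : x ∈ A.gr n) :
    s • toAlgHom A.comulHom x = s • (toAlgHom coprod.inl x + toAlgHom coprod.inr x) := by
  have hs' : ∀ i, i ≠ 0 → i < n → ∀ a ∈ A.gr i, s • a = 0 := by
    intro i hi hin a ha
    rw [← A.barProj_of_mem hi ha, ← mul_splitMap, splitMap_eq, map_add, smul_add,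
      LinearMap.mul'_apply, mul_one, hs i hi hin a ha, zero_add]
    refine eq_of_mem_redTensor (f := s • LinearMap.mul' R A.carrier ∘ₗ
      TensorProduct.map A.primProj LinearMap.id) (g := 0) (A.redCoderiv_mem ha) ?_
    intro k l hk hl hkl b hb c hc
    change s • (A.primProj b * c) = 0
    rw [← smul_mul_assoc, hs k hk (by omega) b hb, zero_mul]
  have h := A.smul_eq_of_mem_coprod hs' (toAlgHom_mem A.comulHom hx) le_rfl
  rwa [fstProj_comul, sndProj_comul, augmentation_toAlgHom, A.augmentation_of_mem hn hx, map_zero,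
    sub_zero] at h

end ConnGrAlg

/-- An element killed by a scalar outside each maximal ideal is zero. -/
theorem eq_zero_of_forall_isMaximal {R M : Type*} [CommRing R] [AddCommGroup M] [Module R M]
    {x : M} (h : ∀ (𝔪 : Ideal R) [𝔪.IsMaximal], ∃ s ∉ 𝔪, s • x = 0) : x = 0 := by
  have htop : Ideal.span {r : R | r • x = 0} = ⊤ := by
    by_contra hne
    obtain ⟨𝔪, hm, hle⟩ := Ideal.exists_le_maximal _ hne
    obtain ⟨s, hs, hsx⟩ := h 𝔪
    exact hs (hle (Ideal.subset_span hsx))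
  have h1 : Ideal.span {r : R | r • x = 0} ≤ LinearMap.ker (LinearMap.toSpanSingleton R M x) :=
    Ideal.span_le.2 fun r hr => hr
  have h2 : (1 : R) ∈ LinearMap.ker (LinearMap.toSpanSingleton R M x) := h1 (htop ▸ trivial)
  simpa using h2

/-! ### The comonoids `T_CM(C(N))` -/

namespace PosGrMod

open ConnGrAlg ConnGrCoalg

variable {R : Type u} [CommRing R]

section TrivialCoalgebra

variable (N : PosGrMod R)

/-- The unit element of the coalgebra `C(N)`. -/
def trivOne : (trivObj N).carrier := TrivCarrier.one N

/-- The inclusion of `N` into the coalgebra `C(N)`. -/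
def trivInr : (⨁ i : ℕ+, N i) →ₗ[R] (trivObj N).carrier := TrivCarrier.inr N

/-- The linear map on `C(N)` with given value at `1` and given restriction to `N`. -/
def trivLift {M : Type*} [AddCommGroup M] [Module R M] (m : M) (g : (⨁ i : ℕ+, N i) →ₗ[R] M) :
    (trivObj N).carrier →ₗ[R] M := TrivCarrier.lift N m g

theorem trivLift_one {M : Type*} [AddCommGroup M] [Module R M] (m : M)
    (g : (⨁ i : ℕ+, N i) →ₗ[R] M) : trivLift N m g (trivOne N) = m :=
  TrivCarrier.lift_one N m g

theorem trivLift_inr {M : Type*} [AddCommGroup M] [Module R M] (m : M)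
    (g : (⨁ i : ℕ+, N i) →ₗ[R] M) (z) : trivLift N m g (trivInr N z) = g z :=
  TrivCarrier.lift_inr N m g z

variable {N} in
theorem triv_linearMap_ext {M : Type*} [AddCommMonoid M] [Module R M]
    {f g : (trivObj N).carrier →ₗ[R] M} (h₁ : f (trivOne N) = g (trivOne N))
    (h₂ : ∀ z, f (trivInr N z) = g (trivInr N z)) : f = g :=
  TrivCarrier.hom_ext h₁ h₂

theorem trivOne_mem : trivOne N ∈ (trivObj N).gr 0 := TrivCarrier.one_mem N

theorem counit_trivOne : Coalgebra.counit (R := R) (trivOne N) = 1 := rfl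

theorem eq_smul_trivOne {x : (trivObj N).carrier} (hx : x ∈ (trivObj N).gr 0) :
    x = (Coalgebra.counit x : R) • trivOne N :=
  TrivCarrier.eq_of_mem_zero N hx

theorem exists_trivInr {i : ℕ+} {x : (trivObj N).carrier} (hx : x ∈ (trivObj N).gr i) :
    ∃ y : N i, x = trivInr N (DirectSum.lof R ℕ+ (fun i => N i) i y) :=
  ⟨_, TrivCarrier.eq_of_mem_pos N hx⟩

theorem comul_trivOne : Coalgebra.comul (R := R) (trivOne N) = trivOne N ⊗ₜ trivOne N :=
  TrivCarrier.comul_one N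

theorem comul_trivInr (z) : Coalgebra.comul (R := R) (trivInr N z) =
    trivInr N z ⊗ₜ trivOne N + trivOne N ⊗ₜ trivInr N z :=
  TrivCarrier.comul_inr N z

theorem conv_trivOne {B : ConnGrAlg R} (f g : (trivObj N).carrier →ₗ[R] B.carrier) :
    conv f g (trivOne N) = f (trivOne N) * g (trivOne N) := by
  rw [conv, LinearMap.comp_apply, LinearMap.comp_apply, comul_trivOne, TensorProduct.map_tmul,
    LinearMap.mul'_apply]

theorem conv_trivInr {B : ConnGrAlg R} (f g : (trivObj N).carrier →ₗ[R] B.carrier)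
    (z : ⨁ i : ℕ+, N i) :
    conv f g (trivInr N z) = f (trivInr N z) * g (trivOne N) + f (trivOne N) * g (trivInr N z) := by
  rw [conv, LinearMap.comp_apply, LinearMap.comp_apply, comul_trivInr, map_add, map_add,
    TensorProduct.map_tmul, TensorProduct.map_tmul, LinearMap.mul'_apply, LinearMap.mul'_apply]

/-- A linear map on `C(N)` which sends `1` to `1` and `Nᵢ` to elements of degree `i` belongs to
`G(C(N), B)`. -/
theorem isG_of_trivOne {B : ConnGrAlg R} {f : (trivObj N).carrier →ₗ[R] B.carrier}
    (h1 : f (trivOne N) = 1)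
    (h2 : ∀ (i : ℕ+) (y : N i), f (trivInr N (DirectSum.lof R ℕ+ (fun i => N i) i y)) ∈ B.gr i) :
    IsG f := by
  constructor
  · intro n x hx
    rcases Nat.eq_zero_or_pos n with rfl | hn
    · rw [eq_smul_trivOne N hx, map_smul, h1]
      exact Submodule.smul_mem _ _ SetLike.GradedOne.one_mem
    · obtain ⟨y, rfl⟩ := exists_trivInr N (i := ⟨n, hn⟩) hx
      exact h2 ⟨n, hn⟩ y
  · intro x hx
    conv_lhs => rw [eq_smul_trivOne N hx, map_smul, h1]
    exact (Algebra.algebraMap_eq_smul_one _).symm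

end TrivialCoalgebra

variable (N : PosGrMod R)

/-- The connected graded algebra underlying `T_CM(C(N))`, i.e. the tensor algebra on `N`. -/
abbrev tensorTriv : ConnGrAlg R := (trivObj N).tensor

theorem toTensor_one : (trivObj N).toTensor (trivOne N) = 1 := by
  rw [(trivObj N).toTensor_zero _ (trivOne_mem N), counit_trivOne, map_one]

/-- The inclusion of the generators of degree `i`. -/
def tgen (i : ℕ+) : N i →ₗ[R] (tensorTriv N).carrier :=
  (trivObj N).toTensor ∘ₗ trivInr N ∘ₗ DirectSum.lof R ℕ+ (fun i => N i) i

theorem tgen_eq_gen (i : ℕ+) (y : N i) : tgen N i y =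
    gen (bar.obj (trivObj N)) i ⟨_, TrivCarrier.inr_mem N i y⟩ :=
  (trivObj N).toTensor_pos i ⟨_, TrivCarrier.inr_mem N i y⟩

theorem gen_eq_tgen (i : ℕ+) (x : TrivCarrier.gr N i) :
    gen (bar.obj (trivObj N)) i x = tgen N i (TrivCarrier.snd N x i) := by
  rw [tgen_eq_gen]
  exact congrArg (gen (bar.obj (trivObj N)) i) (Subtype.ext (TrivCarrier.eq_of_mem_pos N x.2))

theorem tgen_mem (i : ℕ+) (y : N i) : tgen N i y ∈ (tensorTriv N).gr i := by
  rw [tgen_eq_gen]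
  exact gen_mem _ i _

theorem tgen_injective (i : ℕ+) : Function.Injective (tgen N i) := by
  intro y z h
  rw [tgen_eq_gen, tgen_eq_gen] at h
  have h2 := DirectSum.of_injective (β := fun i => (bar.obj (trivObj N)) i) i
    ((TensorAlgebra.ι_inj R _ _).1 h)
  have h3 := congrArg (TrivCarrier.snd N) (congrArg Subtype.val h2)
  exact DirectSum.of_injective (β := fun i => N i) i h3

variable {N} in
theorem tgen_algHom_ext {B : Type*} [Semiring B] [Algebra R B]
    {f g : (tensorTriv N).carrier →ₐ[R] B} (h : ∀ i y, f (tgen N i y) = g (tgen N i y)) :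
    f = g := by
  refine tensorAlg_ext (N := bar.obj (trivObj N)) fun i x => ?_
  exact (congrArg f (gen_eq_tgen N i x)).trans ((h i _).trans (congrArg g (gen_eq_tgen N i x)).symm)

/-- The algebra homomorphism given by linear maps on the generators. -/
def tlift {B : Type*} [Semiring B] [Algebra R B] (g : ∀ i : ℕ+, N i →ₗ[R] B) :
    (tensorTriv N).carrier →ₐ[R] B :=
  liftAlg (bar.obj (trivObj N)) (fun i => g i ∘ₗ DirectSum.component R ℕ+ (fun i => N i) i ∘ₗ
    TrivCarrier.snd N ∘ₗ (TrivCarrier.gr N i).subtype)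

theorem tlift_tgen {B : Type*} [Semiring B] [Algebra R B] (g : ∀ i : ℕ+, N i →ₗ[R] B) (i : ℕ+)
    (y : N i) : tlift N g (tgen N i y) = g i y := by
  rw [tgen_eq_gen]
  refine (liftAlg_gen _ _ _ _).trans ?_
  exact congrArg (g i) (DirectSum.of_eq_same (β := fun i => N i) _ _)

variable {N} in
/-- Induction over the words in the generators. -/
@[elab_as_elim]
theorem tensorTriv_induction
    {p : ∀ (n : ℕ) (x : (tensorTriv N).carrier), x ∈ (tensorTriv N).gr n → Prop}
    (zero : ∀ n, p n 0 (zero_mem _)) (one : p 0 1 SetLike.GradedOne.one_mem)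
    (add : ∀ n v w hv hw, p n v hv → p n w hw → p n (v + w) (add_mem hv hw))
    (smul : ∀ n (r : R) w hw, p n w hw → p n (r • w) (Submodule.smul_mem _ r hw))
    (gen_mul : ∀ (i : ℕ+) n (y : N i) w hw, p n w hw →
      p (i + n) (tgen N i y * w) (SetLike.GradedMul.mul_mem (tgen_mem N i y) hw))
    {n : ℕ} {x : (tensorTriv N).carrier} (hx : x ∈ (tensorTriv N).gr n) : p n x hx := by
  have step : ∀ (i : ℕ+) (n : ℕ) (y : N i) (w : (tensorTriv N).carrier)
      (hw : w ∈ (tensorTriv N).gr n), p n w hw → ∀ s : (tensorTriv N).carrier, s = tgen N i y →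
        ∃ h, p (i + n) (s * w) h := by
    rintro i n y w hw ih _ rfl
    exact ⟨_, gen_mul i n y w hw ih⟩
  have key : ∀ n x, ConnGr.IsWord (gens (bar.obj (trivObj N))) n x →
      ∃ hx : x ∈ (tensorTriv N).gr n, p n x hx := by
    intro n x hx
    induction hx with
    | one => exact ⟨_, one⟩
    | @cons d n s x hs _ ih =>
      obtain ⟨hx, ih⟩ := ih
      obtain ⟨i, rfl, (y : TrivCarrier.gr N i), rfl⟩ := hs
      exact step i n _ x hx ih _ (gen_eq_tgen N i y)
  suffices h : ∃ hx : x ∈ (tensorTriv N).gr n, p n x hx from h.2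
  change x ∈ ConnGr.wordGrading R (gens (bar.obj (trivObj N))) n at hx
  rw [ConnGr.wordGrading] at hx
  induction hx using Submodule.span_induction with
  | mem x hx => exact key n x hx
  | zero => exact ⟨_, zero n⟩
  | add a b _ _ ha hb => exact ⟨_, add n a b _ _ ha.2 hb.2⟩
  | smul r a _ ha => exact ⟨_, smul n r a _ ha.2⟩

theorem isPrimitive_tgen (i : ℕ+) (y : N i) : (tensorTriv N).IsPrimitive (tgen N i y) := by
  have h := LinearMap.congr_fun (extend_comp (conv (res (C := trivObj N) coprod.inl)
    (res coprod.inr)) ((isG_res _).conv (isG_res _)))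
    (trivInr N (DirectSum.lof R ℕ+ (fun i => N i) i y))
  refine h.trans ?_
  rw [conv_trivInr]
  have h1 : ∀ f : tensorTriv N ⟶ tensorTriv N ⨿ tensorTriv N,
      res (C := trivObj N) f (trivOne N) = 1 := by
    intro f
    change toAlgHom f ((trivObj N).toTensor (trivOne N)) = 1
    rw [toTensor_one, map_one]
  rw [h1, h1, one_mul, mul_one]
  rfl

variable {N} in
theorem tcmC_map_tgen {N' : PosGrMod R} (f : N ⟶ N') (i : ℕ+) (y : N i) :
    toAlgHom ((tcmC R).map f).hom (tgen N i y) = tgen N' i (f i y) := by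
  have h := LinearMap.congr_fun (res_tensorMap_comp (trivCoalg.map f) (𝟙 _))
    (trivInr N (DirectSum.lof R ℕ+ (fun i => N i) i y))
  rw [Category.comp_id] at h
  have h2 : TrivCarrier.map f (TrivCarrier.inr N (DirectSum.lof R ℕ+ (fun i => N i) i y)) =
      TrivCarrier.inr N' (DirectSum.lof R ℕ+ (fun i => N' i) i (f i y)) := by
    rw [TrivCarrier.map_inr, DirectSum.lmap_lof]
  exact h.trans (congrArg (trivObj N').toTensor h2)

theorem primProj_tgen (i : ℕ+) (y : N i) : (tensorTriv N).primProj (tgen N i y) = tgen N i y :=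
  (isPrimitive_tgen N i y).primProj_eq i.pos.ne' (tgen_mem N i y)

/-- On a tensor algebra `e` is the projection to the words of length one: it fixes the generators,
which are primitive, and kills the decomposable elements. -/
theorem primProj_mem_range_tgen (i : ℕ+) {x : (tensorTriv N).carrier}
    (hx : x ∈ (tensorTriv N).gr i) : (tensorTriv N).primProj x ∈ LinearMap.range (tgen N i) := by
  suffices h : ∀ n, ∀ x ∈ (tensorTriv N).gr n, ∀ i : ℕ+, (i : ℕ) = n →
      (tensorTriv N).primProj x ∈ LinearMap.range (tgen N i) from h i x hx i rfl
  clear hx x i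
  intro n x hx
  induction hx using tensorTriv_induction with
  | zero n => intro i _; rw [map_zero]; exact zero_mem _
  | one => intro i hi; exact absurd hi i.pos.ne'
  | add n v w _ _ hv hw => intro i hi; rw [map_add]; exact add_mem (hv i hi) (hw i hi)
  | smul n r w _ hw => intro i hi; rw [map_smul]; exact Submodule.smul_mem _ r (hw i hi)
  | gen_mul j n y w hw _ =>
    intro i hi
    by_cases hn : n = 0
    · subst hn
      obtain rfl : i = j := PNat.coe_injective hi
      rw [← (tensorTriv N).algebraMap_augmentation_of_mem hw, ← Algebra.commutes,
        ← Algebra.smul_def, map_smul, primProj_tgen]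
      exact Submodule.smul_mem _ _ ⟨y, rfl⟩
    · rw [(tensorTriv N).primProj_mul j.pos.ne' hn (tgen_mem N j y) hw]
      exact zero_mem _

end PosGrMod

namespace ConnGrAlg

variable {R : Type u} [CommRing R]

theorem IsPrimitive.map {A B : Comon (ConnGrAlg R)} (f : A ⟶ B) {x : A.X.carrier}
    (hx : A.X.IsPrimitive x) : B.X.IsPrimitive (toAlgHom f.hom x) := by
  have h : f.hom ≫ B.X.comulHom = A.X.comulHom ≫ coprod.map f.hom f.hom :=
    IsComonHom.hom_comul f.hom
  have h1 : toAlgHom B.X.comulHom (toAlgHom f.hom x) =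
      toAlgHom (coprod.map f.hom f.hom) (toAlgHom A.X.comulHom x) :=
    AlgHom.congr_fun (congrArg toAlgHom h) x
  have hl : toAlgHom (coprod.map f.hom f.hom) (toAlgHom coprod.inl x) =
      toAlgHom coprod.inl (toAlgHom f.hom x) :=
    AlgHom.congr_fun (congrArg toAlgHom (coprod.inl_map f.hom f.hom)) x
  have hr : toAlgHom (coprod.map f.hom f.hom) (toAlgHom coprod.inr x) =
      toAlgHom coprod.inr (toAlgHom f.hom x) :=
    AlgHom.congr_fun (congrArg toAlgHom (coprod.inr_map f.hom f.hom)) x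
  rw [IsPrimitive, h1, hx, map_add, hl, hr]

end ConnGrAlg

open ConnGrAlg PosGrMod

instance tcmC_faithful (R : Type u) [CommRing R] : (tcmC R).Faithful where
  map_injective {N N'} f g h := by
    funext i
    refine ModuleCat.hom_ext (LinearMap.ext fun y => tgen_injective N' i ?_)
    change tgen N' i (f i y) = tgen N' i (g i y)
    rw [← tcmC_map_tgen, ← tcmC_map_tgen, h]

/-- A morphism of comonoids maps the generators to primitive elements, and the only homogeneous
primitive elements of a tensor algebra are the generators. -/
instance tcmC_full (R : Type u) [CommRing R] : (tcmC R).Full where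
  map_surjective {N N'} ψ := by
    have hmem : ∀ (i : ℕ+) (y : N i),
        toAlgHom ψ.hom (tgen N i y) ∈ LinearMap.range (tgen N' i) := by
      intro i y
      have h1 : toAlgHom ψ.hom (tgen N i y) ∈ (tensorTriv N').gr i :=
        toAlgHom_mem ψ.hom (tgen_mem N i y)
      have h2 : (tensorTriv N').IsPrimitive (toAlgHom ψ.hom (tgen N i y)) :=
        IsPrimitive.map ψ (isPrimitive_tgen N i y)
      have h3 := primProj_mem_range_tgen N' i h1
      rwa [h2.primProj_eq i.pos.ne' h1] at h3
    let f : N ⟶ N' := fun i => ModuleCat.ofHom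
      ((LinearEquiv.ofInjective (tgen N' i) (tgen_injective N' i)).symm.toLinearMap ∘ₗ
        ((toAlgHom ψ.hom).toLinearMap ∘ₗ tgen N i).codRestrict _ (hmem i))
    have hf : ∀ (i : ℕ+) (y : N i), tgen N' i (f i y) = toAlgHom ψ.hom (tgen N i y) := by
      intro i y
      exact congrArg Subtype.val ((LinearEquiv.ofInjective (tgen N' i)
        (tgen_injective N' i)).apply_symm_apply ⟨_, hmem i y⟩)
    refine ⟨f, Comon.ext (ConnGrAlg.hom_ext (tgen_algHom_ext fun i y => ?_))⟩
    exact (tcmC_map_tgen f i y).trans (hf i y)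

namespace PosGrMod

open ConnGrCoalg

variable {R : Type u} [CommRing R] (N : PosGrMod R)

/-- The inverse of the cogroup `T_CM(C(N))` is `x ↦ -x` on generators. -/
theorem isCogroup_tcmC : IsCogroup ((tcmC R).obj N) := by
  let g : (trivObj N).carrier →ₗ[R] (tensorTriv N).carrier :=
    trivLift N 1 (-((trivObj N).toTensor ∘ₗ trivInr N))
  have hg1 : g (trivOne N) = 1 := trivLift_one N _ _
  have hgr : ∀ z, g (trivInr N z) = -(trivObj N).toTensor (trivInr N z) :=
    fun z => trivLift_inr N _ _ z
  have hg : IsG g := isG_of_trivOne N hg1 fun i y => by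
    rw [hgr]
    exact neg_mem (tgen_mem N i y)
  let ν : tensorTriv N ⟶ tensorTriv N := extend g hg
  have hν : res ν = g := extend_comp g hg
  have hid : res (𝟙 (tensorTriv N)) = (trivObj N).toTensor := rfl
  have htriv : res ((trivObj N).tensorCounit ≫ initial.to (tensorTriv N)) =
      Algebra.linearMap R _ ∘ₗ Coalgebra.counit := res_tensorCounit_comp _ _
  refine ⟨ν, ?_, ?_⟩
  · apply tensor_hom_ext
    change res ((trivObj N).tensorComul ≫ coprod.desc ν (𝟙 (tensorTriv N))) =
      res ((trivObj N).tensorCounit ≫ initial.to (tensorTriv N))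
    rw [htriv, res_tensorComul_comp, coprod.inl_desc, coprod.inr_desc, hν, hid]
    refine triv_linearMap_ext ?_ fun z => ?_
    · rw [conv_trivOne, hg1, toTensor_one, one_mul]
      exact (map_one (algebraMap R (tensorTriv N).carrier)).symm
    · rw [conv_trivInr, hg1, toTensor_one, one_mul, mul_one, hgr, neg_add_cancel]
      exact (map_zero (algebraMap R (tensorTriv N).carrier)).symm
  · apply tensor_hom_ext
    change res ((trivObj N).tensorComul ≫ coprod.desc (𝟙 (tensorTriv N)) ν) =
      res ((trivObj N).tensorCounit ≫ initial.to (tensorTriv N))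
    rw [htriv, res_tensorComul_comp, coprod.inl_desc, coprod.inr_desc, hν, hid]
    refine triv_linearMap_ext ?_ fun z => ?_
    · rw [conv_trivOne, hg1, toTensor_one, one_mul]
      exact (map_one (algebraMap R (tensorTriv N).carrier)).symm
    · rw [conv_trivInr, hg1, toTensor_one, one_mul, mul_one, hgr, add_neg_cancel]
      exact (map_zero (algebraMap R (tensorTriv N).carrier)).symm

/-- Graded commutativity of the tensor algebra, on generators. -/
def GensCommute : Prop := ∀ (i j : ℕ+) (p : N i) (q : N j),
  tgen N i p * tgen N j q = (-1) ^ ((i : ℕ) * j) * (tgen N j q * tgen N i p)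

variable {N}

theorem neg_one_pow_mul_comm {B : Type*} [Ring B] (k : ℕ) (x : B) :
    (-1) ^ k * x = x * (-1) ^ k := (Commute.neg_one_left x).pow_left k

theorem GensCommute.isGradedCommutative (h : GensCommute N) :
    (tensorTriv N).IsGradedCommutative := by
  have h1 : ∀ (j : ℕ+) (q : N j) (m : ℕ), ∀ x ∈ (tensorTriv N).gr m,
      x * tgen N j q = (-1) ^ (m * j) * (tgen N j q * x) := by
    intro j q m x hx
    induction hx using tensorTriv_induction with
    | zero n => simp
    | one => simp
    | add n v w _ _ hv hw => rw [add_mul, hv, hw, mul_add, mul_add]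
    | smul n r w _ hw => rw [smul_mul_assoc, hw, mul_smul_comm, mul_smul_comm]
    | gen_mul i n y w _ hw =>
      rw [mul_assoc, hw, ← mul_assoc, ← neg_one_pow_mul_comm, mul_assoc, ← mul_assoc (tgen N i y),
        h i j y q, add_mul, pow_add, mul_assoc, mul_assoc, ← mul_assoc ((-1) ^ (n * (j : ℕ))),
        neg_one_pow_mul_comm, mul_assoc]
  intro p q a ha b hb
  induction hb using tensorTriv_induction with
  | zero n => simp
  | one => simp
  | add n v w _ _ hv hw => rw [mul_add, hv, hw, add_mul, mul_add]
  | smul n r w _ hw => rw [mul_smul_comm, hw, smul_mul_assoc, mul_smul_comm]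
  | gen_mul j n y w _ hw =>
    rw [← mul_assoc, h1 j y p a ha, mul_assoc, mul_assoc, hw, mul_add, pow_add, mul_assoc,
      ← mul_assoc (tgen N j y), ← neg_one_pow_mul_comm]
    simp only [mul_assoc]

end PosGrMod

/-! ### Comonoids generated by primitive elements -/

namespace ConnGrAlg

open PosGrMod ConnGrCoalg

variable {R : Type u} [CommRing R]

section DegreewiseInclusions

variable (A : ConnGrAlg R) {M : ℕ+ → Type*} [∀ i, AddCommGroup (M i)] [∀ i, Module R (M i)]
  {f : ∀ i : ℕ+, M i →ₗ[R] A.carrier}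

theorem decompose_toModule (hf : ∀ (i : ℕ+) m, f i m ∈ A.gr i) (v : ⨁ i, M i) (i : ℕ+) :
    (DirectSum.decompose A.gr (DirectSum.toModule R ℕ+ A.carrier f v) i : A.carrier) =
      f i (v i) := by
  induction v using DirectSum.induction_on with
  | zero => simp
  | of j m =>
    rw [← DirectSum.lof_eq_of R, DirectSum.toModule_lof, DirectSum.decompose_of_mem _ (hf j m)]
    by_cases h : j = i
    · subst h
      rw [DirectSum.of_eq_same, DirectSum.lof_eq_of, DirectSum.of_eq_same]
    · rw [DirectSum.of_eq_of_ne _ _ _ (fun h' => h (PNat.coe_injective h'.symm)),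
        DirectSum.lof_eq_of, DirectSum.of_eq_of_ne _ _ _ (Ne.symm h), map_zero]
      rfl
  | add v w hv hw => rw [map_add, DirectSum.decompose_add, DirectSum.add_apply, Submodule.coe_add,
      hv, hw, DirectSum.add_apply, map_add]

theorem toModule_injective (hf : ∀ (i : ℕ+) m, f i m ∈ A.gr i) (hinj : ∀ i, Function.Injective (f i)) :
    Function.Injective (DirectSum.toModule R ℕ+ A.carrier f) := by
  intro v w h
  refine DFinsupp.ext fun i => hinj i ?_
  have h1 := A.decompose_toModule hf v i
  rw [h, A.decompose_toModule hf w i] at h1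
  exact h1.symm

theorem range_toModule_eq [ComonObj A]
    (hf : ∀ i : ℕ+, LinearMap.range (f i) = (A.gr i).map A.primProj) :
    LinearMap.range (DirectSum.toModule R ℕ+ A.carrier f) = LinearMap.range A.primProj := by
  apply le_antisymm
  · rintro _ ⟨v, rfl⟩
    induction v using DirectSum.induction_on with
    | zero => rw [map_zero]; exact zero_mem _
    | of i m =>
      rw [← DirectSum.lof_eq_of R, DirectSum.toModule_lof]
      have h : f i m ∈ LinearMap.range (f i) := ⟨m, rfl⟩
      rw [hf i] at h
      obtain ⟨a, -, ha⟩ := h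
      exact ⟨a, ha⟩
    | add v w hv hw => rw [map_add]; exact add_mem hv hw
  · rintro _ ⟨x, rfl⟩
    induction x using A.homogeneous_induction with
    | zero r => rw [primProj_algebraMap]; exact zero_mem _
    | pos n hn x hx =>
      have h : A.primProj x ∈ (A.gr n).map A.primProj := ⟨x, hx, rfl⟩
      obtain ⟨i, rfl⟩ : ∃ i : ℕ+, (i : ℕ) = n := ⟨⟨n, Nat.pos_of_ne_zero hn⟩, rfl⟩
      rw [← hf i] at h
      obtain ⟨m, hm⟩ := h
      exact ⟨DirectSum.lof R ℕ+ M i m, by rw [DirectSum.toModule_lof, hm]⟩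
    | add a b ha hb => rw [map_add]; exact add_mem ha hb

end DegreewiseInclusions

/-- The graded module of generators of a comonoid `A`: the image of the projection `e`. -/
def primMod (A : ConnGrAlg R) [ComonObj A] : PosGrMod R :=
  fun i => ModuleCat.of R ((A.gr i).map A.primProj)

section

variable (A : ConnGrAlg R) [ComonObj A]

/-- The inclusion `Pᵢ → A` of the generators of degree `i`. -/
def primIncl (i : ℕ+) : A.primMod i →ₗ[R] A.carrier := ((A.gr i).map A.primProj).subtype

theorem primIncl_injective (i : ℕ+) : Function.Injective (A.primIncl i) :=
  Subtype.val_injective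

theorem exists_primIncl {i : ℕ+} {x : A.carrier} (hx : x ∈ A.gr i) :
    ∃ p, A.primIncl i p = A.primProj x := ⟨⟨_, x, hx, rfl⟩, rfl⟩

theorem primIncl_eq (i : ℕ+) (p : A.primMod i) : ∃ x ∈ A.gr i, A.primIncl i p = A.primProj x := by
  obtain ⟨_, x, hx, rfl⟩ := p
  exact ⟨x, hx, rfl⟩

theorem primIncl_mem (i : ℕ+) (p : A.primMod i) : A.primIncl i p ∈ A.gr i := by
  obtain ⟨x, hx, h⟩ := A.primIncl_eq i p
  rw [h]
  exact A.primProj_mem hx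

/-- The map `C(P) → A` which extends the inclusion of the generators. -/
def primG : (trivObj A.primMod).carrier →ₗ[R] A.carrier :=
  trivLift A.primMod 1 (DirectSum.toModule R ℕ+ A.carrier A.primIncl)

theorem primG_one : A.primG (trivOne _) = 1 := trivLift_one _ _ _

theorem primG_inr (i : ℕ+) (p : A.primMod i) :
    A.primG (trivInr _ (DirectSum.lof R ℕ+ (fun i => A.primMod i) i p)) = A.primIncl i p := by
  rw [primG, trivLift_inr, DirectSum.toModule_lof]

theorem isG_primG : IsG A.primG := isG_of_trivOne _ A.primG_one fun i y => by
  rw [primG_inr]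
  exact A.primIncl_mem i y

/-- The morphism `T(P) → A` which extends the inclusion of the generators. -/
def primHom : tensorTriv A.primMod ⟶ A := extend A.primG A.isG_primG

theorem res_primHom : res A.primHom = A.primG := extend_comp _ _

theorem primHom_tgen (i : ℕ+) (p : A.primMod i) :
    toAlgHom A.primHom (tgen _ i p) = A.primIncl i p :=
  (LinearMap.congr_fun A.res_primHom _).trans (A.primG_inr i p)

theorem primHom_bijective : Function.Bijective (toAlgHom A.primHom) := by
  let f : ∀ i : ℕ+, (trivObj A.primMod).gr i →ₗ[R] A.carrier :=
    fun i => A.primG ∘ₗ ((trivObj A.primMod).gr i).subtype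
  have hf : ∀ (i : ℕ+) m, f i m ∈ A.gr i := fun i m => A.isG_primG.mem i m m.2
  have hinj : ∀ i, Function.Injective (f i) := by
    intro i
    refine (injective_iff_map_eq_zero (f i)).2 ?_
    rintro ⟨x, hx⟩ h
    obtain ⟨y, rfl⟩ := exists_trivInr _ hx
    have hy : A.primIncl i y = 0 := (A.primG_inr i y).symm.trans h
    have hy0 : y = 0 := A.primIncl_injective i (hy.trans (map_zero _).symm)
    apply Subtype.ext
    change trivInr _ (DirectSum.lof R ℕ+ (fun i => A.primMod i) i y) = 0
    rw [hy0, map_zero, map_zero]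
  have hrange : ∀ i : ℕ+, LinearMap.range (f i) = (A.gr i).map A.primProj := by
    intro i
    apply le_antisymm
    · rintro _ ⟨⟨x, hx⟩, rfl⟩
      obtain ⟨y, rfl⟩ := exists_trivInr _ hx
      obtain ⟨a, ha, h⟩ := A.primIncl_eq i y
      exact ⟨a, ha, h.symm.trans (A.primG_inr i y).symm⟩
    · rintro _ ⟨a, ha, rfl⟩
      obtain ⟨p, hp⟩ := A.exists_primIncl ha
      exact ⟨⟨_, TrivCarrier.inr_mem _ i p⟩, (A.primG_inr i p).trans hp⟩
  exact ⟨A.lift_injective _ (A.toModule_injective hf hinj) (A.range_toModule_eq hrange),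
    A.lift_surjective _ (A.range_toModule_eq hrange)⟩

end

/-- If all generators are primitive, the comonoid `A` is isomorphic to `T_CM(C(P))`. -/
theorem nonempty_iso_of_isPrimitive (A : Comon (ConnGrAlg R))
    (h : ∀ i p, A.X.IsPrimitive (A.X.primIncl i p)) :
    Nonempty ((tcmC R).obj A.X.primMod ≅ A) := by
  have hcomul : A.X.primHom ≫ A.X.comulHom =
      (trivObj A.X.primMod).tensorComul ≫ coprod.map A.X.primHom A.X.primHom := by
    apply tensor_hom_ext
    change res _ = res _
    rw [res_tensorComul_comp, coprod.inl_map, coprod.inr_map, res_comp, res_comp, res_comp,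
      res_primHom]
    have h1 : ∀ g : A.X ⟶ A.X ⨿ A.X, toAlgHom g (A.X.primG (trivOne _)) = 1 := by
      intro g
      rw [primG_one, map_one]
    refine triv_linearMap_ext ?_ fun z => ?_
    · rw [conv_trivOne]
      simp only [LinearMap.comp_apply, AlgHom.toLinearMap_apply, h1, mul_one]
    · rw [conv_trivInr]
      simp only [LinearMap.comp_apply, AlgHom.toLinearMap_apply, h1, mul_one, one_mul]
      induction z using DirectSum.induction_on with
      | zero => simp
      | of i p =>
        rw [← DirectSum.lof_eq_of R, primG_inr]
        exact h i p
      | add z w hz hw => simp only [map_add, hz, hw]; abel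
  have hiso : IsIso A.X.primHom := isIso_of_bijective _ A.X.primHom_bijective
  exact ⟨Comon.mkIso (M := (tcmC R).obj A.X.primMod) (@asIso _ _ _ _ A.X.primHom hiso)
    (hom_initial_unique _ _) hcomul⟩

end ConnGrAlg

/-! ### Locally cyclic graded modules -/

namespace PosGrMod

variable {R : Type u} [CommRing R]

section GradedModules

theorem isZero_of_forall_subsingleton {N : PosGrMod R} (h : ∀ i, Subsingleton (N i)) :
    IsZero N where
  unique_to _ := ⟨⟨⟨fun _ => 0⟩, fun _ => funext fun i =>
    ((ModuleCat.isZero_iff_subsingleton.2 (h i)).eq_of_src _ _)⟩⟩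
  unique_from _ := ⟨⟨⟨fun _ => 0⟩, fun _ => funext fun i =>
    ((ModuleCat.isZero_iff_subsingleton.2 (h i)).eq_of_tgt _ _)⟩⟩

theorem subsingleton_of_isZero {N : PosGrMod R} (h : IsZero N) (i : ℕ+) : Subsingleton (N i) := by
  have h1 : 𝟙 N = fun _ => 0 := h.eq_of_src _ _
  refine subsingleton_of_forall_eq 0 fun x => ?_
  exact congrArg (fun f : N ⟶ N => f i x) h1

/-- A graded module concentrated in degree `n` is isomorphic to `M[n]`. -/
theorem nonempty_iso_shift {N : PosGrMod R} {n : ℕ+} {M : ModuleCat.{u} R}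
    (h : ∀ i ≠ n, Subsingleton (N i)) (e : N n ≅ M) : Nonempty (N ≅ shift n M) := by
  refine ⟨GradedObject.isoMk _ _ fun i => if hi : i = n then ?_ else ?_⟩
  · exact eqToIso (by rw [hi]) ≪≫ e ≪≫ (GradedObject.singleObjApplyIsoOfEq n M i hi).symm
  · exact (ModuleCat.isZero_iff_subsingleton.2 (h i hi)).isoZero ≪≫
      (isZero_zero _).isInitial.uniqueUpToIso (GradedObject.isInitialSingleObjApply n M i hi)

theorem nonempty_iso_of_iso_shift {N : PosGrMod R} {n : ℕ+} {M : ModuleCat.{u} R}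
    (e : N ≅ shift n M) : Nonempty (N n ≅ M) ∧ ∀ i ≠ n, Subsingleton (N i) := by
  have e' : ∀ i, N i ≅ shift n M i := fun i => (GradedObject.eval i).mapIso e
  refine ⟨⟨e' n ≪≫ GradedObject.singleObjApplyIso n M⟩, fun i hi => ?_⟩
  rw [← ModuleCat.isZero_iff_subsingleton]
  exact ((isZero_zero _).of_iso
    ((GradedObject.isInitialSingleObjApply n M i hi).uniqueUpToIso (isZero_zero _).isInitial)).of_iso
      (e' i)

end GradedModules

/-- The graded module `N` is, locally at the prime `𝔪`, generated by the element `y` of degree `n`,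
and `2y` vanishes locally at `𝔪` unless `n` is even. The condition is expressed in terms of scalars
outside `𝔪` rather than the localization. -/
structure IsLocallyGeneratedAt (N : PosGrMod R) (𝔪 : Ideal R) (n : ℕ+) (y : N n) : Prop where
  of_ne : ∀ i ≠ n, ∀ p : N i, ∃ s ∉ 𝔪, s • p = 0
  of_eq : ∀ p : N n, ∃ s ∉ 𝔪, ∃ a : R, s • p = a • y
  two_smul : ¬ Even (n : ℕ) → ∃ s ∉ 𝔪, s • (2 : R) • y = 0

section Localization

variable {M : Type*} [AddCommGroup M] [Module R M] (𝔪 : Ideal R) [𝔪.IsPrime]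

theorem exists_smul_eq_zero {p : M} {t : 𝔪.primeCompl}
    (h : LocalizedModule.mk p t = 0) : ∃ s ∉ 𝔪, s • p = 0 := by
  rw [← LocalizedModule.zero_mk t, LocalizedModule.mk_eq] at h
  obtain ⟨u, hu⟩ := h
  refine ⟨u * t, (u * t).2, ?_⟩
  rw [smul_zero, smul_zero] at hu
  rw [mul_smul]
  exact hu

theorem mk_eq_zero {p : M} {s : R} (hs : s ∉ 𝔪) (h : s • p = 0) (t : 𝔪.primeCompl) :
    LocalizedModule.mk p t = 0 := by
  rw [← LocalizedModule.zero_mk t, LocalizedModule.mk_eq]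
  refine ⟨⟨s, hs⟩, ?_⟩
  change s • (t : R) • p = s • (t : R) • 0
  rw [smul_comm, h, smul_zero, smul_zero]

theorem two_smul_mk (y : M) (t : 𝔪.primeCompl) :
    (2 : Localization.AtPrime 𝔪) • LocalizedModule.mk y t = LocalizedModule.mk ((2 : R) • y) t := by
  have h : (2 : Localization.AtPrime 𝔪) = Localization.mk 2 1 := by
    rw [Localization.mk_one_eq_algebraMap, map_ofNat]
  rw [h, LocalizedModule.mk_smul_mk, one_mul]

theorem quotient_smul_one {K : Type*} [CommRing K] (I : Ideal K) (c : K) :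
    c • (1 : K ⧸ I) = Ideal.Quotient.mk I c := by
  rw [Algebra.smul_def, mul_one]
  rfl

theorem subsingleton_localizedModule (h : ∀ p : M, ∃ s ∉ 𝔪, s • p = 0) :
    Subsingleton (LocalizedModule 𝔪.primeCompl M) := by
  refine subsingleton_of_forall_eq 0 fun x => ?_
  induction x using LocalizedModule.induction_on with
  | _ p t =>
    obtain ⟨s, hs, hp⟩ := h p
    exact mk_eq_zero 𝔪 hs hp t

end Localization

/-- A generator of `N_𝔪` can be cleared of its denominator, and `R_𝔪 / 𝔞_𝔪` has characteristic `2`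
if and only if its generator is killed by `2`. -/
theorem IsLocallyAtMostSinglyGenerated.exists_isLocallyGeneratedAt {N : PosGrMod R}
    (h : IsLocallyAtMostSinglyGenerated N) (𝔪 : Ideal R) [𝔪.IsMaximal] :
    ∃ n y, IsLocallyGeneratedAt N 𝔪 n y := by
  have hz : ∀ i, Subsingleton (localization 𝔪 N i) → ∀ p : N i, ∃ s ∉ 𝔪, s • p = 0 := by
    intro i hi p
    exact exists_smul_eq_zero 𝔪 (p := p) (t := 1) (hi.elim (α := LocalizedModule 𝔪.primeCompl (N i))
      _ _)
  rcases h 𝔪 with h0 | ⟨𝔞, n, -, hn, ⟨e⟩⟩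
  · have h1 : ∀ i, ∀ p : N i, ∃ s ∉ 𝔪, s • p = 0 := fun i => hz i (subsingleton_of_isZero h0 i)
    -- Degree `2` is arbitrary, but even: then nothing is required of `2y`.
    refine ⟨2, 0, fun i _ => h1 i, fun p => ?_, fun h => absurd even_two h⟩
    obtain ⟨s, hs, hp⟩ := h1 2 p
    exact ⟨s, hs, 0, by rw [hp, zero_smul]⟩
  · obtain ⟨⟨e⟩, h1⟩ := nonempty_iso_of_iso_shift e
    let E : LocalizedModule 𝔪.primeCompl (N n) ≃ₗ[Localization.AtPrime 𝔪]
        (Localization.AtPrime 𝔪 ⧸ 𝔞.map (algebraMap R (Localization.AtPrime 𝔪))) :=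
      e.toLinearEquiv
    obtain ⟨y, t, hy⟩ : ∃ y t, E.symm 1 = LocalizedModule.mk y t := by
      generalize E.symm 1 = x
      induction x using LocalizedModule.induction_on with
      | _ y t => exact ⟨y, t, rfl⟩
    refine ⟨n, y, fun i hi => hz i (h1 i hi), fun p => ?_, fun hodd => ?_⟩
    · obtain ⟨c, hc⟩ := Ideal.Quotient.mk_surjective (E (LocalizedModule.mk p 1))
      have h2 : LocalizedModule.mk p 1 = c • LocalizedModule.mk y t := by
        rw [← hy, ← map_smul]
        apply E.injective
        rw [E.apply_symm_apply, ← hc]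
        exact (quotient_smul_one _ c).symm
      obtain ⟨a, s, rfl⟩ := IsLocalization.exists_mk'_eq 𝔪.primeCompl c
      rw [← Localization.mk_eq_mk', LocalizedModule.mk_smul_mk, LocalizedModule.mk_eq] at h2
      obtain ⟨u, hu⟩ := h2
      refine ⟨u * (s * t), (u * (s * t)).2, u * a, ?_⟩
      rw [one_smul] at hu
      rw [mul_smul (u : R), mul_smul (u : R)]
      exact hu
    · have h2 : (2 : Localization.AtPrime 𝔪 ⧸
          𝔞.map (algebraMap R (Localization.AtPrime 𝔪))) = 0 := by
        by_contra hne
        refine hodd (hn fun hchar => hne ?_)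
        have h3 := ringChar.Nat.cast_ringChar (R := Localization.AtPrime 𝔪 ⧸
          𝔞.map (algebraMap R (Localization.AtPrime 𝔪)))
        rw [hchar] at h3
        exact_mod_cast h3
      have h3 : LocalizedModule.mk ((2 : R) • y) t = 0 := by
        rw [← two_smul_mk, ← hy, ← map_smul]
        have h5 : (2 : Localization.AtPrime 𝔪) • (1 : Localization.AtPrime 𝔪 ⧸
            𝔞.map (algebraMap R (Localization.AtPrime 𝔪))) = 0 := by
          refine (quotient_smul_one _ _).trans ?_
          rw [map_ofNat]
          exact h2
        rw [h5, map_zero]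
      exact exists_smul_eq_zero 𝔪 h3

/-- If `y` generates `N` locally at `𝔪`, then `N_𝔪` is the quotient of `R_𝔪` by the annihilator of
`y`, which is extended from its contraction to `R`. -/
theorem isLocallyAtMostSinglyGenerated {N : PosGrMod R}
    (h : ∀ (𝔪 : Ideal R) [𝔪.IsMaximal], ∃ n y, IsLocallyGeneratedAt N 𝔪 n y) :
    IsLocallyAtMostSinglyGenerated N := by
  intro 𝔪 _
  obtain ⟨n, y, hy⟩ := h 𝔪
  have hne : ∀ i ≠ n, Subsingleton (localization 𝔪 N i) := fun i hi =>
    subsingleton_localizedModule (M := N i) 𝔪 (hy.of_ne i hi)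
  let x : LocalizedModule 𝔪.primeCompl (N n) := LocalizedModule.mk y 1
  let T := LinearMap.toSpanSingleton (Localization.AtPrime 𝔪) (LocalizedModule 𝔪.primeCompl (N n)) x
  have hT : Function.Surjective T := by
    intro z
    induction z using LocalizedModule.induction_on with
    | _ p t =>
      obtain ⟨s, hs, a, hp⟩ := hy.of_eq p
      refine ⟨Localization.mk a (⟨s, hs⟩ * t), ?_⟩
      change Localization.mk a (⟨s, hs⟩ * t) • LocalizedModule.mk y (1 : 𝔪.primeCompl) =
        LocalizedModule.mk p t
      rw [LocalizedModule.mk_smul_mk, LocalizedModule.mk_eq]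
      refine ⟨1, ?_⟩
      rw [one_smul, one_smul, mul_one, ← hp]
      change (t : R) • s • p = (s * (t : R)) • p
      rw [← mul_smul, mul_comm]
  by_cases hx : x = 0
  · left
    refine isZero_of_forall_subsingleton fun i => ?_
    by_cases hi : i = n
    · subst hi
      refine subsingleton_of_forall_eq 0 fun (z : LocalizedModule 𝔪.primeCompl (N i)) => ?_
      obtain ⟨c, hc⟩ := hT z
      rw [← hc]
      change c • x = 0
      rw [hx, smul_zero]
    · exact hne i hi
  · right
    let I : Ideal (Localization.AtPrime 𝔪) := LinearMap.ker T
    have hI : (I.comap (algebraMap R (Localization.AtPrime 𝔪))).map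
        (algebraMap R (Localization.AtPrime 𝔪)) = I :=
      IsLocalization.map_under 𝔪.primeCompl _ I
    have hI1 : (1 : Localization.AtPrime 𝔪) ∉ I := by
      intro h1
      apply hx
      have h2 : (1 : Localization.AtPrime 𝔪) • x = 0 := h1
      rwa [one_smul] at h2
    have : Nontrivial (Localization.AtPrime 𝔪 ⧸ I) :=
      Ideal.Quotient.nontrivial_iff.2 fun h => hI1 (h ▸ trivial)
    refine ⟨I.comap (algebraMap R (Localization.AtPrime 𝔪)), n, ?_, ?_, ?_⟩
    · intro r hr
      by_contra hrm
      have hu : IsUnit (algebraMap R (Localization.AtPrime 𝔪) r) :=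
        IsLocalization.map_units (M := 𝔪.primeCompl) _ ⟨r, hrm⟩
      exact hI1 ((I.eq_top_of_isUnit_mem hr hu) ▸ trivial)
    · rw [hI]
      intro hchar
      by_contra hodd
      obtain ⟨s, hs, h2y⟩ := hy.two_smul hodd
      refine hchar (CharP.ringChar_of_prime_eq_zero Nat.prime_two ?_)
      have h2 : (2 : Localization.AtPrime 𝔪) ∈ I := by
        have h3 : (2 : Localization.AtPrime 𝔪) • x = 0 :=
          (two_smul_mk 𝔪 y 1).trans (mk_eq_zero 𝔪 hs h2y 1)
        exact h3
      have h3 := Ideal.Quotient.eq_zero_iff_mem.2 h2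
      rw [map_ofNat] at h3
      exact_mod_cast h3
    · rw [hI]
      exact nonempty_iso_shift (N := localization 𝔪 N) hne
        (LinearEquiv.toModuleIso (T.quotKerEquivOfSurjective hT)).symm

end PosGrMod

/-! ### Graded commutativity of tensor algebras -/

namespace PosGrMod

open ConnGrAlg

variable {R : Type u} [CommRing R] {N : PosGrMod R}

/-- If `N` is locally generated by one element `y`, then any two generators of `T(N)` are locally
multiples of `y`, hence commute up to sign. -/
theorem gensCommute_of_isLocallyGeneratedAt
    (h : ∀ (𝔪 : Ideal R) [𝔪.IsMaximal], ∃ n y, IsLocallyGeneratedAt N 𝔪 n y) :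
    GensCommute N := by
  intro i j p q
  rw [← sub_eq_zero]
  refine eq_zero_of_forall_isMaximal (R := R) ?_
  intro 𝔪 hm
  have hmul : ∀ s ∉ 𝔪, ∀ t ∉ 𝔪, s * t ∉ 𝔪 := fun s hs t ht =>
    hm.isPrime.mul_notMem hs ht
  obtain ⟨n, y, hy⟩ := h 𝔪
  by_cases hi : i = n
  swap
  · obtain ⟨s, hs, hp⟩ := hy.of_ne i hi p
    refine ⟨s, hs, ?_⟩
    rw [smul_sub, ← smul_mul_assoc, ← mul_smul_comm, ← mul_smul_comm, ← map_smul, hp]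
    simp
  by_cases hj : j = n
  swap
  · obtain ⟨s, hs, hq⟩ := hy.of_ne j hj q
    refine ⟨s, hs, ?_⟩
    rw [smul_sub, ← mul_smul_comm, ← mul_smul_comm, ← smul_mul_assoc, ← map_smul, hq]
    simp
  subst hi
  subst hj
  obtain ⟨s, hs, a, hp⟩ := hy.of_eq p
  obtain ⟨t, ht, b, hq⟩ := hy.of_eq q
  have h1 : (s * t) • (tgen N j p * tgen N j q) = (a * b) • (tgen N j y * tgen N j y) := by
    rw [← smul_mul_smul_comm, ← map_smul, ← map_smul, hp, hq, map_smul, map_smul,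
      smul_mul_smul_comm]
  have h2 : (s * t) • (tgen N j q * tgen N j p) = (a * b) • (tgen N j y * tgen N j y) := by
    rw [mul_comm s t, mul_comm a b, ← smul_mul_smul_comm, ← map_smul, ← map_smul, hp, hq,
      map_smul, map_smul, smul_mul_smul_comm]
  by_cases hn : Even (j : ℕ)
  · refine ⟨s * t, hmul s hs t ht, ?_⟩
    rw [(hn.mul_left _).neg_one_pow, one_mul, smul_sub, h1, h2, sub_self]
  · obtain ⟨r, hr, h2y⟩ := hy.two_smul hn
    have hodd := Nat.not_even_iff_odd.1 hn
    refine ⟨r * (s * t), hmul r hr _ (hmul s hs t ht), ?_⟩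
    have h3 : r • (2 : R) • tgen N j y = 0 := by
      rw [← map_smul, ← map_smul, h2y, map_zero]
    rw [(hodd.mul hodd).neg_one_pow, neg_one_mul, sub_neg_eq_add, mul_smul, smul_add, h1, h2,
      ← two_smul R, smul_comm (2 : R), smul_comm r, ← smul_mul_assoc, ← smul_mul_assoc, h3, zero_mul,
      smul_zero]

section Functionals

variable {K : Type*} [CommRing K] [Algebra R K]

/-- Graded commutativity of `T(N)`, tested by the homomorphism to strictly upper triangular
matrices which sends a generator `p` to `φ(p) E₁₂ + ψ(p) E₂₃`. -/
theorem GensCommute.mul_eq (h : GensCommute N) (φ ψ : ∀ i, N i →ₗ[R] K) (i j : ℕ+) (p : N i)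
    (q : N j) : φ i p * ψ j q = (-1) ^ ((i : ℕ) * j) * (φ j q * ψ i p) := by
  let g : ∀ i, N i →ₗ[R] Matrix (Fin 3) (Fin 3) K := fun i =>
    { toFun := fun p => !![0, φ i p, 0; 0, 0, ψ i p; 0, 0, 0]
      map_add' := fun a b => by ext k l; fin_cases k <;> fin_cases l <;> simp
      map_smul' := fun r a => by ext k l; fin_cases k <;> fin_cases l <;> simp }
  have hg : ∀ (i j : ℕ+) (p : N i) (q : N j), (g i p * g j q) 0 2 = φ i p * ψ j q := by
    intro i j p q
    simp [g, Matrix.mul_apply, Fin.sum_univ_three]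
  have h1 := congrArg (fun x => tlift N g x 0 2) (h i j p q)
  simp only [map_mul, map_pow, map_neg, map_one, tlift_tgen] at h1
  rw [hg] at h1
  rw [h1]
  rcases neg_one_pow_eq_or K ((i : ℕ) * j) with hs | hs <;>
    rcases Nat.even_or_odd ((i : ℕ) * j) with he | he
  · rw [he.neg_one_pow, he.neg_one_pow, one_mul, one_mul, hg]
  · rw [he.neg_one_pow, he.neg_one_pow, neg_one_mul, neg_one_mul, Matrix.neg_apply, hg]
  · rw [he.neg_one_pow, he.neg_one_pow, one_mul, one_mul, hg]
  · rw [he.neg_one_pow, he.neg_one_pow, neg_one_mul, neg_one_mul, Matrix.neg_apply, hg]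

/-- The family of functionals which is `φ` in degree `n` and zero in the other degrees. -/
def singleFunctional {n : ℕ+} (φ : N n →ₗ[R] K) (i : ℕ+) : N i →ₗ[R] K :=
  if h : i = n then φ ∘ₗ (eqToHom (congrArg N h)).hom else 0

theorem singleFunctional_self {n : ℕ+} (φ : N n →ₗ[R] K) (p : N n) :
    singleFunctional φ n p = φ p := by
  simp [singleFunctional]

theorem singleFunctional_of_ne {n i : ℕ+} (φ : N n →ₗ[R] K) (h : i ≠ n) (p : N i) :
    singleFunctional φ i p = 0 := by
  simp [singleFunctional, h]

theorem GensCommute.mul_eq_zero_of_ne (h : GensCommute N) {i j : ℕ+} (hij : i ≠ j)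
    (φ : N i →ₗ[R] K) (ψ : N j →ₗ[R] K) (p : N i) (q : N j) : φ p * ψ q = 0 := by
  have h1 := h.mul_eq (singleFunctional φ) (singleFunctional ψ) i j p q
  rwa [singleFunctional_self, singleFunctional_self, singleFunctional_of_ne φ hij.symm, zero_mul,
    mul_zero] at h1

theorem GensCommute.mul_eq_self (h : GensCommute N) {n : ℕ+}
    (φ ψ : N n →ₗ[R] K) (p q : N n) : φ p * ψ q = (-1) ^ (n : ℕ) * (φ q * ψ p) := by
  have h1 := h.mul_eq (singleFunctional φ) (singleFunctional ψ) n n p q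
  have h2 : (-1 : K) ^ ((n : ℕ) * n) = (-1) ^ (n : ℕ) := by
    rcases Nat.even_or_odd (n : ℕ) with hn | hn
    · rw [hn.neg_one_pow, (hn.mul_left _).neg_one_pow]
    · rw [hn.neg_one_pow, (hn.mul hn).neg_one_pow]
  rwa [singleFunctional_self, singleFunctional_self, singleFunctional_self,
    singleFunctional_self, h2] at h1

end Functionals

/-- A form of Nakayama's lemma for the quotients `M ⧸ S`: if every functional `M ⧸ S → R ⧸ 𝔪`
vanishes, then `M ⧸ S` is killed by a scalar outside `𝔪`. It holds for finitely generated `M`, and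
for every `M` if `𝔪 = 0`. -/
def HasNakayama (𝔪 : Ideal R) (M : Type*) [AddCommGroup M] [Module R M] : Prop :=
  ∀ S : Submodule R M, (∀ ψ : M ⧸ S →ₗ[R] R ⧸ 𝔪, ψ = 0) → ∃ s ∉ 𝔪, ∀ p : M, s • p ∈ S

section Nakayama

variable {M : Type*} [AddCommGroup M] [Module R M]

theorem mem_smul_top_of_forall_functional (𝔪 : Ideal R) [𝔪.IsMaximal]
    (h : ∀ ψ : M →ₗ[R] R ⧸ 𝔪, ψ = 0) (p : M) : p ∈ 𝔪 • (⊤ : Submodule R M) := by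
  let _ : Field (R ⧸ 𝔪) := Ideal.Quotient.field 𝔪
  rw [← Submodule.Quotient.mk_eq_zero]
  refine (Module.forall_dual_apply_eq_zero_iff (R ⧸ 𝔪) _).1 fun φ => ?_
  exact LinearMap.congr_fun (h (φ.restrictScalars R ∘ₗ Submodule.mkQ _)) p

theorem hasNakayama_of_finite (𝔪 : Ideal R) [hm : 𝔪.IsMaximal] [Module.Finite R M] :
    HasNakayama 𝔪 M := by
  intro S h
  obtain ⟨s, hs1, hs⟩ := Submodule.exists_sub_one_mem_and_smul_eq_zero_of_fg_of_le_smul 𝔪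
    (⊤ : Submodule R (M ⧸ S)) Module.Finite.fg_top
    (fun p _ => mem_smul_top_of_forall_functional 𝔪 h p)
  refine ⟨s, fun hsm => hm.ne_top ((Ideal.eq_top_iff_one _).2 ?_), fun p => ?_⟩
  · simpa using sub_mem hsm hs1
  · rw [← Submodule.Quotient.mk_eq_zero, Submodule.Quotient.mk_smul]
    exact hs _ trivial

theorem hasNakayama_bot (h : (⊥ : Ideal R).IsMaximal) : HasNakayama (⊥ : Ideal R) M := by
  intro S hS
  refine ⟨1, fun h1 => h.ne_top ((Ideal.eq_top_iff_one _).2 h1), fun p => ?_⟩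
  have h1 := mem_smul_top_of_forall_functional (⊥ : Ideal R) hS (Submodule.Quotient.mk p)
  rw [Submodule.bot_smul, Submodule.mem_bot, Submodule.Quotient.mk_eq_zero] at h1
  rwa [one_smul]

end Nakayama

/-- If `T(N)` is graded commutative, then `N` is locally generated by one element: over the residue
field, two functionals on `N` satisfy `φ(p) ψ(q) = ± φ(q) ψ(p)`, so the fibre of `N` has dimension
at most one. For odd degree the same identity with `φ = ψ` has sign `-1` and shows `2y = 0`
locally. -/
theorem GensCommute.exists_isLocallyGeneratedAt (h : GensCommute N) (𝔪 : Ideal R)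
    [hm : 𝔪.IsMaximal] (hN : ∀ i, HasNakayama 𝔪 (N i)) :
    ∃ n y, IsLocallyGeneratedAt N 𝔪 n y := by
  let _ : Field (R ⧸ 𝔪) := Ideal.Quotient.field 𝔪
  have hkill : ∀ i, (∀ ψ : N i →ₗ[R] R ⧸ 𝔪, ψ = 0) → ∀ p : N i, ∃ s ∉ 𝔪, s • p = 0 := by
    intro i hψ p
    obtain ⟨s, hs, hp⟩ := hN i ⊥ fun ψ => by
      refine LinearMap.ext fun x => ?_
      obtain ⟨x, rfl⟩ := Submodule.mkQ_surjective _ x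
      exact LinearMap.congr_fun (hψ (ψ ∘ₗ Submodule.mkQ _)) x
    exact ⟨s, hs, hp p⟩
  by_cases hall : ∀ i, ∀ ψ : N i →ₗ[R] R ⧸ 𝔪, ψ = 0
  · -- Degree `2` is arbitrary, but even: then nothing is required of `2y`.
    refine ⟨2, 0, fun i _ => hkill i (hall i), fun p => ?_, fun h => absurd even_two h⟩
    obtain ⟨s, hs, hp⟩ := hkill 2 (hall 2) p
    exact ⟨s, hs, 0, by rw [hp, zero_smul]⟩
  push Not at hall
  obtain ⟨n, φ, hφ⟩ := hall
  obtain ⟨y, hy⟩ : ∃ y, φ y ≠ 0 := by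
    by_contra hcon
    push Not at hcon
    exact hφ (LinearMap.ext hcon)
  have hgen : ∃ s ∉ 𝔪, ∀ p : N n, s • p ∈ Submodule.span R {y} := by
    refine hN n _ fun ψ => ?_
    refine LinearMap.ext fun x => ?_
    obtain ⟨q, rfl⟩ := Submodule.mkQ_surjective _ x
    have h1 := h.mul_eq_self φ (ψ ∘ₗ Submodule.mkQ _) y q
    have h2 : (ψ ∘ₗ Submodule.mkQ (Submodule.span R {y})) y = 0 := by
      rw [LinearMap.comp_apply, Submodule.mkQ_apply,
        (Submodule.Quotient.mk_eq_zero _).2 (Submodule.mem_span_singleton_self y), map_zero]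
    rw [h2, mul_zero, mul_zero] at h1
    exact (mul_eq_zero.1 h1).resolve_left hy
  obtain ⟨s, hs, hsp⟩ := hgen
  refine ⟨n, y, fun i hi => hkill i fun ψ => ?_, fun p => ?_, fun hodd => ?_⟩
  · refine LinearMap.ext fun q => ?_
    exact (mul_eq_zero.1 (h.mul_eq_zero_of_ne hi.symm φ ψ y q)).resolve_left hy
  · obtain ⟨a, ha⟩ := Submodule.mem_span_singleton.1 (hsp p)
    exact ⟨s, hs, a, ha.symm⟩
  · -- The functional `q ↦ a` with `s q = a y` takes values in `R ⧸ Ann(y)`, and maps `y` to `s`.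
    let T := LinearMap.toSpanSingleton R (N n) y
    have hT : ∀ p : N n, s • p ∈ LinearMap.range T := by
      intro p
      obtain ⟨a, ha⟩ := Submodule.mem_span_singleton.1 (hsp p)
      exact ⟨a, ha⟩
    let χ : N n →ₗ[R] R ⧸ LinearMap.ker T := T.quotKerEquivRange.symm.toLinearMap ∘ₗ
      (s • LinearMap.id).codRestrict (LinearMap.range T) hT
    have hχ : χ y = Ideal.Quotient.mk (LinearMap.ker T) s := by
      have h1 : (s • LinearMap.id).codRestrict (LinearMap.range T) hT y =
          T.quotKerEquivRange (Submodule.Quotient.mk s) := Subtype.ext rfl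
      rw [LinearMap.comp_apply, h1]
      exact T.quotKerEquivRange.symm_apply_apply _
    have h1 := GensCommute.mul_eq_self (K := R ⧸ (LinearMap.ker T : Ideal R)) h χ χ y y
    rw [(Nat.not_even_iff_odd.1 hodd).neg_one_pow, neg_one_mul, eq_neg_iff_add_eq_zero, hχ,
      ← map_mul, ← map_add, Ideal.Quotient.eq_zero_iff_mem] at h1
    refine ⟨s * s, hm.isPrime.mul_notMem hs hs, ?_⟩
    have h2 : (s * s + s * s) • y = 0 := h1
    rw [smul_smul, mul_two]
    exact h2

end PosGrMod

/-! ### Commutative cogroups -/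

namespace PosGrMod

open ConnGrAlg

variable {R : Type u} [CommRing R]

/-- A scalar outside `𝔪` can be chosen uniformly in the element which it kills. -/
theorem HasNakayama.exists_smul_eq_zero {M : Type*} [AddCommGroup M] [Module R M] {𝔪 : Ideal R}
    [hm : 𝔪.IsMaximal] (hM : HasNakayama 𝔪 M) (h : ∀ p : M, ∃ s ∉ 𝔪, s • p = 0) :
    ∃ s ∉ 𝔪, ∀ p : M, s • p = 0 := by
  obtain ⟨s, hs, h1⟩ := hM ⊥ fun ψ => by
    refine LinearMap.ext fun x => ?_
    obtain ⟨p, rfl⟩ := Submodule.mkQ_surjective _ x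
    obtain ⟨t, ht, hp⟩ := h p
    have h2 : Ideal.Quotient.mk 𝔪 t * ψ (Submodule.mkQ _ p) = 0 := by
      have h3 := map_smul ψ t (Submodule.mkQ ⊥ p)
      rw [← map_smul, hp, map_zero, map_zero, Algebra.smul_def] at h3
      exact h3.symm
    exact (mul_eq_zero.1 h2).resolve_left fun h0 => ht (Ideal.Quotient.eq_zero_iff_mem.1 h0)
  exact ⟨s, hs, h1⟩

end PosGrMod

namespace ConnGrAlg

open PosGrMod

variable {R : Type u} [CommRing R]

theorem gensCommute_primMod {A : ConnGrAlg R} [ComonObj A] (h : A.IsGradedCommutative) :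
    GensCommute A.primMod := by
  intro i j p q
  apply A.primHom_bijective.1
  simp only [map_mul, map_pow, map_neg, map_one, primHom_tgen]
  exact h i j _ (A.primIncl_mem i p) _ (A.primIncl_mem j q)

/-- If the generators of `A` are locally generated by a single element, of degree `n` say, then
they are primitive: locally, all generators of degree less than `n` vanish, hence so does
`A` in degrees strictly between `0` and `n`. -/
theorem isPrimitive_primIncl (A : ConnGrAlg R) [ComonObj A]
    (hA : ∀ (𝔪 : Ideal R) [𝔪.IsMaximal] (i), HasNakayama 𝔪 (A.primMod i))
    (h : ∀ (𝔪 : Ideal R) [𝔪.IsMaximal], ∃ n y, IsLocallyGeneratedAt A.primMod 𝔪 n y) (i : ℕ+)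
    (p : A.primMod i) : A.IsPrimitive (A.primIncl i p) := by
  rw [IsPrimitive, ← sub_eq_zero]
  refine eq_zero_of_forall_isMaximal (R := R) ?_
  intro 𝔪 hm
  obtain ⟨n, y, hy⟩ := h 𝔪
  by_cases hi : i = n
  · subst hi
    have hkill : ∀ k : ℕ, k < i → ∃ s ∉ 𝔪, k ≠ 0 → ∀ a ∈ A.gr k, s • A.primProj a = 0 := by
      intro k hk
      rcases Nat.eq_zero_or_pos k with rfl | hpos
      · exact ⟨1, hm.isPrime.one_notMem, fun h => absurd rfl h⟩
      · have hne : (⟨k, hpos⟩ : ℕ+) ≠ i := fun h => hk.ne (congrArg PNat.val h)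
        obtain ⟨s, hs, h1⟩ := (hA 𝔪 ⟨k, hpos⟩).exists_smul_eq_zero (hy.of_ne _ hne)
        refine ⟨s, hs, fun _ a ha => ?_⟩
        obtain ⟨q, hq⟩ := A.exists_primIncl (i := ⟨k, hpos⟩) ha
        rw [← hq, ← map_smul, h1, map_zero]
    choose s hs hsk using hkill
    refine ⟨∏ k : Fin i, s k k.2, ?_, ?_⟩
    · rw [hm.isPrime.prod_mem_iff]
      rintro ⟨k, -, hk⟩
      exact hs k k.2 hk
    · rw [smul_sub, sub_eq_zero]
      refine A.smul_comul_eq i.pos.ne' ?_ (A.primIncl_mem i p)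
      intro k hk0 hk a ha
      rw [← Finset.prod_erase_mul _ _ (Finset.mem_univ (⟨k, hk⟩ : Fin i)), mul_smul,
        hsk k hk hk0 a ha, smul_zero]
  · obtain ⟨s, hs, hp⟩ := hy.of_ne i hi p
    refine ⟨s, hs, ?_⟩
    have h1 : ∀ f : A ⟶ A ⨿ A, s • toAlgHom f (A.primIncl i p) = 0 := fun f => by
      rw [← map_smul, ← map_smul, hp, map_zero, map_zero]
    rw [smul_sub, smul_add, h1, h1, h1, add_zero, sub_zero]

theorem IsGradedCommutative.exists_isLocallyGeneratedAt {A : ConnGrAlg R} [ComonObj A]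
    (h : A.IsGradedCommutative)
    (hA : ∀ (𝔪 : Ideal R) [𝔪.IsMaximal] (i), HasNakayama 𝔪 (A.primMod i))
    (𝔪 : Ideal R) [𝔪.IsMaximal] : ∃ n y, IsLocallyGeneratedAt A.primMod 𝔪 n y :=
  (gensCommute_primMod h).exists_isLocallyGeneratedAt 𝔪 (hA 𝔪)

theorem IsGradedCommutative.nonempty_iso {A : Comon (ConnGrAlg R)} (h : A.X.IsGradedCommutative)
    (hA : ∀ (𝔪 : Ideal R) [𝔪.IsMaximal] (i), HasNakayama 𝔪 (A.X.primMod i)) :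
    Nonempty ((tcmC R).obj A.X.primMod ≅ A) :=
  nonempty_iso_of_isPrimitive A (A.X.isPrimitive_primIncl hA (h.exists_isLocallyGeneratedAt hA))

theorem IsFiniteType.primMod {A : ConnGrAlg R} [ComonObj A] (h : A.IsFiniteType) :
    PosGrMod.IsFiniteType A.primMod := fun i =>
  have := h i
  Module.Finite.map (A.gr i) A.primProj

end ConnGrAlg

namespace PosGrMod

open ConnGrAlg

variable {R : Type u} [CommRing R]

theorem isCommCogroup_tcmC {N : PosGrMod R}
    (h : ∀ (𝔪 : Ideal R) [𝔪.IsMaximal], ∃ n y, IsLocallyGeneratedAt N 𝔪 n y) :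
    IsCommCogroup ((tcmC R).obj N) :=
  ⟨isCogroup_tcmC N, (gensCommute_of_isLocallyGeneratedAt h).isGradedCommutative⟩

/-- A word of positive degree has a first letter. -/
theorem tensorTriv_gr_succ (N : PosGrMod R) (n : ℕ) :
    (tensorTriv N).gr (n + 1) =
      ⨆ k : Fin (n + 1), LinearMap.range (tgen N (k : ℕ).succPNat) * (tensorTriv N).gr (n - k) := by
  apply le_antisymm
  · have key : ∀ (m : ℕ) (x : (tensorTriv N).carrier), x ∈ (tensorTriv N).gr m →
        ∀ n, m = n + 1 → x ∈ ⨆ k : Fin (n + 1),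
          LinearMap.range (tgen N (k : ℕ).succPNat) * (tensorTriv N).gr (n - k) := by
      intro m x hx
      induction hx using tensorTriv_induction with
      | zero m => intro n _; exact zero_mem _
      | one => intro n hn; omega
      | add m v w _ _ hv hw => intro n hn; exact add_mem (hv n hn) (hw n hn)
      | smul m r w _ hw => intro n hn; exact Submodule.smul_mem _ _ (hw n hn)
      | gen_mul i m y w hw _ =>
        intro n hn
        obtain ⟨k, rfl⟩ : ∃ k : ℕ, k.succPNat = i := ⟨_, i.succPNat_natPred⟩
        rw [Nat.succPNat_coe] at hn
        refine Submodule.mem_iSup_of_mem ⟨k, by omega⟩ (Submodule.mul_mem_mul ⟨y, rfl⟩ ?_)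
        have h1 : n - k = m := by omega
        exact h1.symm ▸ hw
    intro x hx
    exact key _ x hx n rfl
  · refine iSup_le fun k => Submodule.mul_le.2 ?_
    rintro _ ⟨y, rfl⟩ x hx
    have h := SetLike.GradedMul.mul_mem (tgen_mem N _ y) hx
    have hk : ((k : ℕ).succPNat : ℕ) + (n - k) = n + 1 := by
      rw [Nat.succPNat_coe]; omega
    rwa [hk] at h

theorem IsFiniteType.tensorTriv {N : PosGrMod R} (h : IsFiniteType N) :
    (tensorTriv N).IsFiniteType := by
  intro n
  rw [Module.Finite.iff_fg]
  induction n using Nat.strong_induction_on with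
  | _ n ih =>
    rcases n with _ | n
    · have h0 : (PosGrMod.tensorTriv N).gr 0 =
          LinearMap.range (Algebra.linearMap R (PosGrMod.tensorTriv N).carrier) := by
        apply le_antisymm
        · intro x hx
          exact ⟨_, algebraMap_augmentation_of_mem _ hx⟩
        · rintro _ ⟨r, rfl⟩
          exact SetLike.algebraMap_mem_graded _ r
      rw [h0]
      exact Module.Finite.iff_fg.1 inferInstance
    · rw [tensorTriv_gr_succ]
      refine Submodule.fg_iSup _ fun k => ?_
      have := h (k : ℕ).succPNat
      exact (Module.Finite.iff_fg.1 inferInstance).mul (ih _ (by omega))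

section Field

variable {N : PosGrMod R}

theorem isZeroOrFreeOnOne_of_isLocallyGeneratedAt (hR : IsField R) {n : ℕ+} {y : N n}
    (hy : IsLocallyGeneratedAt N ⊥ n y) : IsZeroOrFreeOnOne N := by
  have hinv : ∀ s : R, s ∉ (⊥ : Ideal R) → ∃ t, t * s = 1 := by
    intro s hs
    obtain ⟨t, ht⟩ := hR.mul_inv_cancel hs
    exact ⟨t, by rw [mul_comm, ht]⟩
  have hne : ∀ i ≠ n, Subsingleton (N i) := fun i hi =>
    subsingleton_of_forall_eq 0 fun p => by
      obtain ⟨s, hs, hp⟩ := hy.of_ne i hi p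
      obtain ⟨t, ht⟩ := hinv s hs
      rw [← one_smul R p, ← ht, mul_smul, hp, smul_zero]
  have hgen : ∀ p : N n, ∃ a : R, a • y = p := by
    intro p
    obtain ⟨s, hs, a, hp⟩ := hy.of_eq p
    obtain ⟨t, ht⟩ := hinv s hs
    exact ⟨t * a, by rw [mul_smul, ← hp, ← mul_smul, ht, one_smul]⟩
  by_cases h0 : y = 0
  · left
    refine isZero_of_forall_subsingleton fun i => ?_
    by_cases hi : i = n
    · subst hi
      refine subsingleton_of_forall_eq 0 fun p => ?_
      obtain ⟨a, rfl⟩ := hgen p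
      rw [h0, smul_zero]
    · exact hne i hi
  · right
    have hcancel : ∀ a : R, a • y = 0 → a = 0 := by
      intro a ha
      by_contra hcon
      obtain ⟨t, ht⟩ := hinv a hcon
      exact h0 (by rw [← one_smul R y, ← ht, mul_smul, ha, smul_zero])
    refine ⟨n, fun hchar => ?_, ?_⟩
    · by_contra hodd
      obtain ⟨s, hs, h2⟩ := hy.two_smul hodd
      refine hchar ?_
      have := hR.nontrivial
      refine CharP.ringChar_of_prime_eq_zero Nat.prime_two ?_
      obtain ⟨t, ht⟩ := hinv s hs
      refine hcancel _ ?_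
      rw [← one_smul R ((_ : R) • y), ← ht, mul_smul, Nat.cast_ofNat, h2, smul_zero]
    · refine nonempty_iso_shift hne (LinearEquiv.toModuleIso (LinearEquiv.ofBijective
        (LinearMap.toSpanSingleton R (N n) y) ⟨?_, hgen⟩)).symm
      exact (injective_iff_map_eq_zero _).2 hcancel

theorem IsZeroOrFreeOnOne.exists_isLocallyGeneratedAt (h : IsZeroOrFreeOnOne N) (𝔪 : Ideal R)
    [hm : 𝔪.IsMaximal] : ∃ n y, IsLocallyGeneratedAt N 𝔪 n y := by
  have h1 : (1 : R) ∉ 𝔪 := hm.isPrime.one_notMem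
  rcases h with h0 | ⟨n, hn, ⟨e⟩⟩
  · have hs := subsingleton_of_isZero h0
    -- Degree `2` is arbitrary, but even: then nothing is required of `2y`.
    exact ⟨2, 0, fun i _ p => ⟨1, h1, (hs i).elim _ _⟩, fun p => ⟨1, h1, 0, (hs 2).elim _ _⟩,
      fun h => absurd even_two h⟩
  · obtain ⟨⟨e⟩, hs⟩ := nonempty_iso_of_iso_shift e
    let E : N n ≃ₗ[R] R := e.toLinearEquiv
    refine ⟨n, E.symm 1, fun i hi p => ⟨1, h1, (hs i hi).elim _ _⟩, fun p => ⟨1, h1, E p, ?_⟩,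
      fun hodd => ⟨1, h1, ?_⟩⟩
    · rw [one_smul, ← map_smul, smul_eq_mul, mul_one, E.symm_apply_apply]
    · have hchar : ringChar R = 2 := by
        by_contra hne
        exact hodd (hn hne)
      have h2 : (2 : R) = 0 := by
        have h3 := ringChar.Nat.cast_ringChar (R := R)
        rw [hchar] at h3
        exact_mod_cast h3
      rw [h2, zero_smul, smul_zero]

end Field

end PosGrMod

theorem theorem1p4 (R : Type u) [CommRing R] :
    -- (1) fully faithful restriction `𝒮 ⥤ 𝒜_CG^co`
    (∃ h : ∀ N : (PosGrMod.IsLocallyAtMostSinglyGenerated (R := R)).FullSubcategory,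
        ConnGrAlg.IsCommCogroup ((tcmC R).obj N.obj),
      (ConnGrAlg.IsCommCogroup.lift
        (PosGrMod.IsLocallyAtMostSinglyGenerated.ι ⋙ tcmC R) h).Full ∧
      (ConnGrAlg.IsCommCogroup.lift
        (PosGrMod.IsLocallyAtMostSinglyGenerated.ι ⋙ tcmC R) h).Faithful) ∧
    -- (2) over a field, an equivalence `ℱ ⥤ 𝒜_CG^co`
    (IsField R →
      ∃ h : ∀ N : (PosGrMod.IsZeroOrFreeOnOne (R := R)).FullSubcategory,
          ConnGrAlg.IsCommCogroup ((tcmC R).obj N.obj),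
        (ConnGrAlg.IsCommCogroup.lift
          (PosGrMod.IsZeroOrFreeOnOne.ι ⋙ tcmC R) h).IsEquivalence) ∧
    -- (3) an equivalence `𝒮^ft ⥤ 𝒜_CG^{co ft}`
    (∃ h : ∀ N : (PosGrMod.IsLocallyAtMostSinglyGenerated ⊓
          PosGrMod.IsFiniteType (R := R)).FullSubcategory,
        ConnGrAlg.IsCommCogroupFT ((tcmC R).obj N.obj),
      (ConnGrAlg.IsCommCogroupFT.lift
        ((PosGrMod.IsLocallyAtMostSinglyGenerated ⊓ PosGrMod.IsFiniteType).ι ⋙ tcmC R)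
        h).IsEquivalence) := by
  refine ⟨?_, fun hR => ?_, ?_⟩
  · exact ⟨fun N => PosGrMod.isCommCogroup_tcmC fun 𝔪 _ =>
      N.property.exists_isLocallyGeneratedAt 𝔪, inferInstance, inferInstance⟩
  · refine ⟨fun N => PosGrMod.isCommCogroup_tcmC fun 𝔪 _ =>
      PosGrMod.IsZeroOrFreeOnOne.exists_isLocallyGeneratedAt N.property 𝔪, ?_⟩
    have hbot : (⊥ : Ideal R).IsMaximal := by
      let _ := hR.toField
      exact Ideal.bot_isMaximal
    refine { essSurj := ⟨fun A => ?_⟩ }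
    have hA : ∀ (𝔪 : Ideal R) [𝔪.IsMaximal] (i),
        PosGrMod.HasNakayama 𝔪 (A.obj.X.primMod i) := by
      intro 𝔪 hm i
      obtain rfl := hbot.eq_of_le hm.ne_top bot_le
      exact PosGrMod.hasNakayama_bot hbot
    obtain ⟨n, y, hy⟩ := A.property.2.exists_isLocallyGeneratedAt hA ⊥
    obtain ⟨e⟩ := A.property.2.nonempty_iso hA
    exact ⟨⟨_, PosGrMod.isZeroOrFreeOnOne_of_isLocallyGeneratedAt hR hy⟩,
      ⟨ConnGrAlg.IsCommCogroup.isoMk e⟩⟩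
  · have h (N : (PosGrMod.IsLocallyAtMostSinglyGenerated ⊓
        PosGrMod.IsFiniteType (R := R)).FullSubcategory) :
        ConnGrAlg.IsCommCogroupFT ((tcmC R).obj N.obj) :=
      ⟨PosGrMod.isCommCogroup_tcmC fun 𝔪 _ => N.property.1.exists_isLocallyGeneratedAt 𝔪,
        PosGrMod.IsFiniteType.tensorTriv N.property.2⟩
    refine ⟨h, ?_⟩
    refine { essSurj := ⟨fun A => ?_⟩ }
    have hfin : PosGrMod.IsFiniteType A.obj.X.primMod := A.property.2.primMod
    have hA : ∀ (𝔪 : Ideal R) [𝔪.IsMaximal] (i),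
        PosGrMod.HasNakayama 𝔪 (A.obj.X.primMod i) := by
      intro 𝔪 _ i
      have := hfin i
      exact PosGrMod.hasNakayama_of_finite 𝔪
    obtain ⟨e⟩ := A.property.1.2.nonempty_iso hA
    exact ⟨⟨_, PosGrMod.isLocallyAtMostSinglyGenerated fun 𝔪 _ =>
      A.property.1.2.exists_isLocallyGeneratedAt hA 𝔪, hfin⟩,
      ⟨ConnGrAlg.IsCommCogroupFT.isoMk e⟩⟩

end
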